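/- **Proposition 3.5.** Let $n\ge 2$ and let $\Omega\subset\mathbb R^n$ be a bounded open set with Lipschitz boundary. Let $\alpha\in W^{1,n}(\Omega)\cap L^\infty(\Omega)$ and let $u\in BD(\Omega)$, i.e. $u\in L^1(\Omega;\mathbb R^n)$ and the distribution $\mathrm Eu$ with components $\mathrm E_{ij}u=\tfrac12(D_ju^i+D_iu^j)$ is a bounded Radon measure on $\Omega$ with values in the symmetric matrices $\mathbb M^{n\times n}_{\rm sym}$. For $A\subset\Omega$ let $$\operatorname{Cap}_n(A,\Omega)=\inf\Big\{\int_\Omega|\nabla v|^n\,dx:\ v\in W^{1,n}_0(\Omega),\ v\ge 1\text{ a.e. in a neighbourhood of }A\Big\},$$ and let $\widetilde\alpha$ be a $\operatorname{Cap}_n$-quasicontinuous representative of $\alpha$, that is, a function $\widetilde\alpha:\Omega\to\mathbb R$ with $\widetilde\alpha=\alpha$ a.e. in $\Omega$ such that for every $\varepsilon>0$ there is $A\subset\Omega$ with $\operatorname{Cap}_n(A,\Omega)<\varepsilon$ for which the restriction $\widetilde\alpha|_{\Omega\setminus A}$ is continuous; such a representative exists. Then $\alpha u\in BD(\Omega)$,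 $\widetilde\alpha$ is $|\mathrm Eu|$-integrable, $\nabla\alpha\odot u\in L^1(\Omega;\mathbb M^{n\times n}_{\rm sym})$, and $$\mathrm E(\alpha u)=\widetilde\alpha\,\mathrm Eu+\nabla\alpha\odot u\qquad\text{as bounded }\mathbb M^{n\times n}_{\rm sym}\text{-valued Radon measures on }\Omega,$$ where $a\odot b$ is the symmetric matrix with entries $(a_ib_j+a_jb_i)/2$ and $\nabla\alpha\odot u$ is identified with the measure $(\nabla\alpha\odot u)\,\mathcal L^n$ on $\Omega$. -/

import Mathlib

open MeasureTheory Filter Topology TopologicalSpace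
open scoped ENNReal NNReal Distributions Gradient

noncomputable section

namespace BDProduct

/-- Euclidean `n`-space. -/
abbrev Space (n : ℕ) : Type := EuclideanSpace ℝ (Fin n)

/-- Real `n × n` matrices, with the Euclidean scalar product `A : B = tr (A Bᵀ)` and its norm;
the entries of `A` are `A (i, j)`. -/
abbrev Mat (n : ℕ) : Type := EuclideanSpace ℝ (Fin n × Fin n)

variable {n : ℕ}

/-- Symmetrised tensor product `a ⊙ b`, with entries `(a_i b_j + a_j b_i) / 2`. -/
def symTensor (a b : Space n) : Mat n :=
  WithLp.toLp 2 fun p => (a p.1 * b p.2 + a p.2 * b p.1) / 2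

/-- `Ω` has Lipschitz boundary: near every boundary point, in a suitable orthonormal frame with
"vertical" unit vector `e`, `Ω` is the region strictly above the graph of a Lipschitz function.
The point `y - ⟪e, y⟫ e` is the orthogonal projection of `y` onto the hyperplane `e^⊥`, so only
the values of `γ` on `e^⊥` matter. -/
def HasLipschitzBoundary (Ω : Set (Space n)) : Prop :=
  ∀ x ∈ frontier Ω, ∃ (e : Space n) (r : ℝ) (K : ℝ≥0) (γ : Space n → ℝ),
    ‖e‖ = 1 ∧ 0 < r ∧ LipschitzWith K γ ∧
      ∀ y ∈ Metric.ball x r, y ∈ Ω ↔ γ (y - inner ℝ e y • e) < inner ℝ e y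

/-- `v ∈ W^{1,q}(Ω)` with weak gradient `∇v = g`. Only the values on `Ω` matter. -/
structure IsSobolev (Ω : Opens (Space n)) (q : ℝ≥0∞) (v : Space n → ℝ)
    (g : Space n → Space n) : Prop where
  memLp : MemLp v q (volume.restrict Ω)
  memLp_grad : MemLp g q (volume.restrict Ω)
  integral_eq : ∀ φ : 𝓓(Ω, ℝ), ∀ i : Fin n,
    ∫ x in Ω, v x * (∇ φ x) i = - ∫ x in Ω, g x i * φ x

/-- `v ∈ W^{1,q}_0(Ω)` with weak gradient `g`: `v` is the limit in `W^{1,q}(Ω)` of smooth functions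
with compact support in `Ω`. -/
structure IsSobolevZero (Ω : Opens (Space n)) (q : ℝ≥0∞) (v : Space n → ℝ)
    (g : Space n → Space n) : Prop extends IsSobolev Ω q v g where
  exists_approx : ∃ φ : ℕ → 𝓓(Ω, ℝ),
    Tendsto (fun k => eLpNorm (fun x => φ k x - v x) q (volume.restrict Ω)) atTop (𝓝 0) ∧
    Tendsto (fun k => eLpNorm (fun x => ∇ (φ k) x - g x) q (volume.restrict Ω)) atTop (𝓝 0)

/-- The `q`-capacity `Cap_q(A, Ω)` of `A` in `Ω`: the infimum of `∫_Ω |∇v|^q` over all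
`v ∈ W^{1,q}_0(Ω)` with `v ≥ 1` a.e. in a neighbourhood of `A` (`∞` if there is no such `v`). -/
def capacity (q : ℝ≥0∞) (A : Set (Space n)) (Ω : Opens (Space n)) : ℝ≥0∞ :=
  ⨅ (v : Space n → ℝ) (g : Space n → Space n) (_ : IsSobolevZero Ω q v g)
    (_ : ∃ U : Set (Space n), IsOpen U ∧ A ⊆ U ∧ U ⊆ Ω ∧ ∀ᵐ x ∂(volume.restrict U), 1 ≤ v x),
    ∫⁻ x in Ω, ‖g x‖ₑ ^ q.toReal

/-- `f` is `Cap_q`-quasicontinuous on `Ω`. -/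
def IsQuasicontinuous (q : ℝ≥0∞) (Ω : Opens (Space n)) (f : Space n → ℝ) : Prop :=
  ∀ ε : ℝ≥0∞, 0 < ε → ∃ A : Set (Space n), A ⊆ Ω ∧ capacity q A Ω < ε ∧
    ContinuousOn f ((Ω : Set (Space n)) \ A)

/-- `f` is a `Cap_q`-quasicontinuous representative of `α` on `Ω`. -/
def IsQuasicontinuousRep (q : ℝ≥0∞) (Ω : Opens (Space n)) (α f : Space n → ℝ) : Prop :=
  IsQuasicontinuous q Ω f ∧ f =ᵐ[volume.restrict Ω] α

/-- The distribution `Eu` on `Ω`, with components `E_{ij} u = (D_j u^i + D_i u^j) / 2`, is the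
bounded measure `μ ∈ M_b(Ω; M_sym^{n×n})`. A measure on `Ω` is regarded as a Borel measure on `ℝⁿ`
that is concentrated on `Ω`. -/
structure HasStrain (Ω : Opens (Space n)) (u : Space n → Space n)
    (μ : VectorMeasure (Space n) (Mat n)) : Prop where
  restrict_eq : μ.restrict Ω = μ
  variation_lt_top : μ.variation Set.univ < ∞
  isSymm : ∀ (s : Set (Space n)) (i j : Fin n), μ s (i, j) = μ s (j, i)
  integral_eq : ∀ φ : 𝓓(Ω, ℝ), ∀ i j : Fin n,
    (∫ᵛ x, φ x ∂•μ) (i, j) = - ∫ x in Ω, (u x i * (∇ φ x) j + u x j * (∇ φ x) i) / 2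

/-- `u ∈ BD(Ω)`: `u ∈ L¹(Ω; ℝⁿ)` and the distribution `Eu` is a bounded measure. -/
def MemBD (Ω : Opens (Space n)) (u : Space n → Space n) : Prop :=
  MemLp u 1 (volume.restrict Ω) ∧ ∃ μ : VectorMeasure (Space n) (Mat n), HasStrain Ω u μ

/-- The matrix-valued measure `f μ` with density `f` with respect to `μ`. -/
def scalarMul (f : Space n → ℝ) (μ : VectorMeasure (Space n) (Mat n)) :
    VectorMeasure (Space n) (Mat n) :=
  μ.withDensity f (ContinuousLinearMap.lsmul ℝ ℝ)

/-- The measure `F 𝓛ⁿ` on `Ω` associated with an integrable matrix field `F` on `Ω`. -/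
def lebesgueDensity (Ω : Opens (Space n)) (F : Space n → Mat n) :
    VectorMeasure (Space n) (Mat n) :=
  (volume.restrict (Ω : Set (Space n))).withDensityᵥ F

end BDProduct

end

open MeasureTheory Filter Topology TopologicalSpace
open scoped ENNReal NNReal Distributions Gradient Convolution

noncomputable section

/-! Let `α_k` be mollifications of `α` and `φ` a test function. For large `k`, `∇(φ α_k)` is a
mollification of `∇α` times `φ`, plus `α_k ∇φ`. Since `φ α_k` is itself a test function, the
definition of `Eu` gives `∫ φ α_k dEu = - ∫ u ⊙ ∇(φ α_k)`, and the product rule is the limit of this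
identity. The right side converges because `∇(φ α_k) → φ ∇α + α ∇φ` in `Lⁿ`, provided `u ∈
L^{n/(n-1)}`. The left side converges by dominated convergence, with `|α_k| ≤ ‖α‖_∞`, provided that
`α_k → α̃` holds `|Eu|`-almost everywhere on compact sets along a subsequence. These two provisos
are the substance of the proof.

Integrability (`IsStrainDensity.memLp`). For a fixed vector `ξ`, the derivative of `u · ξ` in
direction `ξ` is `Eu ξ · ξ`, a measure, although the other derivatives of `u · ξ` are not
controlled. Gagliardo's argument needs only one derivative per factor, so it bounds the integral of
`∏_i |u · ξ_i|^{1/(n-1)}` for a basis `ξ_1, …, ξ_n`. Near a boundary point the basis is taken in the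
cone of directions that lead into `Ω`; one-sided mollification and integration along half-lines then
stay inside `Ω`. Finitely many such bases can be chosen so that no nonzero vector is orthogonal to a
member of each of them, and the sum of the corresponding products dominates `|u|^{n/(n-1)}`.

Capacity (`IsStrainDensity.exists_setLIntegral_component_le`). Approximate the sign of an entry of
`Eu` by a test function `φ`. For smooth `ψ ≥ 0`, the integral of `ψ` against the variation of that
entry is close to `∫ ψ φ dEu`, hence to `- ∫ u ⊙ ∇(ψ φ)`, which is at most a constant times
`‖u‖_{n/(n-1)} ‖ψ‖_{W^{1,n}}`. So `|Eu|` is small on sets where a function of small `W^{1,n}` norm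
is bounded below. Away from a set of small capacity, `α̃` is continuous and the set where `|α_k -
α̃|` is large is relatively open; the estimate applies there and gives local convergence in
`|Eu|`-measure (`tendstoInMeasure_smoothing`).

The quasicontinuous representative itself is the limit of a fast subsequence of the `α_k`: the sets
where consecutive terms differ by more than `2^{-j}` have summably small norms attached to them, and
convergence is locally uniform off the union of their tails. -/

namespace BDProduct

/-! ### Integration against vector measures with a density. -/

section

section VectorMeasure

variable {X E : Type*} {mX : MeasurableSpace X} [NormedAddCommGroup E]

/-- Two functionals on bounded measurable functions that are additive, agree on indicators and are
continuous under bounded pointwise convergence are equal. -/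
theorem eq_of_eq_indicator {L R : (X → ℝ) → E}
    (h_ind : ∀ (c : ℝ) (s : Set X), MeasurableSet s →
      L (s.indicator fun _ => c) = R (s.indicator fun _ => c))
    (hL_add : ∀ f g : SimpleFunc X ℝ, L (fun x => f x + g x) = L f + L g)
    (hR_add : ∀ f g : SimpleFunc X ℝ, R (fun x => f x + g x) = R f + R g)
    (hL_lim : ∀ (f : ℕ → SimpleFunc X ℝ) (φ : X → ℝ) (C : ℝ), (∀ k x, ‖f k x‖ ≤ C) →
      (∀ x, Tendsto (fun k => f k x) atTop (𝓝 (φ x))) →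
      Tendsto (fun k => L (f k)) atTop (𝓝 (L φ)))
    (hR_lim : ∀ (f : ℕ → SimpleFunc X ℝ) (φ : X → ℝ) (C : ℝ), (∀ k x, ‖f k x‖ ≤ C) →
      (∀ x, Tendsto (fun k => f k x) atTop (𝓝 (φ x))) →
      Tendsto (fun k => R (f k)) atTop (𝓝 (R φ)))
    {φ : X → ℝ} (hφ : StronglyMeasurable φ) {C : ℝ} (hC : ∀ x, ‖φ x‖ ≤ C) : L φ = R φ := by
  have hsimple : ∀ f : SimpleFunc X ℝ, L f = R f := by
    intro f
    induction f using SimpleFunc.induction with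
    | const c hs =>
      simpa [SimpleFunc.coe_piecewise, Set.piecewise_eq_indicator] using! h_ind c _ hs
    | add _ hf hg =>
      rename_i f g _
      have := hL_add f g
      rw [hf, hg, ← hR_add] at this
      exact this
  -- A point of `X` is needed to know that the bound `C` is nonnegative.
  rcases isEmpty_or_nonempty X with hX | ⟨⟨x₀⟩⟩
  · have : φ = ⇑(0 : SimpleFunc X ℝ) := by ext x; exact hX.elim x
    rw [this]; exact hsimple _
  have hC0 : 0 ≤ C := (norm_nonneg _).trans (hC x₀)
  have h1 := hL_lim (fun k => hφ.approxBounded C k) φ C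
    (fun k x => hφ.norm_approxBounded_le hC0 k x)
    (fun x => hφ.tendsto_approxBounded_of_norm_le (hC x))
  have h2 := hR_lim (fun k => hφ.approxBounded C k) φ C
    (fun k x => hφ.norm_approxBounded_le hC0 k x)
    (fun x => hφ.tendsto_approxBounded_of_norm_le (hC x))
  simp_rw [hsimple] at h1
  exact tendsto_nhds_unique h1 h2

variable [NormedSpace ℝ E]

theorem isFiniteMeasure_variation_withDensity {μ : VectorMeasure X E} {f : X → ℝ}
    (hf : μ.Integrable f) :
    IsFiniteMeasure (μ.withDensity f (ContinuousLinearMap.lsmul ℝ ℝ)).variation := by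
  refine ⟨(VectorMeasure.variation_WithDensity_le _).trans_lt ?_⟩
  rw [VectorMeasure.variation_transpose_lsmul]
  simpa using! hf.2

variable [CompleteSpace E]

theorem simpleFunc_integrable {ν : Measure X} [IsFiniteMeasure ν] (f : SimpleFunc X ℝ) :
    Integrable f ν := SimpleFunc.integrable_of_isFiniteMeasure f

/-- Integral of a bounded function against the vector measure with density `F`. -/
theorem integral_withDensityᵥ {ν : Measure X} {F : X → E} (hF : Integrable F ν)
    {φ : X → ℝ} (hφ : StronglyMeasurable φ) {C : ℝ} (hC : ∀ x, ‖φ x‖ ≤ C) :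
    (∫ᵛ x, φ x ∂•(ν.withDensityᵥ F)) = ∫ x, φ x • F x ∂ν := by
  have : IsFiniteMeasure (ν.withDensityᵥ F).variation := by
    rw [Measure.variation_withDensityᵥ hF]
    exact ⟨by simpa using! hF.2⟩
  have hint : ∀ f : SimpleFunc X ℝ, Integrable (fun x => f x • F x) ν := fun f => by
    obtain ⟨c, hc⟩ := f.exists_forall_norm_le
    exact hF.bdd_smul (φ := f) c f.aestronglyMeasurable (ae_of_all _ hc)
  refine eq_of_eq_indicator (L := fun φ => ∫ᵛ x, φ x ∂•(ν.withDensityᵥ F))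
    (R := fun φ => ∫ x, φ x • F x ∂ν) ?_ ?_ ?_ ?_ ?_ hφ hC
  · intro c s hs
    rw [VectorMeasure.integral_indicator hs, VectorMeasure.setIntegral_const,
      withDensityᵥ_apply hF hs, ContinuousLinearMap.lsmul_apply, ← integral_smul,
      ← integral_indicator hs]
    congr with x
    by_cases hx : x ∈ s <;> simp [hx]
  · intro f g
    exact VectorMeasure.integral_fun_add (simpleFunc_integrable f) (simpleFunc_integrable g)
  · intro f g
    dsimp only
    simp_rw [add_smul]
    exact integral_add (hint f) (hint g)
  · intro f φ C hC hlim
    exact VectorMeasure.tendsto_integral_of_dominated_convergence (fun _ => C)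
      (fun k => (f k).aestronglyMeasurable) (integrable_const _) (fun k => ae_of_all _ (hC k))
      (ae_of_all _ hlim)
  · intro f φ C hC hlim
    refine tendsto_integral_of_dominated_convergence (fun x => C * ‖F x‖)
      (fun k => (hint (f k)).1) (hF.norm.const_mul C) (fun k => ae_of_all _ fun x => ?_)
      (ae_of_all _ fun x => (hlim x).smul_const _)
    rw [norm_smul]
    gcongr
    exact hC k x

/-- `∫ φ d(f μ) = ∫ φ f dμ` for bounded `φ`. -/
theorem integral_withDensity_lsmul {μ : VectorMeasure X E} {f : X → ℝ} (hf : μ.Integrable f)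
    {φ : X → ℝ} (hφ : StronglyMeasurable φ) {C : ℝ} (hC : ∀ x, ‖φ x‖ ≤ C) :
    (∫ᵛ x, φ x ∂•(μ.withDensity f (ContinuousLinearMap.lsmul ℝ ℝ))) = ∫ᵛ x, φ x * f x ∂•μ := by
  have := isFiniteMeasure_variation_withDensity hf
  have hint : ∀ g : SimpleFunc X ℝ, Integrable (fun x => g x * f x) μ.variation := fun g => by
    obtain ⟨c, hc⟩ := g.exists_forall_norm_le
    exact Integrable.bdd_mul hf g.aestronglyMeasurable (ae_of_all _ hc)
  refine eq_of_eq_indicator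
    (L := fun φ => ∫ᵛ x, φ x ∂•(μ.withDensity f (ContinuousLinearMap.lsmul ℝ ℝ)))
    (R := fun φ => ∫ᵛ x, φ x * f x ∂•μ) ?_ ?_ ?_ ?_ ?_ hφ hC
  · intro c s hs
    rw [VectorMeasure.integral_indicator hs, VectorMeasure.setIntegral_const,
      VectorMeasure.withDensity_apply hf, ContinuousLinearMap.lsmul_apply,
      ← VectorMeasure.integral_smul,
      ← VectorMeasure.integral_indicator hs]
    congr with x
    by_cases hx : x ∈ s <;> simp [hx]
  · intro f g
    exact VectorMeasure.integral_fun_add (simpleFunc_integrable f) (simpleFunc_integrable g)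
  · intro f g
    dsimp only
    simp_rw [add_mul]
    exact VectorMeasure.integral_fun_add (hint f) (hint g)
  · intro f φ C hC hlim
    exact VectorMeasure.tendsto_integral_of_dominated_convergence (fun _ => C)
      (fun k => (f k).aestronglyMeasurable) (integrable_const _) (fun k => ae_of_all _ (hC k))
      (ae_of_all _ hlim)
  · intro g φ C hC hlim
    refine VectorMeasure.tendsto_integral_of_dominated_convergence (fun x => C * ‖f x‖)
      (fun k => (hint (g k)).1) (hf.norm.const_mul C) (fun k => ae_of_all _ fun x => ?_)
      (ae_of_all _ fun x => (hlim x).mul_const _)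
    rw [norm_mul]
    gcongr
    exact hC k x

end VectorMeasure

variable {n : ℕ}

theorem gradient_apply (f : Space n → ℝ) (x : Space n) (i : Fin n) :
    (∇ f x) i = fderiv ℝ f x (EuclideanSpace.single i 1) := by
  have h := EuclideanSpace.inner_single_right (𝕜 := ℝ) i 1 (∇ f x)
  rw [gradient, InnerProductSpace.toDual_symm_apply] at h
  rw [gradient]
  simpa using h.symm

/-- A matrix-valued measure of finite variation has a density with respect to its variation. -/
theorem exists_density (μ : VectorMeasure (Space n) (Mat n)) (hμ : μ.variation Set.univ < ∞) :
    ∃ σ : Space n → Mat n, Measurable σ ∧ Integrable σ μ.variation ∧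
      μ = μ.variation.withDensityᵥ σ := by
  have : IsFiniteMeasure μ.variation := ⟨hμ⟩
  -- Radon–Nikodym entry by entry: each entry is a signed measure, absolutely continuous with
  -- respect to the variation.
  let pr : Fin n × Fin n → (Mat n →L[ℝ] ℝ) := fun p => EuclideanSpace.proj p
  let s : Fin n × Fin n → SignedMeasure (Space n) :=
    fun p => μ.mapRange (pr p).toAddMonoidHom (pr p).continuous
  have hs : ∀ p, μ.variation.withDensityᵥ ((s p).rnDeriv μ.variation) = s p := by
    intro p
    rw [← SignedMeasure.absolutelyContinuous_iff_withDensityᵥ_rnDeriv_eq]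
    refine VectorMeasure.AbsolutelyContinuous.mk fun t ht h0 => ?_
    rw [Measure.toENNRealVectorMeasure_apply_measurable ht] at h0
    have h1 : μ t = 0 := by
      have := VectorMeasure.enorm_measure_le_variation μ t
      rw [h0] at this
      simpa using this
    change pr p (μ t) = 0
    rw [h1, map_zero]
  let σ : Space n → Mat n := fun x => WithLp.toLp 2 fun p => (s p).rnDeriv μ.variation x
  have hσm : Measurable σ := by
    refine (WithLp.measurable_toLp 2 _).comp (measurable_pi_lambda _ fun p => ?_)
    exact SignedMeasure.measurable_rnDeriv _ _
  have hσi : Integrable σ μ.variation := by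
    rw [← memLp_one_iff_integrable, memLp_piLp_iff]
    intro p
    rw [memLp_one_iff_integrable]
    exact SignedMeasure.integrable_rnDeriv _ _
  refine ⟨σ, hσm, hσi, ?_⟩
  ext t ht p
  rw [withDensityᵥ_apply hσi ht]
  have h1 : (∫ x in t, σ x ∂μ.variation) p = ∫ x in t, σ x p ∂μ.variation :=
    ((pr p).integral_comp_comm hσi.integrableOn).symm
  rw [h1]
  have h2 := congrArg (fun m => m t) (hs p)
  simp only [withDensityᵥ_apply (SignedMeasure.integrable_rnDeriv _ _) ht] at h2
  exact h2.symm

end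

/-! ### Mollification. -/

section

variable {n : ℕ}

/-- A smooth nonnegative convolution kernel of integral one supported in the ball of radius `δ`. -/
structure IsMollifier (g : Space n → ℝ) (δ : ℝ) : Prop where
  contDiff : ContDiff ℝ (⊤ : ℕ∞) g
  nonneg : ∀ x, 0 ≤ g x
  tsupport_subset : tsupport g ⊆ Metric.closedBall 0 δ
  integral_eq_one : ∫ x, g x = 1

/-- Convolution of scalar functions, `conv f g x = ∫ f y g (x - y) dy`. -/
def conv (f g : Space n → ℝ) : Space n → ℝ :=
  f ⋆[ContinuousLinearMap.lsmul ℝ ℝ, volume] g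

theorem conv_apply (f g : Space n → ℝ) (x : Space n) : conv f g x = ∫ y, f y * g (x - y) := rfl

/-- The bump may be off centre: near the boundary of `Ω` the kernel has to be displaced so that
averages only see points inside `Ω`. The radius `‖c‖ + ρ` is that of a ball about the origin
containing its support. -/
theorem exists_isMollifier (c : Space n) {ρ : ℝ} (hρ : 0 < ρ) :
    ∃ g : Space n → ℝ, IsMollifier g (‖c‖ + ρ) ∧ tsupport g ⊆ Metric.closedBall c ρ := by
  let b : ContDiffBump c := ⟨ρ / 2, ρ, half_pos hρ, half_lt_self hρ⟩
  have h : tsupport (b.normed volume) = Metric.closedBall c ρ := b.tsupport_normed_eq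
  refine ⟨b.normed volume, ⟨b.contDiff_normed, b.nonneg_normed, ?_, b.integral_normed⟩, h.le⟩
  rw [h]
  apply Metric.closedBall_subset_closedBall'
  simp [add_comm]

namespace IsMollifier

variable {g : Space n → ℝ} {δ : ℝ}

theorem hasCompactSupport (hg : IsMollifier g δ) : HasCompactSupport g :=
  HasCompactSupport.of_support_subset_isCompact (isCompact_closedBall 0 δ)
    ((subset_tsupport g).trans hg.tsupport_subset)

theorem continuous (hg : IsMollifier g δ) : Continuous g := hg.contDiff.continuous

theorem integrable (hg : IsMollifier g δ) : Integrable g :=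
  hg.continuous.integrable_of_hasCompactSupport hg.hasCompactSupport

theorem eq_zero (hg : IsMollifier g δ) {x : Space n} (hx : δ < ‖x‖) : g x = 0 := by
  by_contra h
  have := hg.tsupport_subset (subset_tsupport g h)
  simp at this
  linarith

theorem integral_sub (hg : IsMollifier g δ) (x : Space n) : ∫ y, g (x - y) = 1 := by
  rw [integral_sub_left_eq_self g volume x, hg.integral_eq_one]

theorem lintegral_ofReal_sub (hg : IsMollifier g δ) (x : Space n) :
    ∫⁻ y, ENNReal.ofReal (g (x - y)) = 1 := by
  rw [← ofReal_integral_eq_lintegral_ofReal (hg.integrable.comp_sub_left x)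
    (ae_of_all _ fun y => hg.nonneg _), hg.integral_sub, ENNReal.ofReal_one]

theorem lintegral_ofReal_sub' (hg : IsMollifier g δ) (y : Space n) :
    ∫⁻ x, ENNReal.ofReal (g (x - y)) = 1 := by
  rw [lintegral_sub_right_eq_self (fun x => ENNReal.ofReal (g x)) y]
  simpa using hg.lintegral_ofReal_sub 0 |>.symm ▸ (lintegral_sub_left_eq_self (μ := volume)
    (fun x => ENNReal.ofReal (g x)) 0).symm ▸ rfl

theorem integrable_mul (hg : IsMollifier g δ) {f : Space n → ℝ} (hf : LocallyIntegrable f)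
    (x : Space n) : Integrable fun y => f y * g (x - y) :=
  hg.hasCompactSupport.convolutionExists_right (ContinuousLinearMap.lsmul ℝ ℝ) hf
    hg.continuous x

theorem contDiff_conv (hg : IsMollifier g δ) {f : Space n → ℝ} (hf : LocallyIntegrable f) :
    ContDiff ℝ (⊤ : ℕ∞) (conv f g) :=
  hg.hasCompactSupport.contDiff_convolution_right _ hf hg.contDiff

theorem fderiv_conv (hg : IsMollifier g δ) {f : Space n → ℝ} (hf : LocallyIntegrable f)
    (x v : Space n) : fderiv ℝ (conv f g) x v = ∫ y, f y * fderiv ℝ g (x - y) v := by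
  have h := hg.hasCompactSupport.hasFDerivAt_convolution_right
    (ContinuousLinearMap.lsmul ℝ ℝ) hf (hg.contDiff.of_le (by simp)) x
  have h2 : fderiv ℝ (conv f g) x = _ := h.fderiv
  rw [h2, convolution_precompR_apply _ hf]
  · rfl
  · exact hg.hasCompactSupport.fderiv ℝ
  · exact hg.contDiff.continuous_fderiv (by simp)

theorem conv_sub (hg : IsMollifier g δ) {f f' : Space n → ℝ} (hf : LocallyIntegrable f)
    (hf' : LocallyIntegrable f') : conv (f - f') g = conv f g - conv f' g := by
  ext x
  simp only [conv_apply, Pi.sub_apply, sub_mul]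
  exact MeasureTheory.integral_sub (hg.integrable_mul hf x) (hg.integrable_mul hf' x)

theorem abs_conv_le (hg : IsMollifier g δ) {f : Space n → ℝ} {M : ℝ}
    (hM : ∀ᵐ x, |f x| ≤ M) (x : Space n) : |conv f g x| ≤ M := by
  rw [conv_apply, ← Real.norm_eq_abs]
  calc ‖∫ y, f y * g (x - y)‖ ≤ ∫ y, M * g (x - y) := by
        refine norm_integral_le_of_norm_le ((hg.integrable.comp_sub_left x).const_mul M) ?_
        filter_upwards [hM] with y hy
        rw [norm_mul, Real.norm_eq_abs, Real.norm_of_nonneg (hg.nonneg _)]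
        exact mul_le_mul_of_nonneg_right hy (hg.nonneg _)
    _ = M := by rw [integral_const_mul, hg.integral_sub, mul_one]

theorem le_conv (hg : IsMollifier g δ) {f : Space n → ℝ} (hf : LocallyIntegrable f) {x : Space n}
    {c : ℝ} (hc : ∀ᵐ y, y ∈ Metric.closedBall x δ → c ≤ f y) : c ≤ conv f g x := by
  rw [conv_apply]
  calc c = ∫ y, c * g (x - y) := by rw [integral_const_mul, hg.integral_sub, mul_one]
    _ ≤ _ := by
      refine integral_mono_ae ((hg.integrable.comp_sub_left x).const_mul c)
        (hg.integrable_mul hf x) ?_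
      filter_upwards [hc] with y hy
      by_cases h : y ∈ Metric.closedBall x δ
      · exact mul_le_mul_of_nonneg_right (hy h) (hg.nonneg _)
      · rw [hg.eq_zero, mul_zero, mul_zero]
        rw [Metric.mem_closedBall, not_le, dist_comm, dist_eq_norm] at h
        exact h

/-- Averaging against a mollifier does not increase the `Lᵖ` norm. -/
theorem eLpNorm_conv_le (hg : IsMollifier g δ) {f : Space n → ℝ} (hf : AEStronglyMeasurable f)
    {p : ℝ≥0∞} (hp1 : 1 ≤ p) (hp : p ≠ ∞) : eLpNorm (conv f g) p volume ≤ eLpNorm f p volume := by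
  have hp0 : p ≠ 0 := (zero_lt_one.trans_le hp1).ne'
  have hpr : 0 < p.toReal := ENNReal.toReal_pos hp0 hp
  rw [eLpNorm_eq_lintegral_rpow_enorm_toReal hp0 hp, eLpNorm_eq_lintegral_rpow_enorm_toReal hp0 hp]
  gcongr ?_ ^ _
  have hgm : Measurable fun z : Space n => ENNReal.ofReal (g z) :=
    ENNReal.measurable_ofReal.comp hg.continuous.measurable
  have hpt : ∀ x, ‖conv f g x‖ₑ ^ p.toReal ≤
      ∫⁻ y, ‖f y‖ₑ ^ p.toReal * ENNReal.ofReal (g (x - y)) := by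
    intro x
    -- `g (x - y) dy` is a probability measure, on which the `L¹` norm is at most the `Lᵖ` norm;
    -- this bounds `|conv f g x|ᵖ` by an average of `|f|ᵖ`, and Tonelli finishes.
    let ν : Measure (Space n) := volume.withDensity fun y => ENNReal.ofReal (g (x - y))
    have hm : Measurable fun y => ENNReal.ofReal (g (x - y)) :=
      hgm.comp (measurable_const.sub measurable_id)
    have hν : IsProbabilityMeasure ν := ⟨by simp [ν, hg.lintegral_ofReal_sub]⟩
    have hfν : AEStronglyMeasurable f ν := hf.mono_ac (withDensity_absolutelyContinuous _ _)
    have h1 : ‖conv f g x‖ₑ ≤ eLpNorm f 1 ν := by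
      rw [eLpNorm_one_eq_lintegral_enorm, lintegral_withDensity_eq_lintegral_mul₀ hm.aemeasurable
        hf.enorm, conv_apply]
      refine (enorm_integral_le_lintegral_enorm _).trans (le_of_eq ?_)
      congr with y
      rw [enorm_mul, Pi.mul_apply, mul_comm, Real.enorm_of_nonneg (hg.nonneg _)]
    have h2 := h1.trans (eLpNorm_le_eLpNorm_of_exponent_le hp1 hfν)
    rw [eLpNorm_eq_lintegral_rpow_enorm_toReal hp0 hp, lintegral_withDensity_eq_lintegral_mul₀
      hm.aemeasurable (hf.enorm.pow_const _)] at h2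
    have h3 := ENNReal.rpow_le_rpow h2 hpr.le
    rw [← ENNReal.rpow_mul, one_div_mul_cancel hpr.ne', ENNReal.rpow_one] at h3
    refine h3.trans (le_of_eq ?_)
    congr with y
    rw [Pi.mul_apply, mul_comm]
  calc ∫⁻ x, ‖conv f g x‖ₑ ^ p.toReal
      ≤ ∫⁻ x, ∫⁻ y, ‖f y‖ₑ ^ p.toReal * ENNReal.ofReal (g (x - y)) := lintegral_mono hpt
    _ = ∫⁻ y, ∫⁻ x, ‖f y‖ₑ ^ p.toReal * ENNReal.ofReal (g (x - y)) := by
      apply lintegral_lintegral_swap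
      refine AEMeasurable.mul ?_ (hgm.comp (measurable_fst.sub measurable_snd)).aemeasurable
      exact (hf.enorm.pow_const _).comp_snd
    _ = ∫⁻ y, ‖f y‖ₑ ^ p.toReal := by
      congr with y
      have hm : Measurable fun x => ENNReal.ofReal (g (x - y)) :=
        hgm.comp (measurable_id.sub measurable_const)
      rw [lintegral_const_mul _ hm,
        hg.lintegral_ofReal_sub', mul_one]

end IsMollifier

theorem dist_conv_le {g : Space n → ℝ} {δ : ℝ} (hg : IsMollifier g δ) {h : Space n → ℝ}
    (hh : Continuous h) {x : Space n} {ε : ℝ} (hε : ∀ y, dist y x ≤ δ → |h y - h x| ≤ ε) :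
    |conv h g x - h x| ≤ ε := by
  have h1 : conv h g x - h x = ∫ y, (h y - h x) * g (x - y) := by
    simp_rw [sub_mul]
    rw [MeasureTheory.integral_sub (hg.integrable_mul hh.locallyIntegrable x)
      ((hg.integrable.comp_sub_left x).const_mul _), integral_const_mul, hg.integral_sub, mul_one]
    rfl
  rw [h1, ← Real.norm_eq_abs]
  calc ‖∫ y, (h y - h x) * g (x - y)‖ ≤ ∫ y, ε * g (x - y) := by
        refine norm_integral_le_of_norm_le ((hg.integrable.comp_sub_left x).const_mul ε)
          (ae_of_all _ fun y => ?_)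
        rw [norm_mul, Real.norm_eq_abs, Real.norm_of_nonneg (hg.nonneg _)]
        by_cases hy : dist y x ≤ δ
        · exact mul_le_mul_of_nonneg_right (hε y hy) (hg.nonneg _)
        · rw [hg.eq_zero, mul_zero, mul_zero]
          rw [not_le, dist_comm, dist_eq_norm] at hy
          exact hy
    _ = ε := by rw [integral_const_mul, hg.integral_sub, mul_one]

/-- Uniform continuity makes the difference uniformly small, and once the radius is below `1` the
difference is supported in the compact set `K`, the closed `1`-thickening of the support of `h`. -/
theorem tendsto_eLpNorm_conv_sub_of_continuous {g : ℕ → Space n → ℝ} {δ : ℕ → ℝ}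
    (hg : ∀ k, IsMollifier (g k) (δ k)) (hδ : Tendsto δ atTop (𝓝 0)) {h : Space n → ℝ}
    (hh : Continuous h) (hc : HasCompactSupport h) {p : ℝ≥0∞} :
    Tendsto (fun k => eLpNorm (conv h (g k) - h) p volume) atTop (𝓝 0) := by
  let K := Metric.cthickening 1 (tsupport h)
  have hK : IsCompact K := hc.isCompact.cthickening
  have huc := hc.uniformContinuous_of_continuous hh
  have hfin : volume K ^ p.toReal⁻¹ ≠ ∞ := by
    apply ENNReal.rpow_ne_top_of_nonneg (by positivity) hK.measure_lt_top.ne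
  rw [ENNReal.tendsto_atTop_zero]
  intro η hη
  obtain ⟨ε, hε0, hε⟩ : ∃ ε : ℝ, 0 < ε ∧ volume K ^ p.toReal⁻¹ * ENNReal.ofReal ε ≤ η := by
    rcases eq_or_ne η ∞ with rfl | hη'
    · exact ⟨1, one_pos, le_top⟩
    have hη'' : 0 < η.toReal := ENNReal.toReal_pos hη.ne' hη'
    obtain ⟨a, ha⟩ : ∃ a : ℝ≥0, volume K ^ p.toReal⁻¹ = a := ⟨_, (ENNReal.coe_toNNReal hfin).symm⟩
    refine ⟨η.toReal / (a + 1), by positivity, ?_⟩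
    rw [ha, ← ENNReal.ofReal_coe_nnreal, ← ENNReal.ofReal_mul (by positivity)]
    refine ENNReal.ofReal_le_of_le_toReal ?_
    rw [mul_div_assoc', div_le_iff₀ (by positivity), mul_comm]
    gcongr
    linarith
  obtain ⟨ρ, hρ0, hρ⟩ := Metric.uniformContinuous_iff.1 huc ε hε0
  have hev : ∀ᶠ k in atTop, δ k < min ρ 1 := hδ.eventually_lt_const (by positivity)
  obtain ⟨N, hN⟩ := eventually_atTop.1 hev
  refine ⟨N, fun k hk => ?_⟩
  have hkδ := hN k hk
  have hbound : ∀ x, |conv h (g k) x - h x| ≤ ε := fun x =>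
    dist_conv_le (hg k) hh fun y hy =>
      (hρ (lt_of_le_of_lt hy (hkδ.trans_le (min_le_left _ _)))).le
  have hsupp : ∀ x, x ∉ K → conv h (g k) x - h x = 0 := by
    intro x hx
    have h0 : h x = 0 := by
      by_contra hne
      exact hx (Metric.self_subset_cthickening _ (subset_tsupport h hne))
    rw [h0, sub_zero, conv_apply]
    refine integral_eq_zero_of_ae (ae_of_all _ fun y => ?_)
    by_cases hy : h y = 0
    · simp [hy]
    · have : 1 < ‖x - y‖ := by
        by_contra hle
        refine hx (Metric.mem_cthickening_of_dist_le x y 1 _ (subset_tsupport h hy) ?_)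
        rw [dist_eq_norm]; exact not_lt.1 hle
      simp [(hg k).eq_zero ((hkδ.trans_le (min_le_right _ _)).trans this)]
  have heq : conv h (g k) - h = K.indicator (conv h (g k) - h) := by
    ext x
    by_cases hx : x ∈ K
    · simp [hx]
    · simpa [hx] using hsupp x hx
  rw [heq, eLpNorm_indicator_eq_eLpNorm_restrict hK.measurableSet]
  refine (eLpNorm_le_of_ae_bound (C := ε) (ae_of_all _ hbound)).trans ?_
  simpa using hε

/-- Convolution with mollifiers of vanishing radius converges in `Lᵖ`. -/
theorem tendsto_eLpNorm_conv_sub {g : ℕ → Space n → ℝ} {δ : ℕ → ℝ}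
    (hg : ∀ k, IsMollifier (g k) (δ k)) (hδ : Tendsto δ atTop (𝓝 0)) {f : Space n → ℝ}
    {p : ℝ≥0∞} (hp1 : 1 ≤ p) (hp : p ≠ ∞) (hf : MemLp f p volume) :
    Tendsto (fun k => eLpNorm (conv f (g k) - f) p volume) atTop (𝓝 0) := by
  rw [ENNReal.tendsto_atTop_zero]
  intro η hη
  have hη3 : η / 3 ≠ 0 := (ENNReal.div_pos hη.ne' (by simp)).ne'
  obtain ⟨h, hc, hfh, hh, hhp⟩ := hf.exists_hasCompactSupport_eLpNorm_sub_le hp hη3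
  obtain ⟨N, hN⟩ := ENNReal.tendsto_atTop_zero.1
    (tendsto_eLpNorm_conv_sub_of_continuous hg hδ hh hc (p := p))
    (η / 3) hη3.bot_lt
  refine ⟨N, fun k hk => ?_⟩
  have hfl := hf.locallyIntegrable hp1
  have hhl := hh.locallyIntegrable (μ := (volume : Measure (Space n)))
  have hm : ∀ {f : Space n → ℝ}, LocallyIntegrable f → AEStronglyMeasurable (conv f (g k)) :=
    fun hf => ((hg k).contDiff_conv hf).continuous.aestronglyMeasurable
  have heq : conv f (g k) - f = conv (f - h) (g k) + (conv h (g k) - h) + (h - f) := by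
    rw [(hg k).conv_sub hfl hhl]; abel
  rw [heq]
  have hfhm : AEStronglyMeasurable (f - h) volume := hf.1.sub hhp.1
  calc _ ≤ eLpNorm (conv (f - h) (g k) + (conv h (g k) - h)) p volume
        + eLpNorm (h - f) p volume :=
        eLpNorm_add_le ((hm (hfl.sub hhl)).add ((hm hhl).sub hhp.1)) (hhp.1.sub hf.1) hp1
    _ ≤ eLpNorm (conv (f - h) (g k)) p volume + eLpNorm (conv h (g k) - h) p volume
        + eLpNorm (h - f) p volume := by
        gcongr
        exact eLpNorm_add_le (hm (hfl.sub hhl)) ((hm hhl).sub hhp.1) hp1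
    _ ≤ η / 3 + η / 3 + η / 3 := by
        gcongr
        · exact ((hg k).eLpNorm_conv_le hfhm hp1 hp).trans hfh
        · exact hN k hk
        · rw [eLpNorm_sub_comm]; exact hfh
    _ = η := ENNReal.add_thirds η

/-- The test function with values `g (x - y) φ y`. -/
def kernelTest {Ω : Opens (Space n)} {g φ : Space n → ℝ} (hg : ContDiff ℝ (⊤ : ℕ∞) g)
    (hgc : HasCompactSupport g) (hφ : ContDiff ℝ (⊤ : ℕ∞) φ) (x : Space n)
    (hx : ∀ y, x - y ∈ tsupport g → y ∈ tsupport φ → y ∈ Ω) : 𝓓(Ω, ℝ) where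
  toFun y := g (x - y) * φ y
  contDiff' := (hg.comp (contDiff_const.sub contDiff_id)).mul hφ
  hasCompactSupport' := (hgc.comp_homeomorph (Homeomorph.subLeft x)).mul_right
  tsupport_subset' := by
    intro y hy
    refine hx y ?_ (closure_mono (Function.support_mul_subset_right _ _) hy)
    have h1 := closure_mono (Function.support_mul_subset_left _ _) hy
    have : tsupport (g ∘ Homeomorph.subLeft x) = Homeomorph.subLeft x ⁻¹' tsupport g :=
      tsupport_comp_eq_preimage g _
    change y ∈ tsupport (g ∘ Homeomorph.subLeft x) at h1
    rw [this] at h1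
    exact h1

/-- Differentiating the convolution puts the derivative on the kernel, and `y ↦ g (x - y)` is an
admissible test function as soon as the ball of radius `δ` about `x` lies in `Ω`. The factor `φ` of
`kernelTest` is the constant `1`, since the kernel alone has compact support. -/
theorem IsSobolev.gradient_conv {Ω : Opens (Space n)} {q : ℝ≥0∞} (hq : 1 ≤ q) {v : Space n → ℝ}
    {G : Space n → Space n} (hv : IsSobolev Ω q v G) {g : Space n → ℝ} {δ : ℝ}
    (hg : IsMollifier g δ) {x : Space n} (hx : Metric.closedBall x δ ⊆ Ω) (i : Fin n) :
    (∇ (conv ((Ω : Set (Space n)).indicator v) g) x) i =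
      conv ((Ω : Set (Space n)).indicator fun y => G y i) g x := by
  have hΩ : MeasurableSet (Ω : Set (Space n)) := Ω.isOpen.measurableSet
  have hvl : LocallyIntegrable ((Ω : Set (Space n)).indicator v) :=
    ((memLp_indicator_iff_restrict hΩ).2 hv.memLp).locallyIntegrable hq
  let ψ : 𝓓(Ω, ℝ) := kernelTest hg.contDiff hg.hasCompactSupport contDiff_const x (φ := fun _ => 1)
    (by
      intro y hy _
      have := hg.tsupport_subset hy
      apply hx
      rw [Metric.mem_closedBall, dist_comm, dist_eq_norm]
      simpa using this)
  have hψ : ∀ y, ψ y = g (x - y) := fun y => mul_one _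
  have hψ' : ∀ y, (∇ ψ y) i = - fderiv ℝ g (x - y) (EuclideanSpace.single i 1) := by
    intro y
    rw [gradient_apply]
    have h1 : (ψ : Space n → ℝ) = fun y => g (x - y) := funext hψ
    have h2 : HasFDerivAt (fun y => g (x - y)) ((fderiv ℝ g (x - y)).comp
        (-ContinuousLinearMap.id ℝ (Space n))) y :=
      ((hg.contDiff.differentiable (by simp)) (x - y)).hasFDerivAt.comp y
        ((hasFDerivAt_id y).const_sub x)
    rw [h1, h2.fderiv]
    simp
  rw [gradient_apply, hg.fderiv_conv hvl, conv_apply]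
  have h := hv.integral_eq ψ i
  simp_rw [hψ, hψ'] at h
  simp only [mul_neg, integral_neg, neg_inj] at h
  rw [← integral_indicator hΩ, ← integral_indicator hΩ] at h
  convert! h using 2
  · ext y; by_cases hy : y ∈ (Ω : Set (Space n)) <;> simp [hy]
  · ext y; by_cases hy : y ∈ (Ω : Set (Space n)) <;> simp [hy]

end

/-! ### The strain as a density, and directional derivatives of mollified components. -/

section

variable {n : ℕ}

theorem TestFunction.exists_bound {Ω : Opens (Space n)} (φ : 𝓓(Ω, ℝ)) : ∃ C, ∀ x, ‖φ x‖ ≤ C :=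
  φ.continuous.bounded_above_of_compact_support φ.hasCompactSupport

theorem HasStrain.variation_compl {Ω : Opens (Space n)} {u : Space n → Space n}
    {μ : VectorMeasure (Space n) (Mat n)} (h : HasStrain Ω u μ) :
    μ.variation (Ω : Set (Space n))ᶜ = 0 := by
  have hΩ : MeasurableSet (Ω : Set (Space n)) := Ω.isOpen.measurableSet
  have h1 := VectorMeasure.variation_restrict (μ := μ) hΩ
  rw [h.restrict_eq] at h1
  rw [h1, Measure.restrict_apply hΩ.compl]
  simp

/-- A density of the strain with respect to a finite measure. -/
structure IsStrainDensity (Ω : Opens (Space n)) (u : Space n → Space n) (m : Measure (Space n))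
    (σ : Space n → Mat n) : Prop where
  measurable : Measurable σ
  integrable : Integrable σ m
  measure_compl : m (Ω : Set (Space n))ᶜ = 0
  integral_eq : ∀ φ : 𝓓(Ω, ℝ), ∀ i j : Fin n,
    ∫ x, φ x * σ x (i, j) ∂m = - ∫ x in Ω, (u x i * (∇ φ x) j + u x j * (∇ φ x) i) / 2

/-- Polar decomposition of the strain. The second clause lets estimates for `m.withDensity ‖σ‖ₑ` be
read as estimates for the variation of `μ`. -/
theorem HasStrain.exists_isStrainDensity {Ω : Opens (Space n)} {u : Space n → Space n}
    {μ : VectorMeasure (Space n) (Mat n)} (h : HasStrain Ω u μ) :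
    ∃ σ, IsStrainDensity Ω u μ.variation σ ∧
      μ.variation = μ.variation.withDensity fun x => ‖σ x‖ₑ := by
  obtain ⟨σ, hσm, hσi, hσ⟩ := exists_density μ h.variation_lt_top
  refine ⟨σ, ⟨hσm, hσi, h.variation_compl, fun φ i j => ?_⟩, ?_⟩
  · obtain ⟨C, hC⟩ := TestFunction.exists_bound φ
    rw [← h.integral_eq]
    conv_rhs => rw [hσ]
    rw [integral_withDensityᵥ hσi φ.stronglyMeasurable hC]
    have hint : Integrable (fun x => φ x • σ x) μ.variation :=
      hσi.bdd_smul (φ := φ) C φ.aestronglyMeasurable (ae_of_all _ hC)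
    exact ((EuclideanSpace.proj (𝕜 := ℝ) (i, j) : Mat n →L[ℝ] ℝ).integral_comp_comm hint)
  · conv_lhs => rw [hσ]
    exact Measure.variation_withDensityᵥ hσi

theorem continuous_gradient {φ : Space n → ℝ} (hφ : ContDiff ℝ (⊤ : ℕ∞) φ) :
    Continuous (∇ φ) :=
  (InnerProductSpace.toDual ℝ (Space n)).symm.continuous.comp (hφ.continuous_fderiv (by simp))

theorem hasCompactSupport_gradient {φ : Space n → ℝ} (hφ : HasCompactSupport φ) :
    HasCompactSupport (∇ φ) :=
  (hφ.fderiv ℝ).comp_left (map_zero _)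

theorem exists_bound_gradient {φ : Space n → ℝ} (hφ : ContDiff ℝ (⊤ : ℕ∞) φ)
    (hc : HasCompactSupport φ) : ∃ C, ∀ x, ‖∇ φ x‖ ≤ C :=
  (continuous_gradient hφ).bounded_above_of_compact_support (hasCompactSupport_gradient hc)

theorem fderiv_eq_inner_gradient (φ : Space n → ℝ) (x ξ : Space n) :
    fderiv ℝ φ x ξ = ∑ i, ξ i * (∇ φ x) i := by
  simp_rw [gradient_apply]
  have : ξ = ∑ i, ξ i • EuclideanSpace.single i (1 : ℝ) := by
    ext j
    simp [Pi.single_apply]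
  conv_lhs => rw [this]
  simp [map_sum]

/-- The diagonal quadratic form `ξ ↦ A ξ · ξ`. -/
def quadForm (A : Mat n) (ξ : Space n) : ℝ := ∑ i, ∑ j, ξ i * ξ j * A (i, j)

theorem integrable_comp_mul_gradient {Ω : Opens (Space n)} {u : Space n → Space n}
    (hu : MemLp u 1 (volume.restrict Ω)) {φ : Space n → ℝ} (hφ : ContDiff ℝ (⊤ : ℕ∞) φ)
    (hc : HasCompactSupport φ) (i j : Fin n) :
    Integrable (fun x => u x i * (∇ φ x) j) (volume.restrict (Ω : Set (Space n))) := by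
  obtain ⟨C, hC⟩ := exists_bound_gradient hφ hc
  have hui : Integrable (fun x => u x i) (volume.restrict (Ω : Set (Space n))) := by
    rw [← memLp_one_iff_integrable]
    exact (memLp_piLp_iff.1 hu) i
  refine hui.mul_bdd (c := C) ?_ (ae_of_all _ fun x => ?_)
  · have : Continuous fun x => (∇ φ x) j :=
      (EuclideanSpace.proj (𝕜 := ℝ) j : Space n →L[ℝ] ℝ).continuous.comp (continuous_gradient hφ)
    exact this.aestronglyMeasurable
  · exact (PiLp.norm_apply_le (∇ φ x) j).trans (hC x)

/-- Contracting the symmetrised gradient with `ξ ⊗ ξ` leaves the single derivative of `u · ξ` in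
direction `ξ`. This is what allows a Gagliardo argument without control of the full gradient. -/
theorem IsStrainDensity.integral_quadForm {Ω : Opens (Space n)} {u : Space n → Space n}
    {m : Measure (Space n)} {σ : Space n → Mat n} (h : IsStrainDensity Ω u m σ)
    (hu : MemLp u 1 (volume.restrict Ω)) (φ : 𝓓(Ω, ℝ)) (ξ : Space n) :
    ∫ x, φ x * quadForm (σ x) ξ ∂m = - ∫ x in Ω, inner ℝ (u x) ξ * fderiv ℝ φ x ξ := by
  obtain ⟨C, hC⟩ := TestFunction.exists_bound φ
  have hint : ∀ i j, Integrable (fun x => φ x * σ x (i, j)) m := fun i j => by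
    have : Integrable (fun x => σ x (i, j)) m := by
      rw [← memLp_one_iff_integrable]
      exact (memLp_piLp_iff.1 (memLp_one_iff_integrable.2 h.integrable)) (i, j)
    exact this.bdd_mul φ.aestronglyMeasurable (ae_of_all _ hC)
  have hintu := integrable_comp_mul_gradient hu φ.contDiff φ.hasCompactSupport
  have hintu' : ∀ i j, Integrable (fun x => (u x i * (∇ φ x) j + u x j * (∇ φ x) i) / 2)
      (volume.restrict (Ω : Set (Space n))) :=
    fun i j => ((hintu i j).add (hintu j i)).div_const 2
  have h1 : ∀ x, φ x * quadForm (σ x) ξ = ∑ i, ∑ j, ξ i * ξ j * (φ x * σ x (i, j)) := by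
    intro x
    simp only [quadForm, Finset.mul_sum]
    refine Finset.sum_congr rfl fun i _ => Finset.sum_congr rfl fun j _ => by ring
  have h2 : ∀ x, inner ℝ (u x) ξ * fderiv ℝ φ x ξ =
      ∑ i, ∑ j, ξ i * ξ j * ((u x i * (∇ φ x) j + u x j * (∇ φ x) i) / 2) := by
    intro x
    have hs : ∑ i, ∑ j, ξ i * ξ j * (u x j * (∇ φ x) i) =
        ∑ i, ∑ j, ξ i * ξ j * (u x i * (∇ φ x) j) := by
      rw [Finset.sum_comm]
      refine Finset.sum_congr rfl fun i _ => Finset.sum_congr rfl fun j _ => by ring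
    have h3 : inner ℝ (u x) ξ * fderiv ℝ φ x ξ =
        ∑ i, ∑ j, ξ i * ξ j * (u x i * (∇ φ x) j) := by
      rw [fderiv_eq_inner_gradient, PiLp.inner_apply, Finset.sum_mul_sum]
      refine Finset.sum_congr rfl fun i _ => Finset.sum_congr rfl fun j _ => ?_
      simp; ring
    rw [h3]
    calc _ = (∑ i, ∑ j, ξ i * ξ j * (u x i * (∇ φ x) j) +
          ∑ i, ∑ j, ξ i * ξ j * (u x j * (∇ φ x) i)) / 2 := by rw [hs]; ring
      _ = _ := by
        rw [← Finset.sum_add_distrib, Finset.sum_div]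
        refine Finset.sum_congr rfl fun i _ => ?_
        rw [← Finset.sum_add_distrib, Finset.sum_div]
        refine Finset.sum_congr rfl fun j _ => by ring
  simp_rw [h1, h2]
  rw [integral_finsetSum _ fun i _ => integrable_finsetSum _ fun j _ => (hint i j).const_mul _,
    integral_finsetSum _ fun i _ => integrable_finsetSum _ fun j _ =>
      (hintu' i j).const_mul _, ← Finset.sum_neg_distrib]
  refine Finset.sum_congr rfl fun i _ => ?_
  rw [integral_finsetSum _ fun j _ => (hint i j).const_mul _,
    integral_finsetSum _ fun j _ =>
      (hintu' i j).const_mul _, ← Finset.sum_neg_distrib]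
  refine Finset.sum_congr rfl fun j _ => ?_
  rw [integral_const_mul, integral_const_mul, h.integral_eq, mul_neg]

/-- The derivative in direction `ξ` of the mollified component `u · ξ`, localised by `φ`. -/
theorem IsStrainDensity.fderiv_conv {Ω : Opens (Space n)} {u : Space n → Space n}
    {m : Measure (Space n)} {σ : Space n → Mat n} (h : IsStrainDensity Ω u m σ)
    (hu : MemLp u 1 (volume.restrict Ω)) {φ : Space n → ℝ} (hφ : ContDiff ℝ (⊤ : ℕ∞) φ)
    (hc : HasCompactSupport φ) {g : Space n → ℝ} {δ : ℝ} (hg : IsMollifier g δ) (ξ : Space n)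
    {x : Space n} (hx : ∀ y, x - y ∈ tsupport g → y ∈ tsupport φ → y ∈ Ω) :
    fderiv ℝ (conv ((Ω : Set (Space n)).indicator fun y => φ y * inner ℝ (u y) ξ) g) x ξ =
      ∫ y, g (x - y) * (φ y * quadForm (σ y) ξ) ∂m +
        ∫ y in Ω, g (x - y) * (inner ℝ (u y) ξ * fderiv ℝ φ y ξ) := by
  have hΩ : MeasurableSet (Ω : Set (Space n)) := Ω.isOpen.measurableSet
  obtain ⟨C, hC⟩ := hφ.continuous.bounded_above_of_compact_support hc
  have huξ : Integrable (fun y => inner ℝ (u y) ξ) (volume.restrict (Ω : Set (Space n))) :=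
    (memLp_one_iff_integrable.1 hu).inner_const ξ
  have hfi : Integrable (fun y => φ y * inner ℝ (u y) ξ) (volume.restrict (Ω : Set (Space n))) :=
    huξ.bdd_mul hφ.continuous.aestronglyMeasurable (ae_of_all _ hC)
  have hfl : LocallyIntegrable ((Ω : Set (Space n)).indicator fun y => φ y * inner ℝ (u y) ξ) :=
    ((integrable_indicator_iff hΩ).2 hfi).locallyIntegrable
  -- Only the part of the shifted kernel that meets the support of `φ` has to lie in `Ω`, so `x` may
  -- be close to the boundary.
  let ψ : 𝓓(Ω, ℝ) := kernelTest hg.contDiff hg.hasCompactSupport hφ x hx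
  have hψ : ∀ y, ψ y = g (x - y) * φ y := fun y => rfl
  have hψ' : ∀ y, fderiv ℝ ψ y ξ =
      g (x - y) * fderiv ℝ φ y ξ - fderiv ℝ g (x - y) ξ * φ y := by
    intro y
    have h1 : (ψ : Space n → ℝ) = fun y => g (x - y) * φ y := funext hψ
    have h2 : HasFDerivAt (fun y => g (x - y)) ((fderiv ℝ g (x - y)).comp
        (-ContinuousLinearMap.id ℝ (Space n))) y :=
      ((hg.contDiff.differentiable (by simp)) (x - y)).hasFDerivAt.comp y
        ((hasFDerivAt_id y).const_sub x)
    have h3 := h2.fun_mul ((hφ.differentiable (by simp)) y).hasFDerivAt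
    rw [h1, h3.fderiv]
    simp
    ring
  -- The product rule for `g (x - y) φ y` yields two terms: the one with the derivative of `g` is
  -- the derivative of the convolution, the one with the derivative of `φ` is the correction due to
  -- localisation.
  have hq := h.integral_quadForm hu ψ ξ
  simp_rw [hψ, hψ', mul_sub] at hq
  obtain ⟨C', hC'⟩ := (hφ.continuous_fderiv (by simp)).bounded_above_of_compact_support
    (hc.fderiv ℝ)
  obtain ⟨D, hD⟩ := hg.continuous.bounded_above_of_compact_support hg.hasCompactSupport
  obtain ⟨D', hD'⟩ := (hg.contDiff.continuous_fderiv (by simp)).bounded_above_of_compact_support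
    (hg.hasCompactSupport.fderiv ℝ)
  have hgx : Continuous fun y => g (x - y) := hg.continuous.comp (continuous_const.sub continuous_id)
  have hi1 : Integrable (fun y => inner ℝ (u y) ξ * (g (x - y) * fderiv ℝ φ y ξ))
      (volume.restrict (Ω : Set (Space n))) := by
    refine huξ.mul_bdd (c := D * (C' * ‖ξ‖)) ?_ (ae_of_all _ fun y => ?_)
    · exact (hgx.mul ((hφ.continuous_fderiv (by simp)).clm_apply
        continuous_const)).aestronglyMeasurable
    · rw [norm_mul]
      gcongr
      · exact (norm_nonneg _).trans (hD (x - y))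
      · exact hD _
      · exact (ContinuousLinearMap.le_opNorm _ _).trans (by gcongr; exact hC' y)
  have hi2 : Integrable (fun y => inner ℝ (u y) ξ * (fderiv ℝ g (x - y) ξ * φ y))
      (volume.restrict (Ω : Set (Space n))) := by
    refine huξ.mul_bdd (c := D' * ‖ξ‖ * C) ?_ (ae_of_all _ fun y => ?_)
    · exact ((((hg.contDiff.continuous_fderiv (by simp)).comp
        (continuous_const.sub continuous_id)).clm_apply
        continuous_const).mul hφ.continuous).aestronglyMeasurable
    · rw [norm_mul]
      gcongr
      · exact mul_nonneg ((norm_nonneg _).trans (hD' (x - y))) (norm_nonneg _)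
      · exact (ContinuousLinearMap.le_opNorm _ _).trans (by gcongr; exact hD' _)
      · exact hC y
  rw [MeasureTheory.integral_sub hi1 hi2] at hq
  rw [hg.fderiv_conv hfl]
  have e1 : ∫ y, (Ω : Set (Space n)).indicator (fun y => φ y * inner ℝ (u y) ξ) y *
      fderiv ℝ g (x - y) ξ = ∫ y in Ω, inner ℝ (u y) ξ * (fderiv ℝ g (x - y) ξ * φ y) := by
    rw [← integral_indicator hΩ]
    congr with y
    by_cases hy : y ∈ (Ω : Set (Space n))
    · simp only [hy, Set.indicator_of_mem]; ring
    · simp [hy]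
  have e2 : ∫ y in Ω, g (x - y) * (inner ℝ (u y) ξ * fderiv ℝ φ y ξ) =
      ∫ y in Ω, inner ℝ (u y) ξ * (g (x - y) * fderiv ℝ φ y ξ) := by
    congr with y; ring
  have e3 : ∫ y, g (x - y) * (φ y * quadForm (σ y) ξ) ∂m =
      ∫ y, g (x - y) * φ y * quadForm (σ y) ξ ∂m := by
    congr with y; ring
  rw [e1, e2, e3, hq]
  ring

end

/-! ### Gagliardo's inequality in oblique directions, and the choice of bases. -/

section

variable {n : ℕ}

/-- Gagliardo's inequality along the directions of a basis, on a set that the directions do not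
leave inside `B`. -/
theorem exists_lintegral_prod_le (hn : 2 ≤ n) {ξ : Fin n → Space n} (hξ : LinearIndependent ℝ ξ) :
    ∃ C : ℝ≥0∞, C ≠ ∞ ∧ ∀ (S B : Set (Space n)), MeasurableSet S →
      (∀ x ∈ S, ∀ i, ∀ t : ℝ, 0 ≤ t → x + t • ξ i ∈ B → x + t • ξ i ∈ S) →
      ∀ (H : Fin n → Space n → ℝ), (∀ i, ContDiff ℝ 1 (H i)) → (∀ i, HasCompactSupport (H i)) →
      ∀ (F : Space n → ℝ≥0∞), Measurable F →
      (∀ i, ∀ x ∈ S, ‖fderiv ℝ (H i) x (ξ i)‖ₑ ≤ F x) → (∀ i, ∀ x ∉ B, fderiv ℝ (H i) x = 0) →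
      ∫⁻ x in S, ∏ i, ‖H i x‖ₑ ^ ((1 : ℝ) / (n - 1)) ≤
        C * (∫⁻ x, F x) ^ ((n : ℝ) / (n - 1)) := by
  classical
  have hn1 : (0 : ℝ) < n - 1 := by
    have : (2 : ℝ) ≤ n := by exact_mod_cast hn
    linarith
  have hp : Real.HolderConjugate (Fintype.card (Fin n)) ((n : ℝ) / (n - 1)) := by
    rw [Fintype.card_fin]
    exact (Real.holderConjugate_iff_eq_conjExponent (by linarith)).2 rfl
  have hcard : Fintype.card (Fin n) = Module.finrank ℝ (Space n) := by simp
  have : Nonempty (Fin n) := ⟨⟨0, by omega⟩⟩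
  let b : Module.Basis (Fin n) ℝ (Space n) := basisOfLinearIndependentOfCardEqFinrank hξ hcard
  have hb : ∀ i, b i = ξ i := fun i => by simp [b]
  -- Coordinates along the basis with reversed sign: the half-line `x + t ξ i`, `t ≥ 0`, then
  -- corresponds to decreasing the `i`-th coordinate, in accordance with the integration over `(-∞,
  -- y i]` below.
  let T : (Fin n → ℝ) ≃L[ℝ] Space n :=
    b.equivFunL.symm.trans (ContinuousLinearEquiv.neg ℝ)
  have hT : ∀ y, T y = - ∑ i, y i • ξ i := by
    intro y
    have h1 : T y = - b.equivFun.symm y := rfl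
    rw [h1, Module.Basis.equivFun_symm_apply]
    simp_rw [hb]
  have hTu : ∀ y i t, T (Function.update y i t) = T y + (y i - t) • ξ i := by
    intro y i t
    rw [hT, hT, ← Finset.add_sum_erase _ _ (Finset.mem_univ i),
      ← Finset.add_sum_erase Finset.univ (fun i => y i • ξ i) (Finset.mem_univ i)]
    have : ∑ j ∈ Finset.univ.erase i, Function.update y i t j • ξ j =
        ∑ j ∈ Finset.univ.erase i, y j • ξ j := by
      refine Finset.sum_congr rfl fun j hj => ?_
      rw [Function.update_of_ne (Finset.ne_of_mem_erase hj)]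
    rw [this, Function.update_self, sub_smul]
    abel
  -- Uniqueness of Haar measure supplies the Jacobian of `T` as an unspecified nonzero constant.
  obtain ⟨c, hc⟩ : ∃ c : ℝ≥0, (volume : Measure (Space n)) =
      c • ((volume : Measure (Fin n → ℝ)).map T) := ⟨_, Measure.isAddLeftInvariant_eq_smul _ _⟩
  have hc0 : c ≠ 0 := by
    rintro rfl
    rw [zero_smul] at hc
    exact (NeZero.ne (volume : Measure (Space n))) hc
  have hvol : ∀ f : Space n → ℝ≥0∞, Measurable f → ∫⁻ x, f x = c * ∫⁻ y, f (T y) := by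
    intro f hf
    conv_lhs => rw [hc]
    rw [lintegral_smul_measure, lintegral_map hf T.continuous.measurable]
    rfl
  set p := (n : ℝ) / (n - 1) with hpdef
  have hp0 : 0 ≤ p := by positivity
  -- The factor `c` comes from changing variables on the left, and `c⁻¹ ^ p` from returning to `∫ F`
  -- on the right.
  refine ⟨c * ((c : ℝ≥0∞)⁻¹) ^ p, ENNReal.mul_ne_top (by simp)
    (ENNReal.rpow_ne_top_of_nonneg hp0 (by simpa using hc0)), ?_⟩
  intro S B hS hcone H hH hHc F hF hHF hH0
  have hHm : ∀ i, Measurable (H i) := fun i => (hH i).continuous.measurable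
  -- The fundamental theorem of calculus along the half-line. Its points in `B` remain in `S`, where
  -- `F` dominates the derivative; outside `B` the derivative vanishes.
  have key : ∀ y : Fin n → ℝ, T y ∈ S → ∀ i,
      ‖H i (T y)‖ₑ ≤ ∫⁻ t, F (T (Function.update y i t)) := by
    intro y hy i
    let h : ℝ → ℝ := fun t => H i (T (Function.update y i t))
    have hupd : ∀ t, h t = H i (T y + (y i - t) • ξ i) := fun t => by simp only [h, hTu]
    have hh : ContDiff ℝ 1 h :=
      ((hH i).comp T.contDiff).comp (contDiff_update 1 y i)
    have hhc : HasCompactSupport h :=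
      ((hHc i).comp_homeomorph T.toHomeomorph).comp_isClosedEmbedding
        (isClosedEmbedding_update y i)
    have hder : ∀ t, deriv h t = - fderiv ℝ (H i) (T y + (y i - t) • ξ i) (ξ i) := by
      intro t
      have h1 : HasDerivAt (fun t : ℝ => T y + (y i - t) • ξ i) (-(ξ i)) t := by
        have := (((hasDerivAt_id t).const_sub (y i)).smul_const (ξ i)).const_add (T y)
        simpa using this
      have h2 := (((hH i).differentiable (by simp))
        (T y + (y i - t) • ξ i)).hasFDerivAt.comp_hasDerivAt t h1
      have h3 : h = (H i) ∘ fun t : ℝ => T y + (y i - t) • ξ i := funext hupd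
      rw [h3, h2.deriv]; simp
    have h1 := HasCompactSupport.enorm_le_lintegral_Ici_deriv hh hhc (y i)
    have h2 : h (y i) = H i (T y) := by simp [hupd]
    rw [h2] at h1
    refine h1.trans ((setLIntegral_mono' measurableSet_Iic fun t ht => ?_).trans
      (setLIntegral_le_lintegral _ _))
    rw [hder, enorm_neg, hTu]
    by_cases hB : T y + (y i - t) • ξ i ∈ B
    · exact hHF i _ (hcone _ hy i _ (sub_nonneg.2 ht) hB)
    · simp [hH0 i _ hB]
  have hprod : Measurable fun x => ∏ i, ‖H i x‖ₑ ^ ((1 : ℝ) / (n - 1)) :=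
    Finset.measurable_prod _ fun i _ => (hHm i).enorm.pow_const _
  calc ∫⁻ x in S, ∏ i, ‖H i x‖ₑ ^ ((1 : ℝ) / (n - 1))
      = c * ∫⁻ y, S.indicator (fun x => ∏ i, ‖H i x‖ₑ ^ ((1 : ℝ) / (n - 1))) (T y) := by
        rw [← lintegral_indicator hS, hvol _ (hprod.indicator hS)]
    _ ≤ c * ∫⁻ y, ∏ i, (∫⁻ t, F (T (Function.update y i t))) ^ ((1 : ℝ) / (n - 1)) := by
        gcongr with y
        by_cases hy : T y ∈ S
        · rw [Set.indicator_of_mem hy]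
          gcongr with i
          exact key y hy i
        · simp [hy]
    -- The Gagliardo–Loomis–Whitney inequality in product coordinates.
    _ ≤ c * (∫⁻ y, F (T y)) ^ p := by
        gcongr
        have := lintegral_prod_lintegral_pow_le (fun _ : Fin n => (volume : Measure ℝ)) hp
          (f := fun y => F (T y)) (hF.comp T.continuous.measurable)
        simpa [volume_pi] using this
    _ = c * ((c : ℝ≥0∞)⁻¹) ^ p * (∫⁻ x, F x) ^ p := by
        rw [hvol F hF, mul_assoc, ← ENNReal.mul_rpow_of_nonneg _ _ hp0, ← mul_assoc,
          ENNReal.inv_mul_cancel (by simpa using hc0) (by simp), one_mul]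


/-- Finitely many bases close to a given vector such that no nonzero vector is orthogonal to an
element of each of them. -/
theorem exists_bases (hn : 2 ≤ n) (e : Space n) {κ : ℝ} (hκ : 0 < κ) :
    ∃ ξ : Fin n → Fin n → Space n, (∀ k i, ‖ξ k i - e‖ < κ) ∧
      (∀ k, LinearIndependent ℝ (ξ k)) ∧
      ∀ w : Space n, w ≠ 0 → ∃ k, ∀ i, inner ℝ w (ξ k i) ≠ 0 := by
  -- The vectors will be `e + s vd(τ k i)`, with `vd` the moment curve `(1, t, …, t^{n-1})` and `n²`
  -- distinct nodes `τ k i`.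
  let τ : Fin n → Fin n → ℝ := fun k i => ((finProdFinEquiv (k, i) : Fin (n * n)) : ℕ)
  have hτ : ∀ k i k' i', τ k i = τ k' i' → k = k' ∧ i = i' := by
    intro k i k' i' h
    have h1 : finProdFinEquiv (k, i) = finProdFinEquiv (k', i') := by
      exact Fin.ext (Nat.cast_injective (R := ℝ) h)
    simpa using finProdFinEquiv.injective h1
  let i₀ : Fin n := ⟨0, by omega⟩
  let vd : ℝ → Space n := fun t => WithLp.toLp 2 fun j => t ^ (j : ℕ)
  obtain ⟨M, hM⟩ : ∃ M : ℝ, ∀ k i, ‖vd (τ k i)‖ ≤ M := by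
    obtain ⟨M, hM⟩ := (Set.finite_range fun p : Fin n × Fin n => ‖vd (τ p.1 p.2)‖).bddAbove
    exact ⟨M, fun k i => hM ⟨(k, i), rfl⟩⟩
  have hM0 : 0 ≤ M := (norm_nonneg _).trans (hM i₀ i₀)
  -- Smallness of `s` keeps the vectors within `κ` of `e`. The condition `s ≠ - e i₀` ensures that
  -- the polynomial `P w` below determines `w`: if only `w i₀` survives, its constant coefficient is
  -- `w i₀ (e i₀ + s)`.
  obtain ⟨s, hs0, hs1, hs2⟩ : ∃ s : ℝ, 0 < s ∧ s * M < κ ∧ s ≠ - e i₀ := by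
    by_cases h : κ / (M + 1) / 2 = - e i₀
    · refine ⟨κ / (M + 1) / 4, by positivity, ?_, ?_⟩
      · rw [div_div, div_mul_eq_mul_div, div_lt_iff₀ (by positivity)]
        nlinarith
      · have : 0 < κ / (M + 1) := by positivity
        intro h'
        linarith
    · refine ⟨κ / (M + 1) / 2, by positivity, ?_, h⟩
      rw [div_div, div_mul_eq_mul_div, div_lt_iff₀ (by positivity)]
      nlinarith
  let ξ : Fin n → Fin n → Space n := fun k i => e + s • vd (τ k i)
  -- `P w` takes the value `w · ξ k i` at the node `τ k i` and has degree less than `n`, so a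
  -- nonzero `w` is orthogonal to fewer than `n` of all the vectors. Applied inside one family this
  -- gives linear independence; applied to one bad vector from each of the `n` families it gives the
  -- last claim.
  let P : Space n → Polynomial ℝ := fun w =>
    Polynomial.C (inner ℝ w e) + Polynomial.C s * ∑ j : Fin n, Polynomial.C (w j) *
      Polynomial.X ^ (j : ℕ)
  have hPeval : ∀ w k i, (P w).eval (τ k i) = inner ℝ w (ξ k i) := by
    intro w k i
    simp only [P, ξ, vd, Polynomial.eval_add, Polynomial.eval_mul, Polynomial.eval_C,
      Polynomial.eval_finsetSum, Polynomial.eval_pow, Polynomial.eval_X, inner_add_right,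
      inner_smul_right, PiLp.inner_apply]
    simp [mul_comm]
  have hPdeg : ∀ w, (P w).natDegree < n := by
    intro w
    have : (P w).natDegree ≤ n - 1 := by
      refine Polynomial.natDegree_add_le_of_degree_le (by simp) ?_
      refine (Polynomial.natDegree_C_mul_le _ _).trans ?_
      refine Polynomial.natDegree_sum_le_of_forall_le _ _ fun j _ => ?_
      refine (Polynomial.natDegree_C_mul_X_pow_le _ _).trans ?_
      omega
    omega
  have hcoeff : ∀ w (j : Fin n), (P w).coeff j = (if j = i₀ then inner ℝ w e else 0) + s * w j := by
    intro w j
    simp only [P, Polynomial.coeff_add, Polynomial.coeff_C_mul, Polynomial.finsetSum_coeff,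
      Polynomial.coeff_X_pow, Polynomial.coeff_C]
    congr 1
    · simp [i₀, Fin.ext_iff]
    · congr 1
      rw [Finset.sum_eq_single j]
      · simp
      · intro b _ hb
        simp [Fin.val_ne_of_ne hb.symm]
      · simp
  have hP0 : ∀ w, P w = 0 → w = 0 := by
    intro w hw
    have h1 : ∀ j, j ≠ i₀ → w j = 0 := by
      intro j hj
      have := hcoeff w j
      rw [hw, if_neg hj] at this
      simpa [hs0.ne'] using this
    have h2 : inner ℝ w e = w i₀ * e i₀ := by
      rw [PiLp.inner_apply, Finset.sum_eq_single i₀]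
      · simp [mul_comm]
      · intro j _ hj; simp [h1 j hj]
      · simp
    have h3 : w i₀ = 0 := by
      have := hcoeff w i₀
      rw [hw, if_pos rfl, h2, Polynomial.coeff_zero] at this
      have h4 : w i₀ * (e i₀ + s) = 0 := by linarith
      rcases mul_eq_zero.1 h4 with h | h
      · exact h
      · exact absurd (by linarith) hs2
    ext j
    by_cases hj : j = i₀
    · rw [hj, h3]; rfl
    · rw [h1 j hj]; rfl
  refine ⟨ξ, fun k i => ?_, fun k => ?_, fun w hw => ?_⟩
  · simp only [ξ, add_sub_cancel_left, norm_smul, Real.norm_eq_abs, abs_of_pos hs0]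
    exact (mul_le_mul_of_nonneg_left (hM k i) hs0.le).trans_lt hs1
  · have hcard : Fintype.card (Fin n) = Module.finrank ℝ (Space n) := by simp
    refine (linearIndependent_iff_card_eq_finrank_span (R := ℝ) (b := ξ k)).2 ?_
    have htop : Submodule.span ℝ (Set.range (ξ k)) = ⊤ := by
      rw [← Submodule.orthogonal_eq_bot_iff, Submodule.eq_bot_iff]
      intro w hw
      refine hP0 w (Polynomial.eq_zero_of_natDegree_lt_card_of_eval_eq_zero (P w)
        (f := fun i => τ k i) (fun i j h => (hτ k i k j h).2) (fun i => ?_) (by simpa using hPdeg w))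
      rw [hPeval, real_inner_comm]
      exact (Submodule.mem_orthogonal _ _).1 hw _ (Submodule.subset_span ⟨i, rfl⟩)
    rw [Set.finrank, htop, finrank_top, hcard]
  · by_contra hcon
    push Not at hcon
    choose j hj using hcon
    refine hw (hP0 w (Polynomial.eq_zero_of_natDegree_lt_card_of_eval_eq_zero (P w)
      (f := fun k => τ k (j k)) (fun k k' h => (hτ _ _ _ _ h).1) (fun k => ?_)
      (by simpa using hPdeg w)))
    rw [hPeval]
    exact hj k

/-- A lower bound for the sum of the products of components of a vector. -/
theorem exists_pos_mul_norm_rpow_le (hn : 2 ≤ n) {ξ : Fin n → Fin n → Space n}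
    (hξ : ∀ w : Space n, w ≠ 0 → ∃ k, ∀ i, inner ℝ w (ξ k i) ≠ 0) :
    ∃ c : ℝ, 0 < c ∧ ∀ w : Space n, c * ‖w‖ ^ ((n : ℝ) / (n - 1)) ≤
      ∑ k, ∏ i, |inner ℝ w (ξ k i)| ^ ((1 : ℝ) / (n - 1)) := by
  have hn1 : (0 : ℝ) < n - 1 := by
    have : (2 : ℝ) ≤ n := by exact_mod_cast hn
    linarith
  -- This function is continuous, positive away from `0` and homogeneous of degree `n / (n - 1)`;
  -- the constant is its minimum on the unit sphere.
  let f : Space n → ℝ := fun w => ∑ k, ∏ i, |inner ℝ w (ξ k i)| ^ ((1 : ℝ) / (n - 1))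
  have hf0 : ∀ w, 0 ≤ f w := fun w =>
    Finset.sum_nonneg fun k _ => Finset.prod_nonneg fun i _ => by positivity
  have hfpos : ∀ w, w ≠ 0 → 0 < f w := by
    intro w hw
    obtain ⟨k, hk⟩ := hξ w hw
    refine Finset.sum_pos' (fun k _ => Finset.prod_nonneg fun i _ => by positivity)
      ⟨k, Finset.mem_univ k, Finset.prod_pos fun i _ => ?_⟩
    exact Real.rpow_pos_of_pos (abs_pos.2 (hk i)) _
  have hfc : Continuous f := by
    refine continuous_finsetSum _ fun k _ => continuous_finsetProd _ fun i _ => ?_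
    refine Continuous.rpow_const ?_ fun _ => Or.inr (by positivity)
    fun_prop
  have hhom : ∀ (r : ℝ) (w : Space n), 0 ≤ r → f (r • w) = r ^ ((n : ℝ) / (n - 1)) * f w := by
    intro r w hr
    simp only [f, Finset.mul_sum, inner_smul_left, RCLike.conj_to_real, abs_mul, abs_of_nonneg hr]
    refine Finset.sum_congr rfl fun k _ => ?_
    simp_rw [Real.mul_rpow hr (abs_nonneg _)]
    rw [Finset.prod_mul_distrib, Finset.prod_const, Finset.card_univ, Fintype.card_fin,
      ← Real.rpow_natCast, ← Real.rpow_mul hr]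
    congr 2
    field_simp
  have : Nonempty (Fin n) := ⟨⟨0, by omega⟩⟩
  have hne : (Metric.sphere (0 : Space n) 1).Nonempty := NormedSpace.sphere_nonempty.2 zero_le_one
  obtain ⟨w₀, hw₀, hmin⟩ := (isCompact_sphere (0 : Space n) 1).exists_isMinOn hne hfc.continuousOn
  refine ⟨f w₀, hfpos w₀ ?_, fun w => ?_⟩
  · rintro rfl
    simp at hw₀
  · rcases eq_or_ne w 0 with rfl | hw
    · rw [norm_zero, Real.zero_rpow (by positivity), mul_zero]
      exact hf0 0
    · have hw1 : ‖w‖⁻¹ • w ∈ Metric.sphere (0 : Space n) 1 := by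
        simp [norm_smul, hw]
      have h1 : f w₀ ≤ f (‖w‖⁻¹ • w) := hmin hw1
      have h2 := hhom ‖w‖ (‖w‖⁻¹ • w) (norm_nonneg _)
      rw [smul_smul, mul_inv_cancel₀ (norm_ne_zero_iff.2 hw), one_smul] at h2
      change _ ≤ f w
      rw [h2, mul_comm]
      gcongr

end

/-! ### Integrability of `u` with the power `n / (n - 1)` on a Lipschitz domain. -/

section

variable {n : ℕ}

/-- Inside the ball of radius `r` about `x₀`, moving in a direction close to `e` does not leave
`Ω`. -/
def ConeCondition (Ω : Set (Space n)) (x₀ e : Space n) (r κ : ℝ) : Prop :=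
  ∀ x ∈ Ω, x ∈ Metric.ball x₀ r → ∀ z, ‖z - e‖ < κ → ∀ t : ℝ, 0 ≤ t →
    x + t • z ∈ Metric.ball x₀ r → x + t • z ∈ Ω

/-- At an interior point a ball contained in `Ω` suffices, with `e = 0`. At a boundary point `e` is
the vertical direction of the graph. Write `z = e + w`: moving by `t z` raises the height by at
least `t (1 - ‖w‖)`, while the graph rises by at most `K t ‖w‖`, so `‖w‖ < 1 / (K + 1)` keeps the
point above the graph. -/
theorem HasLipschitzBoundary.exists_coneCondition {Ω : Set (Space n)} (hΩ : IsOpen Ω)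
    (hL : HasLipschitzBoundary Ω) {x₀ : Space n} (hx₀ : x₀ ∈ closure Ω) :
    ∃ (e : Space n) (r κ : ℝ), 0 < r ∧ 0 < κ ∧ ConeCondition Ω x₀ e r κ := by
  by_cases hx : x₀ ∈ Ω
  · obtain ⟨r, hr, hball⟩ := Metric.isOpen_iff.1 hΩ x₀ hx
    exact ⟨0, r, 1, hr, one_pos, fun _ _ _ _ _ _ _ h => hball h⟩
  · obtain ⟨e, r, K, γ, he, hr, hγ, hiff⟩ := hL x₀ ⟨hx₀, by rwa [hΩ.interior_eq]⟩
    refine ⟨e, r, 1 / (K + 1), hr, by positivity, fun x hxΩ hxr z hz t ht hxt => ?_⟩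
    rw [hiff _ hxt]
    have hx1 := (hiff x hxr).1 hxΩ
    have hee : inner ℝ e e = 1 := by rw [real_inner_self_eq_norm_sq, he]; norm_num
    set w := z - e with hw
    have hz' : z = e + w := by rw [hw]; abel
    have h1 : inner ℝ e (x + t • z) = inner ℝ e x + t * (1 + inner ℝ e w) := by
      rw [inner_add_right, inner_smul_right, hz', inner_add_right, hee]
    have hew : |inner ℝ e w| ≤ ‖w‖ := by
      simpa [he] using abs_real_inner_le_norm e w
    have h2 : (x + t • z - inner ℝ e (x + t • z) • e) - (x - inner ℝ e x • e) =
        t • (w - inner ℝ e w • e) := by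
      rw [h1, hz']
      module
    have h3 : ‖w - inner ℝ e w • e‖ ≤ ‖w‖ := by
      have h4 : ‖w - inner ℝ e w • e‖ ^ 2 ≤ ‖w‖ ^ 2 := by
        rw [norm_sub_sq_real, inner_smul_right, norm_smul, he, real_inner_comm e w,
          Real.norm_eq_abs, mul_one, sq_abs, real_inner_comm w e]
        nlinarith [sq_nonneg (inner ℝ e w)]
      exact le_of_sq_le_sq h4 (norm_nonneg _)
    have h5 := hγ.dist_le_mul (x + t • z - inner ℝ e (x + t • z) • e) (x - inner ℝ e x • e)
    rw [dist_eq_norm, dist_eq_norm, h2, norm_smul, Real.norm_of_nonneg ht, Real.norm_eq_abs] at h5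
    have h6 := (le_abs_self _).trans h5
    have h7 : (K : ℝ) * (t * ‖w - inner ℝ e w • e‖) ≤ K * (t * ‖w‖) := by gcongr
    have h8 : ‖w‖ * (K + 1) < 1 := by rwa [lt_div_iff₀ (by positivity)] at hz
    have h9 := neg_le_of_abs_le hew
    refine lt_of_lt_of_eq ?_ h1.symm
    have h10 : t * (‖w‖ * (K + 1)) ≤ t * 1 := by gcongr
    have h11 : t * -‖w‖ ≤ t * inner ℝ e w := by gcongr
    nlinarith

theorem enorm_le_sum_enorm (a : Fin n → ℝ) : ‖a‖ₑ ≤ ∑ i, ‖a i‖ₑ := by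
  have h : ‖a‖₊ ≤ ∑ i, ‖a i‖₊ := by
    rw [Pi.nnnorm_def]
    exact Finset.sup_le fun i _ => Finset.single_le_sum (f := fun i => ‖a i‖₊)
      (fun _ _ => zero_le) (Finset.mem_univ i)
  simp only [enorm_eq_nnnorm]
  exact_mod_cast h

variable {Ω : Opens (Space n)} {u : Space n → Space n} {m : Measure (Space n)}
  {σ : Space n → Mat n}

theorem integrable_quadForm (hσ : Integrable σ m) (ξ : Space n) :
    Integrable (fun x => quadForm (σ x) ξ) m := by
  refine integrable_finsetSum _ fun i _ => integrable_finsetSum _ fun j _ => Integrable.const_mul ?_ _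
  rw [← memLp_one_iff_integrable]
  exact (memLp_piLp_iff.1 (memLp_one_iff_integrable.2 hσ)) (i, j)

/-- The products of the components of a localised function of bounded deformation along a basis of
admissible directions are integrable with the power `1 / (n - 1)`. -/
theorem IsStrainDensity.lintegral_prod_lt_top (hn : 2 ≤ n) [IsFiniteMeasure m]
    (h : IsStrainDensity Ω u m σ)
    (hu : MemLp u 1 (volume.restrict Ω)) {x₀ e : Space n} {r κ : ℝ} (hr : 0 < r) (hκ : 0 < κ)
    (hcone : ConeCondition (Ω : Set (Space n)) x₀ e r κ) {φ : Space n → ℝ}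
    (hφ : ContDiff ℝ (⊤ : ℕ∞) φ) (hφs : tsupport φ ⊆ Metric.closedBall x₀ (r / 2))
    {ξ : Fin n → Space n} (hξ : LinearIndependent ℝ ξ) (hξe : ∀ i, ‖ξ i - e‖ < κ) :
    ∫⁻ x in (Ω : Set (Space n)) ∩ Metric.ball x₀ r,
      ∏ i, ‖φ x * inner ℝ (u x) (ξ i)‖ₑ ^ ((1 : ℝ) / (n - 1)) < ∞ := by
  have hn1 : (0 : ℝ) < n - 1 := by
    have : (2 : ℝ) ≤ n := by exact_mod_cast hn
    linarith
  have hΩ : MeasurableSet (Ω : Set (Space n)) := Ω.isOpen.measurableSet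
  have hc : HasCompactSupport φ := HasCompactSupport.of_support_subset_isCompact
    (isCompact_closedBall x₀ (r / 2)) ((subset_tsupport φ).trans hφs)
  obtain ⟨C₀, hC₀⟩ := hφ.continuous.bounded_above_of_compact_support hc
  obtain ⟨C₁, hC₁⟩ := (hφ.continuous_fderiv (by simp)).bounded_above_of_compact_support
    (hc.fderiv ℝ)
  set S : Set (Space n) := (Ω : Set (Space n)) ∩ Metric.ball x₀ r with hSdef
  have hS : MeasurableSet S := hΩ.inter Metric.isOpen_ball.measurableSet
  have huξ : ∀ i, Integrable (fun y => inner ℝ (u y) (ξ i)) (volume.restrict (Ω : Set (Space n))) :=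
    fun i => (memLp_one_iff_integrable.1 hu).inner_const (ξ i)
  let f : Fin n → Space n → ℝ :=
    fun i => (Ω : Set (Space n)).indicator fun y => φ y * inner ℝ (u y) (ξ i)
  have hfi : ∀ i, Integrable (f i) := fun i => (integrable_indicator_iff hΩ).2
    ((huξ i).bdd_mul hφ.continuous.aestronglyMeasurable (ae_of_all _ hC₀))
  have hfz : ∀ i y, y ∉ Metric.closedBall x₀ (r / 2) → f i y = 0 := by
    intro i y hy
    have : φ y = 0 := by
      by_contra hne
      exact hy (hφs (subset_tsupport φ hne))
    by_cases hyΩ : y ∈ (Ω : Set (Space n)) <;> simp [f, hyΩ, this]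
  have hfc : ∀ i, HasCompactSupport (f i) := fun i =>
    HasCompactSupport.of_support_subset_isCompact (isCompact_closedBall x₀ (r / 2)) fun y hy => by
      by_contra hcon
      exact hy (hfz i y hcon)
  -- the dominating measure
  let A : Space n → ℝ≥0∞ := fun y => ∑ i, ‖φ y * quadForm (σ y) (ξ i)‖ₑ
  let B : Space n → ℝ≥0∞ := fun y => ∑ i, ‖inner ℝ (u y) (ξ i) * fderiv ℝ φ y (ξ i)‖ₑ
  have hAi : ∀ i, Integrable (fun y => φ y * quadForm (σ y) (ξ i)) m := fun i =>
    (integrable_quadForm h.integrable (ξ i)).bdd_mul hφ.continuous.aestronglyMeasurable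
      (ae_of_all _ hC₀)
  have hBi : ∀ i, Integrable (fun y => inner ℝ (u y) (ξ i) * fderiv ℝ φ y (ξ i))
      (volume.restrict (Ω : Set (Space n))) := fun i => by
    refine (huξ i).mul_bdd (c := C₁ * ‖ξ i‖) ?_ (ae_of_all _ fun y => ?_)
    · exact ((hφ.continuous_fderiv (by simp)).clm_apply continuous_const).aestronglyMeasurable
    · exact (ContinuousLinearMap.le_opNorm _ _).trans (by gcongr; exact hC₁ y)
  have hAm : AEMeasurable A m :=
    Finset.aemeasurable_fun_sum _ fun i _ => (hAi i).1.enorm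
  have hBm : AEMeasurable B (volume.restrict (Ω : Set (Space n))) :=
    Finset.aemeasurable_fun_sum _ fun i _ => (hBi i).1.enorm
  let M : Measure (Space n) :=
    m.withDensity A + (volume.restrict (Ω : Set (Space n))).withDensity B
  have hMfin : M Set.univ < ∞ := by
    simp only [M, Measure.add_apply, withDensity_apply _ MeasurableSet.univ, Measure.restrict_univ,
      A, B, ENNReal.add_lt_top]
    constructor
    · rw [lintegral_finsetSum' _ fun i _ => (hAi i).1.enorm]
      exact ENNReal.sum_lt_top.2 fun i _ => (hAi i).2
    · rw [lintegral_finsetSum' _ fun i _ => (hBi i).1.enorm]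
      exact ENNReal.sum_lt_top.2 fun i _ => (hBi i).2
  have : IsFiniteMeasure M := ⟨hMfin⟩
  -- the mollifiers
  let ε : ℕ → ℝ := fun k => r / (4 * (‖e‖ + κ) + 1) / (k + 1)
  have hε0 : ∀ k, 0 < ε k := fun k => by positivity
  have hεle : ∀ k, ε k * (‖e‖ + κ) < r / 4 := by
    intro k
    have h1 : ε k ≤ r / (4 * (‖e‖ + κ) + 1) :=
      div_le_self (by positivity) (by linarith [(Nat.cast_nonneg k : (0 : ℝ) ≤ k)])
    have h2 : r / (4 * (‖e‖ + κ) + 1) * (‖e‖ + κ) < r / 4 := by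
      rw [div_mul_eq_mul_div, div_lt_div_iff₀ (by positivity) (by norm_num)]
      nlinarith
    exact (mul_le_mul_of_nonneg_right h1 (by positivity)).trans_lt h2
  have hεlim : Tendsto ε atTop (𝓝 0) := by
    have := (tendsto_const_div_atTop_nhds_zero_nat (r / (4 * (‖e‖ + κ) + 1))).comp
      (tendsto_add_atTop_nat 1)
    refine this.congr fun k => ?_
    simp [ε]
  -- The kernel is supported around `-(ε k • e)`, so the average at `x` uses points `x + ε k z` with
  -- `‖z - e‖ < κ`, which the cone condition keeps in `Ω`. The choice of `ε k` bounds its radius by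
  -- `r / 4`; as `φ` is supported in the ball of radius `r / 2`, the convolutions vanish beyond `3 r
  -- / 4`.
  have hmol : ∀ k, ∃ g : Space n → ℝ, IsMollifier g (‖-(ε k • e)‖ + ε k * (κ / 2)) ∧
      tsupport g ⊆ Metric.closedBall (-(ε k • e)) (ε k * (κ / 2)) := fun k =>
    exists_isMollifier _ (mul_pos (hε0 k) (half_pos hκ))
  choose g hg hgs using hmol
  have hδeq : ∀ k, ‖-(ε k • e)‖ + ε k * (κ / 2) = ε k * (‖e‖ + κ / 2) := fun k => by
    rw [norm_neg, norm_smul, Real.norm_of_nonneg (hε0 k).le]; ring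
  have hδlt : ∀ k, ‖-(ε k • e)‖ + ε k * (κ / 2) < r / 4 := fun k => by
    rw [hδeq]
    refine lt_of_le_of_lt ?_ (hεle k)
    have := (hε0 k).le
    gcongr
    linarith
  have hδlim : Tendsto (fun k => ‖-(ε k • e)‖ + ε k * (κ / 2)) atTop (𝓝 0) := by
    simp_rw [hδeq]
    simpa using hεlim.mul_const (‖e‖ + κ / 2)
  have hgm : ∀ k, Measurable fun z : Space n => ENNReal.ofReal (g k z) := fun k =>
    ENNReal.measurable_ofReal.comp (hg k).continuous.measurable
  -- The mollification of the measure `M`: on `S` it dominates all the directional derivatives of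
  -- the convolutions, and by Tonelli its integral is the total mass of `M`, whatever `k`.
  let F : ℕ → Space n → ℝ≥0∞ := fun k x => ∫⁻ y, ENNReal.ofReal (g k (x - y)) ∂M
  have hgm2 : ∀ k, Measurable fun z : Space n × Space n => ENNReal.ofReal (g k (z.1 - z.2)) :=
    fun k => (hgm k).comp (measurable_fst.sub measurable_snd)
  have hFm : ∀ k, Measurable (F k) := fun k => (hgm2 k).lintegral_prod_right'
  have hFint : ∀ k, ∫⁻ x, F k x = M Set.univ := by
    intro k
    rw [lintegral_lintegral_swap (hgm2 k).aemeasurable]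
    simp_rw [(hg k).lintegral_ofReal_sub']
    simp
  obtain ⟨C, hCtop, hC⟩ := exists_lintegral_prod_le hn hξ
  let H : ℕ → Fin n → Space n → ℝ := fun k i => conv (f i) (g k)
  have hHd : ∀ k i, ContDiff ℝ (⊤ : ℕ∞) (H k i) := fun k i =>
    (hg k).contDiff_conv (hfi i).locallyIntegrable
  have hHz : ∀ k i x, 3 * r / 4 < dist x x₀ → H k i x = 0 := by
    intro k i x hx
    change conv (f i) (g k) x = 0
    rw [conv_apply]
    refine integral_eq_zero_of_ae (ae_of_all _ fun y => ?_)
    by_cases hy : y ∈ Metric.closedBall x₀ (r / 2)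
    · have h1 : ‖-(ε k • e)‖ + ε k * (κ / 2) < ‖x - y‖ := by
        have h2 := dist_triangle x y x₀
        rw [Metric.mem_closedBall] at hy
        rw [← dist_eq_norm]
        have := hδlt k
        linarith
      simp [(hg k).eq_zero h1]
    · simp [hfz i y hy]
  have hbound : ∀ k, ∫⁻ x in S, ∏ i, ‖H k i x‖ₑ ^ ((1 : ℝ) / (n - 1)) ≤
      C * (M Set.univ) ^ ((n : ℝ) / (n - 1)) := by
    intro k
    rw [← hFint k]
    refine hC S (Metric.ball x₀ r) hS ?_ (H k) (fun i => (hHd k i).of_le (by simp)) ?_ (F k) (hFm k)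
      ?_ ?_
    · intro x hx i t ht hxt
      exact ⟨hcone x hx.1 hx.2 (ξ i) (hξe i) t ht hxt, hxt⟩
    · intro i
      exact HasCompactSupport.convolution _ (hfc i) (hg k).hasCompactSupport
    · intro i x hx
      have hx' : ∀ y, x - y ∈ tsupport (g k) → y ∈ tsupport φ → y ∈ Ω := by
        intro y hy1 hy2
        have hyb : y ∈ Metric.ball x₀ r := by
          have := hφs hy2
          rw [Metric.mem_closedBall] at this
          rw [Metric.mem_ball]
          linarith
        have h1 := hgs k hy1
        rw [Metric.mem_closedBall, dist_eq_norm] at h1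
        have h2 : y = x + ε k • ((ε k)⁻¹ • (y - x)) := by
          rw [smul_smul, mul_inv_cancel₀ (hε0 k).ne', one_smul]; abel
        have h3 : ‖(ε k)⁻¹ • (y - x) - e‖ < κ := by
          have h4 : (ε k)⁻¹ • (y - x) - e = (ε k)⁻¹ • -(x - y - -(ε k • e)) := by
            have h5 : (ε k)⁻¹ • (ε k • e) = e := by
              rw [smul_smul, inv_mul_cancel₀ (hε0 k).ne', one_smul]
            conv_lhs => rw [← h5]
            module
          rw [h4, norm_smul, norm_neg, norm_inv, Real.norm_of_nonneg (hε0 k).le,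
            inv_mul_lt_iff₀ (hε0 k)]
          have := mul_pos (hε0 k) hκ
          linarith
        rw [h2] at hyb ⊢
        exact hcone x hx.1 hx.2 _ h3 _ (hε0 k).le hyb
      have h1 := h.fderiv_conv hu hφ hc (hg k) (ξ i) hx'
      change ‖fderiv ℝ (conv (f i) (g k)) x (ξ i)‖ₑ ≤ F k x
      rw [h1]
      have hm1 : Measurable fun y => ENNReal.ofReal (g k (x - y)) :=
        (hgm k).comp (measurable_const.sub measurable_id)
      have hF : F k x = ∫⁻ y, ENNReal.ofReal (g k (x - y)) * A y ∂m +
          ∫⁻ y in Ω, ENNReal.ofReal (g k (x - y)) * B y := by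
        simp only [F, M]
        rw [lintegral_add_measure, lintegral_withDensity_eq_lintegral_mul₀ hAm hm1.aemeasurable,
          lintegral_withDensity_eq_lintegral_mul₀ hBm hm1.aemeasurable]
        simp only [Pi.mul_apply, mul_comm]
      rw [hF]
      refine (enorm_add_le _ _).trans (add_le_add ?_ ?_)
      · refine (enorm_integral_le_lintegral_enorm _).trans (lintegral_mono fun y => ?_)
        rw [enorm_mul, Real.enorm_of_nonneg ((hg k).nonneg _)]
        gcongr
        exact Finset.single_le_sum (f := fun i => ‖φ y * quadForm (σ y) (ξ i)‖ₑ)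
          (fun _ _ => zero_le) (Finset.mem_univ i)
      · refine (enorm_integral_le_lintegral_enorm _).trans (lintegral_mono fun y => ?_)
        rw [enorm_mul, Real.enorm_of_nonneg ((hg k).nonneg _)]
        gcongr
        exact Finset.single_le_sum
          (f := fun i => ‖inner ℝ (u y) (ξ i) * fderiv ℝ φ y (ξ i)‖ₑ)
          (fun _ _ => zero_le) (Finset.mem_univ i)
    · intro i x hx
      have hev : H k i =ᶠ[𝓝 x] fun _ => 0 := by
        have hopen : IsOpen {x' : Space n | 3 * r / 4 < dist x' x₀} :=
          isOpen_lt continuous_const (continuous_id.dist continuous_const)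
        refine Filter.eventuallyEq_of_mem (hopen.mem_nhds ?_) fun x' hx' => hHz k i x' hx'
        rw [Metric.mem_ball, not_lt] at hx
        change 3 * r / 4 < dist x x₀
        linarith
      rw [hev.fderiv_eq]
      simp
  -- almost everywhere convergence along a subsequence
  have hconv : ∀ i, Tendsto (fun k => eLpNorm (H k i - f i) 1 volume) atTop (𝓝 0) := fun i =>
    tendsto_eLpNorm_conv_sub hg hδlim le_rfl (by simp) (memLp_one_iff_integrable.2 (hfi i))
  have hHm : ∀ k i, AEStronglyMeasurable (H k i) volume := fun k i =>
    (hHd k i).continuous.aestronglyMeasurable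
  -- Joint convergence of all components, so that a single subsequence converges almost everywhere
  -- for every `i`.
  have hvec : Tendsto (fun k => eLpNorm ((fun x i => H k i x) - fun x i => f i x : Space n →
      Fin n → ℝ) 1 volume) atTop (𝓝 0) := by
    refine tendsto_of_tendsto_of_tendsto_of_le_of_le tendsto_const_nhds
      (h := fun k => ∑ i, eLpNorm (H k i - f i) 1 volume) ?_ (fun _ => zero_le) fun k => ?_
    · simpa using tendsto_finsetSum Finset.univ fun i _ => hconv i
    · simp_rw [eLpNorm_one_eq_lintegral_enorm]
      rw [← lintegral_finsetSum' _ fun i _ => ((hHm k i).sub (hfi i).1).enorm]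
      refine lintegral_mono fun x => ?_
      exact enorm_le_sum_enorm _
  have hmeas := tendstoInMeasure_of_tendsto_eLpNorm one_ne_zero
    (fun k => (aemeasurable_pi_lambda _ fun i => (hHm k i).aemeasurable).aestronglyMeasurable)
    (aemeasurable_pi_lambda _ fun i => (hfi i).1.aemeasurable).aestronglyMeasurable hvec
  obtain ⟨ns, -, hns⟩ := hmeas.exists_seq_tendsto_ae
  have hlim : ∀ᵐ x ∂(volume.restrict S), Tendsto
      (fun k => ∏ i, ‖H (ns k) i x‖ₑ ^ ((1 : ℝ) / (n - 1))) atTop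
      (𝓝 (∏ i, ‖φ x * inner ℝ (u x) (ξ i)‖ₑ ^ ((1 : ℝ) / (n - 1)))) := by
    filter_upwards [ae_restrict_of_ae hns, ae_restrict_mem hS] with x hx hxS
    refine ENNReal.tendsto_finsetProd_of_ne_top _ (fun i _ => ?_) fun i _ =>
      ENNReal.rpow_ne_top_of_nonneg (by positivity) enorm_ne_top
    have h1 : f i x = φ x * inner ℝ (u x) (ξ i) := by simp [f, hxS.1]
    rw [← h1]
    exact ((tendsto_pi_nhds.1 hx i).enorm).ennrpow_const _
  calc ∫⁻ x in S, ∏ i, ‖φ x * inner ℝ (u x) (ξ i)‖ₑ ^ ((1 : ℝ) / (n - 1))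
      = ∫⁻ x in S, liminf (fun k => ∏ i, ‖H (ns k) i x‖ₑ ^ ((1 : ℝ) / (n - 1))) atTop :=
        lintegral_congr_ae (by filter_upwards [hlim] with x hx using hx.liminf_eq.symm)
    -- Fatou's lemma transfers the uniform bound to the limit.
    _ ≤ liminf (fun k => ∫⁻ x in S, ∏ i, ‖H (ns k) i x‖ₑ ^ ((1 : ℝ) / (n - 1))) atTop :=
        lintegral_liminf_le fun k => Finset.measurable_fun_prod _ fun i _ =>
          ((hHd _ i).continuous.measurable.enorm.pow_const _)
    _ ≤ C * (M Set.univ) ^ ((n : ℝ) / (n - 1)) :=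
        (liminf_le_liminf (Eventually.of_forall fun k => hbound (ns k))).trans_eq
          (liminf_const _)
    _ < ∞ := ENNReal.mul_lt_top hCtop.lt_top
        (ENNReal.rpow_lt_top_of_nonneg (by positivity) hMfin.ne)

/-- The finitely many bases of `exists_bases` lie in the cone of admissible directions. On the ball
of radius `r / 4` the bump equals `1`, and `|u|^{n/(n-1)}` is bounded by a constant times the sum of
the integrable products attached to these bases. -/
theorem IsStrainDensity.exists_lintegral_ball_lt_top (hn : 2 ≤ n) [IsFiniteMeasure m]
    (h : IsStrainDensity Ω u m σ) (hu : MemLp u 1 (volume.restrict Ω))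
    (hL : HasLipschitzBoundary (Ω : Set (Space n))) {x₀ : Space n}
    (hx₀ : x₀ ∈ closure (Ω : Set (Space n))) :
    ∃ r > 0, ∫⁻ x in (Ω : Set (Space n)) ∩ Metric.ball x₀ r,
      ‖u x‖ₑ ^ ((n : ℝ) / (n - 1)) < ∞ := by
  have hn1 : (0 : ℝ) < n - 1 := by
    have : (2 : ℝ) ≤ n := by exact_mod_cast hn
    linarith
  have hΩ : MeasurableSet (Ω : Set (Space n)) := Ω.isOpen.measurableSet
  obtain ⟨e, r, κ, hr, hκ, hcone⟩ := hL.exists_coneCondition Ω.isOpen hx₀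
  obtain ⟨ξ, hξe, hξ, hξ0⟩ := exists_bases hn e hκ
  obtain ⟨c, hc0, hc⟩ := exists_pos_mul_norm_rpow_le hn hξ0
  let b : ContDiffBump x₀ := ⟨r / 4, r / 2, by linarith, by linarith⟩
  have hb := fun k => h.lintegral_prod_lt_top hn hu hr hκ hcone (φ := b) b.contDiff
    b.tsupport_eq.le (hξ k) (hξe k)
  refine ⟨r / 4, by linarith, ?_⟩
  have hsub : (Ω : Set (Space n)) ∩ Metric.ball x₀ (r / 4) ⊆ Ω ∩ Metric.ball x₀ r :=
    Set.inter_subset_inter_right _ (Metric.ball_subset_ball (by linarith))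
  have hS : MeasurableSet ((Ω : Set (Space n)) ∩ Metric.ball x₀ (r / 4)) :=
    hΩ.inter Metric.isOpen_ball.measurableSet
  have huξ : ∀ k i, AEMeasurable (fun y => ‖b y * inner ℝ (u y) (ξ k i)‖ₑ ^ ((1 : ℝ) / (n - 1)))
      (volume.restrict ((Ω : Set (Space n)) ∩ Metric.ball x₀ (r / 4))) := fun k i => by
    have h1 : AEStronglyMeasurable (fun y => inner ℝ (u y) (ξ k i))
        (volume.restrict (Ω : Set (Space n))) :=
      ((memLp_one_iff_integrable.1 hu).inner_const (ξ k i)).1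
    have h2 := (b.continuous.aestronglyMeasurable.mul h1).enorm.pow_const ((1 : ℝ) / (n - 1))
    exact h2.mono_measure (Measure.restrict_mono Set.inter_subset_left le_rfl)
  have hpt : ∀ x ∈ (Ω : Set (Space n)) ∩ Metric.ball x₀ (r / 4),
      ENNReal.ofReal c * ‖u x‖ₑ ^ ((n : ℝ) / (n - 1)) ≤
        ∑ k, ∏ i, ‖b x * inner ℝ (u x) (ξ k i)‖ₑ ^ ((1 : ℝ) / (n - 1)) := by
    intro x hx
    have hbx : b x = 1 := b.one_of_mem_closedBall (Metric.ball_subset_closedBall hx.2)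
    simp_rw [hbx, one_mul]
    have h1 := ENNReal.ofReal_le_ofReal (hc (u x))
    rw [ENNReal.ofReal_mul hc0.le, ← ENNReal.ofReal_rpow_of_nonneg (norm_nonneg _) (by positivity),
      ENNReal.ofReal_sum_of_nonneg fun k _ => Finset.prod_nonneg fun i _ => by positivity,
      ofReal_norm] at h1
    refine h1.trans_eq (Finset.sum_congr rfl fun k _ => ?_)
    rw [ENNReal.ofReal_prod_of_nonneg fun i _ => by positivity]
    refine Finset.prod_congr rfl fun i _ => ?_
    rw [← ENNReal.ofReal_rpow_of_nonneg (abs_nonneg _) (by positivity), ← Real.norm_eq_abs,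
      ofReal_norm]
  have hle : ENNReal.ofReal c * ∫⁻ x in (Ω : Set (Space n)) ∩ Metric.ball x₀ (r / 4),
      ‖u x‖ₑ ^ ((n : ℝ) / (n - 1)) < ∞ := by
    rw [← lintegral_const_mul' _ _ ENNReal.ofReal_ne_top]
    refine (setLIntegral_mono' hS hpt).trans_lt ?_
    rw [lintegral_finsetSum' _ fun k _ => Finset.aemeasurable_fun_prod _ fun i _ => huξ k i]
    exact ENNReal.sum_lt_top.2 fun k _ =>
      (lintegral_mono_set hsub).trans_lt (hb k)
  exact ENNReal.lt_top_of_mul_ne_top_right hle.ne (by simpa using hc0)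

/-- Functions of bounded deformation on a bounded Lipschitz domain are integrable with the power
`n / (n - 1)`. -/
theorem IsStrainDensity.memLp (hn : 2 ≤ n) [IsFiniteMeasure m]
    (h : IsStrainDensity Ω u m σ) (hu : MemLp u 1 (volume.restrict Ω))
    (hb : Bornology.IsBounded (Ω : Set (Space n)))
    (hL : HasLipschitzBoundary (Ω : Set (Space n))) :
    MemLp u (ENNReal.ofReal ((n : ℝ) / (n - 1))) (volume.restrict Ω) := by
  have hn1 : (0 : ℝ) < n - 1 := by
    have : (2 : ℝ) ≤ n := by exact_mod_cast hn
    linarith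
  have hp : 0 < (n : ℝ) / (n - 1) := by positivity
  refine ⟨hu.1, ?_⟩
  rw [eLpNorm_lt_top_iff_lintegral_rpow_enorm_lt_top (by simpa using hp) ENNReal.ofReal_ne_top,
    ENNReal.toReal_ofReal hp.le]
  have hK : IsCompact (closure (Ω : Set (Space n))) := hb.isCompact_closure
  -- Finiteness of the integral over `Ω ∩ s` passes to subsets and finite unions, so compactness of
  -- the closure reduces it to small balls.
  have hind := hK.induction_on (p := fun s => ∫⁻ x in (Ω : Set (Space n)) ∩ s,
      ‖u x‖ₑ ^ ((n : ℝ) / (n - 1)) < ∞) (by simp)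
    (fun s t hst ht => (lintegral_mono_set (Set.inter_subset_inter_right _ hst)).trans_lt ht)
    (fun s t hs ht => by
      rw [Set.inter_union_distrib_left]
      exact (lintegral_union_le _ _ _).trans_lt (ENNReal.add_lt_top.2 ⟨hs, ht⟩))
    (fun x hx => by
      obtain ⟨r, hr, hfin⟩ := h.exists_lintegral_ball_lt_top hn hu hL hx
      exact ⟨Metric.ball x r, mem_nhdsWithin_of_mem_nhds (Metric.ball_mem_nhds x hr), hfin⟩)
  rwa [Set.inter_eq_left.2 subset_closure] at hind

end

/-! ### Smallness of the strain where functions of small `W^{1,n}` norm are bounded below. -/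

section

variable {n : ℕ}

theorem exists_cutoff {K O : Set (Space n)} (hK : IsCompact K) (hO : IsOpen O) (hKO : K ⊆ O) :
    ∃ χ : Space n → ℝ, ContDiff ℝ (⊤ : ℕ∞) χ ∧ HasCompactSupport χ ∧ tsupport χ ⊆ O ∧
      (∀ x, 0 ≤ χ x ∧ χ x ≤ 1) ∧ ∃ V : Set (Space n), IsOpen V ∧ K ⊆ V ∧ ∀ x ∈ V, χ x = 1 := by
  obtain ⟨ρ, hρ, hsub⟩ := hK.exists_cthickening_subset_open hO hKO
  obtain ⟨f, hf1, hf0, hf⟩ := exists_contMDiffMap_one_nhds_of_subset_interior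
    (modelWithCornersSelf ℝ (Space n)) (n := (⊤ : ℕ∞)) hK.isClosed
    (t := Metric.cthickening ρ K)
    ((Metric.self_subset_thickening hρ K).trans
      (interior_maximal (Metric.thickening_subset_cthickening ρ K) Metric.isOpen_thickening))
  have hsupp : tsupport f ⊆ Metric.cthickening ρ K := by
    refine closure_minimal (fun x hx => ?_) Metric.isClosed_cthickening
    by_contra hcon
    exact hx (hf0 x hcon)
  obtain ⟨V, hV, hKV, hV1⟩ := (eventually_nhdsSet_iff_exists).1 hf1
  exact ⟨f, contMDiff_iff_contDiff.1 f.contMDiff,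
    HasCompactSupport.of_support_subset_isCompact hK.cthickening
      ((subset_tsupport _).trans hsupp), hsupp.trans hsub, hf, V, hV, hKV, hV1⟩

/-- Bounded measurable functions are approximated by test functions in `L¹` of a finite measure. -/
theorem exists_testFunction_lintegral_sub_le {Ω : Opens (Space n)} (M : Measure (Space n))
    [IsFiniteMeasure M] (hM : M (Ω : Set (Space n))ᶜ = 0) {τ : Space n → ℝ} (hτ : Measurable τ)
    (hτ1 : ∀ x, |τ x| ≤ 1) {ε : ℝ≥0∞} (hε : ε ≠ 0) :
    ∃ φ : 𝓓(Ω, ℝ), ∫⁻ x, ‖τ x - φ x‖ₑ ∂M ≤ ε := by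
  classical
  have hε3 : ε / 3 ≠ 0 := (ENNReal.div_pos hε (by simp)).ne'
  have hτi : MemLp τ 1 M := memLp_one_iff_integrable.2
    (Integrable.of_bound hτ.aestronglyMeasurable 1 (ae_of_all _ hτ1))
  -- Three errors of size `ε / 3`: `τ` is replaced by a compactly supported continuous `h` in `L¹`,
  -- `h` by a smooth `f` uniformly, and the cutoff `χ` costs at most the measure of `Ω \ K` because
  -- `|τ| ≤ 1`.
  obtain ⟨h, hhc, hhε, hh, -⟩ := hτi.exists_hasCompactSupport_eLpNorm_sub_le (by simp) hε3
  obtain ⟨K, hKΩ, hK, hKε⟩ : ∃ K ⊆ (Ω : Set (Space n)), IsCompact K ∧ M (Ω \ K) < ε / 3 :=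
    Ω.isOpen.measurableSet.exists_isCompact_sdiff_lt (measure_ne_top M _) hε3
  obtain ⟨χ, hχ, hχc, hχΩ, hχ01, V, -, hKV, hV⟩ := exists_cutoff hK Ω.isOpen hKΩ
  obtain ⟨s, hs0, hs⟩ : ∃ s : ℝ, 0 < s ∧ ENNReal.ofReal s * M Set.univ ≤ ε / 3 := by
    obtain ⟨c, hc⟩ : ∃ c : ℝ≥0, M Set.univ = c :=
      ⟨_, (ENNReal.coe_toNNReal (measure_ne_top M _)).symm⟩
    rcases eq_or_ne (ε / 3) ∞ with hη' | hη'
    · exact ⟨1, one_pos, by simp [hη']⟩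
    have hη'' : 0 < (ε / 3).toReal := ENNReal.toReal_pos hε3 hη'
    refine ⟨(ε / 3).toReal / (c + 1), by positivity, ?_⟩
    rw [hc, ← ENNReal.ofReal_coe_nnreal, ← ENNReal.ofReal_mul (by positivity)]
    refine ENNReal.ofReal_le_of_le_toReal ?_
    rw [div_mul_eq_mul_div, div_le_iff₀ (by positivity)]
    gcongr
    linarith
  obtain ⟨f, hf, hfh⟩ :=
    (hhc.uniformContinuous_of_continuous hh).exists_contDiff_dist_le hs0
  refine ⟨⟨fun x => χ x * f x, hχ.mul hf, hχc.mul_right,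
    (closure_mono (Function.support_mul_subset_left _ _)).trans hχΩ⟩, ?_⟩
  have hpt : ∀ᵐ x ∂M, ‖τ x - χ x * f x‖ₑ ≤
      ENNReal.ofReal s + ‖(τ - h) x‖ₑ + ((Ω : Set (Space n)) \ K).indicator 1 x := by
    have hΩae : ∀ᵐ x ∂M, x ∈ (Ω : Set (Space n)) := by
      rw [ae_iff]; exact hM
    filter_upwards [hΩae] with x hx
    have h1 : |f x - h x| ≤ s := by
      have := (hfh x).le
      rwa [Real.dist_eq] at this
    have hr : |τ x - χ x * f x| ≤ s + |τ x - h x| + (if x ∈ K then 0 else 1) := by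
      have e1 : τ x - χ x * f x = (1 - χ x) * τ x + χ x * (τ x - h x) - χ x * (f x - h x) := by
        ring
      have h2 : |(1 - χ x) * τ x| ≤ if x ∈ K then 0 else 1 := by
        split_ifs with hxK
        · rw [hV x (hKV hxK)]; simp
        · rw [abs_mul, abs_of_nonneg (by linarith [(hχ01 x).2])]
          exact mul_le_one₀ (by linarith [(hχ01 x).1]) (abs_nonneg _) (hτ1 x)
      have h3 : ∀ a : ℝ, |χ x * a| ≤ |a| := fun a => by
        rw [abs_mul, abs_of_nonneg (hχ01 x).1]
        exact mul_le_of_le_one_left (abs_nonneg _) (hχ01 x).2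
      rw [e1]
      have h4 := abs_sub ((1 - χ x) * τ x + χ x * (τ x - h x)) (χ x * (f x - h x))
      have h5 := abs_add_le ((1 - χ x) * τ x) (χ x * (τ x - h x))
      linarith [h3 (τ x - h x), h3 (f x - h x)]
    have h6 := ENNReal.ofReal_le_ofReal hr
    rw [ENNReal.ofReal_add (by positivity) (by split_ifs <;> norm_num),
      ENNReal.ofReal_add hs0.le (abs_nonneg _), ← Real.enorm_eq_ofReal_abs,
      ← Real.enorm_eq_ofReal_abs] at h6
    refine h6.trans (add_le_add le_rfl ?_)
    by_cases hxK : x ∈ K <;> simp [hxK, hx]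
  refine (lintegral_mono_ae hpt).trans ?_
  have hmeas : MeasurableSet ((Ω : Set (Space n)) \ K) := Ω.isOpen.measurableSet.diff hK.measurableSet
  rw [lintegral_add_right _ (measurable_one.indicator hmeas), lintegral_add_left measurable_const,
    lintegral_const, lintegral_indicator_one hmeas, ← eLpNorm_one_eq_lintegral_enorm]
  calc _ ≤ ε / 3 + ε / 3 + ε / 3 := add_le_add (add_le_add hs hhε) hKε.le
    _ = ε := ENNReal.add_thirds ε

/-- A smooth bounded function which vanishes at `0` and is at least `1 / 2` outside `(-1, 1)`. -/
def softSq (t : ℝ) : ℝ := t ^ 2 / (1 + t ^ 2)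

theorem contDiff_softSq : ContDiff ℝ (⊤ : ℕ∞) softSq :=
  (contDiff_id.pow 2).div (contDiff_const.add (contDiff_id.pow 2)) fun t => by
    have := sq_nonneg t
    positivity

theorem softSq_zero : softSq 0 = 0 := by simp [softSq]

theorem softSq_nonneg (t : ℝ) : 0 ≤ softSq t := by unfold softSq; positivity

theorem softSq_le_one (t : ℝ) : softSq t ≤ 1 := by
  unfold softSq
  rw [div_le_one (by positivity)]
  linarith

/-- Together with the bound `1` on the derivative, this shows that composing with `softSq` increases
neither the norm of a function nor that of its gradient. It is a smooth substitute for the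
truncation `min |t| 1`. -/
theorem softSq_le_abs (t : ℝ) : softSq t ≤ |t| := by
  unfold softSq
  rw [div_le_iff₀ (by positivity), ← sq_abs]
  nlinarith [sq_nonneg (|t| - 1), abs_nonneg t, mul_nonneg (abs_nonneg t) (sq_nonneg (|t| - 1))]

theorem half_le_softSq {t : ℝ} (ht : 1 ≤ |t|) : 1 / 2 ≤ softSq t := by
  unfold softSq
  rw [div_le_div_iff₀ (by norm_num) (by positivity), ← sq_abs]
  nlinarith

/-- The derivative of `softSq`. -/
def softSqDeriv (t : ℝ) : ℝ := 2 * t / (1 + t ^ 2) ^ 2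

theorem hasDerivAt_softSq (t : ℝ) : HasDerivAt softSq (softSqDeriv t) t := by
  have h0 : (1 + t ^ 2) ≠ 0 := by positivity
  have h := ((hasDerivAt_id t).pow 2).div (((hasDerivAt_id t).pow 2).const_add 1) h0
  refine h.congr_deriv ?_
  simp [softSqDeriv]
  field_simp
  ring

theorem abs_softSqDeriv_le (t : ℝ) : |softSqDeriv t| ≤ 1 := by
  unfold softSqDeriv
  rw [abs_div, abs_of_nonneg (by positivity : (0 : ℝ) ≤ (1 + t ^ 2) ^ 2),
    div_le_one (by positivity), abs_mul, abs_two]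
  have h : t ^ 2 = |t| ^ 2 := (sq_abs t).symm
  rw [h]
  nlinarith [sq_nonneg (|t| - 1), sq_nonneg (|t|), sq_nonneg (|t| ^ 2)]

theorem holderTriple (hn : 2 ≤ n) :
    ENNReal.HolderTriple (ENNReal.ofReal ((n : ℝ) / (n - 1))) (n : ℝ≥0∞) 1 := by
  have hn1 : (1 : ℝ) < n := by exact_mod_cast hn
  have h : Real.HolderConjugate n ((n : ℝ) / (n - 1)) :=
    (Real.holderConjugate_iff_eq_conjExponent hn1).2 rfl
  have := h.symm.ennrealOfReal
  simpa using this

theorem exists_ne_zero_mul_le {a η : ℝ≥0∞} (ha : a ≠ ∞) (hη : η ≠ 0) :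
    ∃ δ : ℝ≥0∞, δ ≠ 0 ∧ δ ≠ ∞ ∧ a * δ ≤ η := by
  have h : Tendsto (fun δ : ℝ≥0∞ => a * δ) (𝓝 0) (𝓝 0) := by
    simpa using ENNReal.Tendsto.const_mul (tendsto_id (x := 𝓝 (0 : ℝ≥0∞))) (Or.inr ha)
  have h1 : ∀ᶠ δ in 𝓝 (0 : ℝ≥0∞), a * δ ≤ η := h.eventually_le_const hη.bot_lt
  obtain ⟨δ, hδ, hδ'⟩ := ENNReal.nhds_zero_basis_Iic.eventually_iff.1 h1
  refine ⟨min δ 1, by simp [hδ.ne'], by simp, hδ' ?_⟩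
  simp

theorem gradient_mul_apply {f g : Space n → ℝ} {x : Space n} (hf : DifferentiableAt ℝ f x)
    (hg : DifferentiableAt ℝ g x) (i : Fin n) :
    (∇ (fun y => f y * g y) x) i = f x * (∇ g x) i + g x * (∇ f x) i := by
  simp only [gradient_apply]
  rw [fderiv_fun_mul hf hg]
  simp

theorem lintegral_comp_mul_le (hn : 2 ≤ n) {Ω : Set (Space n)} {u : Space n → Space n}
    (hu : AEStronglyMeasurable u (volume.restrict Ω)) {f : Space n → ℝ}
    (hf : AEStronglyMeasurable f (volume.restrict Ω)) (i : Fin n) :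
    ∫⁻ x in Ω, ‖u x i‖ₑ * ‖f x‖ₑ ≤
      eLpNorm u (ENNReal.ofReal ((n : ℝ) / (n - 1))) (volume.restrict Ω) *
        eLpNorm f n (volume.restrict Ω) := by
  have := (holderTriple hn).symm
  have h := eLpNorm_smul_le_mul_eLpNorm (p := n) (q := ENNReal.ofReal ((n : ℝ) / (n - 1))) (r := 1)
    (f := u) (φ := f) hu hf
  rw [eLpNorm_one_eq_lintegral_enorm, mul_comm] at h
  refine le_trans (lintegral_mono fun x => ?_) h
  rw [Pi.smul_apply', enorm_smul, mul_comm]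
  gcongr
  rw [← ofReal_norm, ← ofReal_norm]
  exact ENNReal.ofReal_le_ofReal (PiLp.norm_apply_le _ _)

/-- A measure that is a component of the strain is small on compact sets of small capacity. -/
theorem IsStrainDensity.exists_setLIntegral_component_le (hn : 2 ≤ n) {Ω : Opens (Space n)}
    {u : Space n → Space n} {m : Measure (Space n)} {σ : Space n → Mat n}
    (h : IsStrainDensity Ω u m σ)
    (hu : MemLp u (ENNReal.ofReal ((n : ℝ) / (n - 1))) (volume.restrict Ω)) (i j : Fin n)
    {η : ℝ≥0∞} (hη : η ≠ 0) :
    ∃ δ : ℝ≥0∞, δ ≠ 0 ∧ ∀ ψ : Space n → ℝ, ContDiff ℝ (⊤ : ℕ∞) ψ → (∀ x, 0 ≤ ψ x ∧ ψ x ≤ 2) →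
      eLpNorm ψ n volume ≤ δ → (∀ i, eLpNorm (fun x => (∇ ψ x) i) n volume ≤ δ) →
      ∀ K : Set (Space n), MeasurableSet K → (∀ x ∈ K, 1 / 4 ≤ ψ x) →
        ∫⁻ x in K, ‖σ x (i, j)‖ₑ ∂m ≤ η := by
  have hσm : Measurable fun x => σ x (i, j) :=
    (EuclideanSpace.proj (𝕜 := ℝ) (i, j)).continuous.measurable.comp h.measurable
  have hσi : Integrable (fun x => σ x (i, j)) m := by
    rw [← memLp_one_iff_integrable]
    exact (memLp_piLp_iff.1 (memLp_one_iff_integrable.2 h.integrable)) (i, j)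
  -- The sign of the entry, so that `τ σ (i, j) = |σ (i, j)|`. It will be replaced by a test
  -- function `φ` fixed before `ψ`; hence `δ` depends on `φ`, and the result is an absolute
  -- continuity statement rather than a linear estimate.
  let τ : Space n → ℝ := fun x => if 0 ≤ σ x (i, j) then 1 else -1
  have hτm : Measurable τ :=
    Measurable.ite (measurableSet_le measurable_const hσm) measurable_const measurable_const
  have hτ1 : ∀ x, |τ x| ≤ 1 := fun x => by simp only [τ]; split_ifs <;> simp
  have hτσ : ∀ x, τ x * σ x (i, j) = |σ x (i, j)| := fun x => by
    simp only [τ]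
    split_ifs with h0
    · rw [one_mul, abs_of_nonneg h0]
    · rw [neg_one_mul, abs_of_neg (not_le.1 h0)]
  let M := m.withDensity fun x => ‖σ x (i, j)‖ₑ
  have hMf : IsFiniteMeasure M := isFiniteMeasure_withDensity hσi.2.ne
  have hMc : M (Ω : Set (Space n))ᶜ = 0 := withDensity_absolutelyContinuous _ _ h.measure_compl
  have hη16 : η / 16 ≠ 0 := (ENNReal.div_pos hη (by simp)).ne'
  obtain ⟨φ, hφ⟩ := exists_testFunction_lintegral_sub_le M hMc hτm hτ1 hη16
  have hφm : Measurable fun x => ‖τ x - φ x‖ₑ := (hτm.sub φ.contDiff.continuous.measurable).enorm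
  rw [lintegral_withDensity_eq_lintegral_mul _ hσm.enorm hφm] at hφ
  obtain ⟨C₁, hC₁⟩ := TestFunction.exists_bound φ
  obtain ⟨C₂, hC₂⟩ := exists_bound_gradient φ.contDiff φ.hasCompactSupport
  let C := max C₁ C₂
  have hC₁' : ∀ x, ‖φ x‖ₑ ≤ ENNReal.ofReal C := fun x => by
    rw [← ofReal_norm]; exact ENNReal.ofReal_le_ofReal ((hC₁ x).trans (le_max_left _ _))
  have hC₂' : ∀ x k, ‖(∇ φ x) k‖ₑ ≤ ENNReal.ofReal C := fun x k => by
    rw [← ofReal_norm]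
    exact ENNReal.ofReal_le_ofReal
      (((PiLp.norm_apply_le _ _).trans (hC₂ x)).trans (le_max_right _ _))
  set B := eLpNorm u (ENNReal.ofReal ((n : ℝ) / (n - 1))) (volume.restrict (Ω : Set (Space n)))
    with hB
  -- The factor `16` is `4 · 4`: one `4` from `ψ ≥ 1 / 4` on `K`, the other from two terms of the
  -- symmetrised gradient, each with two terms of the product rule. This uses `η / 2`; the other
  -- half is `4 · 2 · (η / 16)`, the cost of approximating the sign, with `ψ ≤ 2`.
  obtain ⟨δ, hδ0, -, hδ⟩ := exists_ne_zero_mul_le (a := 16 * (ENNReal.ofReal C * B)) (η := η / 2)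
    (ENNReal.mul_ne_top (by simp) (ENNReal.mul_ne_top (by simp) hu.2.ne))
    (ENNReal.div_pos hη (by simp)).ne'
  refine ⟨δ, hδ0, fun ψ hψ hψ01 hψδ hψδ' K hK hψK => ?_⟩
  have hn1 : (1 : ℝ≥0∞) ≤ n := by exact_mod_cast (by omega : 1 ≤ n)
  let θ : 𝓓(Ω, ℝ) := ⟨fun x => ψ x * φ x, hψ.mul φ.contDiff, φ.hasCompactSupport.mul_left,
    (closure_mono (Function.support_mul_subset_right _ _)).trans φ.tsupport_subset⟩
  have hθ : ∀ x k, ‖(∇ θ x) k‖ₑ ≤ ENNReal.ofReal C * (‖(∇ ψ x) k‖ₑ + ‖ψ x‖ₑ) := fun x k => by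
    have : (∇ θ x) k = ψ x * (∇ φ x) k + φ x * (∇ ψ x) k :=
      gradient_mul_apply ((hψ.differentiable (by simp)) x)
        ((φ.contDiff.differentiable (by simp)) x) k
    rw [this, mul_add, add_comm]
    refine (enorm_add_le _ _).trans (add_le_add ?_ ?_)
    · rw [enorm_mul]; gcongr; exact hC₁' x
    · rw [enorm_mul, mul_comm]; gcongr; exact hC₂' x k
  have hψm : AEStronglyMeasurable ψ (volume.restrict (Ω : Set (Space n))) :=
    hψ.continuous.aestronglyMeasurable
  have hψm' : ∀ k, Continuous fun x => (∇ ψ x) k := fun k =>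
    (EuclideanSpace.proj (𝕜 := ℝ) k).continuous.comp (continuous_gradient hψ)
  have hterm : ∀ k l, ∫⁻ x in Ω, ‖u x k * (∇ θ x) l‖ₑ ≤ 2 * (ENNReal.ofReal C * B) * δ := by
    intro k l
    calc ∫⁻ x in Ω, ‖u x k * (∇ θ x) l‖ₑ
        ≤ ∫⁻ x in Ω, ENNReal.ofReal C * (‖u x k‖ₑ * ‖(∇ ψ x) l‖ₑ + ‖u x k‖ₑ * ‖ψ x‖ₑ) := by
          refine lintegral_mono fun x => ?_
          rw [enorm_mul, ← mul_add, mul_left_comm]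
          gcongr
          exact hθ x l
      _ = ENNReal.ofReal C * ((∫⁻ x in Ω, ‖u x k‖ₑ * ‖(∇ ψ x) l‖ₑ) +
            ∫⁻ x in Ω, ‖u x k‖ₑ * ‖ψ x‖ₑ) := by
          rw [lintegral_const_mul' _ _ (by simp), lintegral_add_left']
          have : AEStronglyMeasurable (fun x => u x k) (volume.restrict (Ω : Set (Space n))) :=
            (EuclideanSpace.proj (𝕜 := ℝ) k).continuous.comp_aestronglyMeasurable hu.1
          exact this.enorm.mul (hψm' l).aestronglyMeasurable.enorm
      _ ≤ ENNReal.ofReal C * (B * δ + B * δ) := by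
          gcongr
          · exact (lintegral_comp_mul_le hn hu.1 (hψm' l).aestronglyMeasurable k).trans
              (by gcongr; exact (eLpNorm_restrict_le _ _ _ _).trans (hψδ' l))
          · exact (lintegral_comp_mul_le hn hu.1 hψm k).trans
              (by gcongr; exact (eLpNorm_restrict_le _ _ _ _).trans hψδ)
      _ = _ := by ring
  have hI1 : ‖∫ x, θ x * σ x (i, j) ∂m‖ₑ ≤ 4 * (ENNReal.ofReal C * B) * δ := by
    rw [h.integral_eq θ i j, enorm_neg]
    refine (enorm_integral_le_lintegral_enorm _).trans ?_
    calc _ ≤ ∫⁻ x in Ω, (‖u x i * (∇ θ x) j‖ₑ + ‖u x j * (∇ θ x) i‖ₑ) := by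
          refine lintegral_mono fun x => ?_
          refine le_trans ?_ (enorm_add_le _ _)
          rw [← ofReal_norm, ← ofReal_norm]
          refine ENNReal.ofReal_le_ofReal ?_
          rw [norm_div, Real.norm_two]
          linarith [norm_nonneg (u x i * (∇ θ x) j + u x j * (∇ θ x) i)]
      _ = _ := by
          refine lintegral_add_left' (AEMeasurable.enorm ?_) _
          have : AEStronglyMeasurable (fun x => u x i) (volume.restrict (Ω : Set (Space n))) :=
            (EuclideanSpace.proj (𝕜 := ℝ) i).continuous.comp_aestronglyMeasurable hu.1
          exact (this.mul ((EuclideanSpace.proj (𝕜 := ℝ) j).continuous.comp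
            (continuous_gradient θ.contDiff)).aestronglyMeasurable).aemeasurable
      _ ≤ 2 * (ENNReal.ofReal C * B) * δ + 2 * (ENNReal.ofReal C * B) * δ :=
          add_le_add (hterm i j) (hterm j i)
      _ = _ := by ring
  have hψσ : Integrable (fun x => ψ x * σ x (i, j)) m :=
    hσi.bdd_mul (c := 2) hψ.continuous.aestronglyMeasurable (ae_of_all _ fun x => by
      rw [Real.norm_of_nonneg (hψ01 x).1]; exact (hψ01 x).2)
  have hI2 : ‖∫ x, (τ x - φ x) * (ψ x * σ x (i, j)) ∂m‖ₑ ≤ 2 * (η / 16) := by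
    refine (enorm_integral_le_lintegral_enorm _).trans ?_
    calc _ ≤ ∫⁻ x, 2 * (‖σ x (i, j)‖ₑ * ‖τ x - φ x‖ₑ) ∂m := by
          refine lintegral_mono fun x => ?_
          rw [enorm_mul, enorm_mul, mul_comm, mul_assoc]
          gcongr
          rw [Real.enorm_of_nonneg (hψ01 x).1]
          exact ENNReal.ofReal_le_of_le_toReal (by simpa using (hψ01 x).2)
      _ = 2 * ∫⁻ x, ‖σ x (i, j)‖ₑ * ‖τ x - φ x‖ₑ ∂m := lintegral_const_mul' _ _ (by simp)
      _ ≤ _ := by gcongr; exact hφ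
  -- Replacing the sign by `φ`: the first integral is controlled by integration by parts against
  -- `u`, the second by the `L¹` distance from `φ` to the sign.
  have hsum : ∫ x, ψ x * |σ x (i, j)| ∂m =
      ∫ x, θ x * σ x (i, j) ∂m + ∫ x, (τ x - φ x) * (ψ x * σ x (i, j)) ∂m := by
    rw [← integral_add]
    · refine integral_congr_ae (ae_of_all _ fun x => ?_)
      change ψ x * |σ x (i, j)| = ψ x * φ x * σ x (i, j) + (τ x - φ x) * (ψ x * σ x (i, j))
      rw [← hτσ]; ring
    · refine (hψσ.bdd_mul (c := C₁) φ.contDiff.continuous.aestronglyMeasurable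
        (ae_of_all _ hC₁)).congr (ae_of_all _ fun x => ?_)
      change φ x * (ψ x * σ x (i, j)) = ψ x * φ x * σ x (i, j)
      ring
    · refine hψσ.bdd_mul (c := 1 + C₁)
        (hτm.sub φ.contDiff.continuous.measurable).aestronglyMeasurable (ae_of_all _ fun x => ?_)
      exact (norm_sub_le _ _).trans (add_le_add (hτ1 x) (hC₁ x))
  have hlow : ∫⁻ x in K, ‖σ x (i, j)‖ₑ ∂m ≤ 4 * ‖∫ x, ψ x * |σ x (i, j)| ∂m‖ₑ := by
    have hnn : ∀ x, 0 ≤ ψ x * |σ x (i, j)| := fun x => mul_nonneg (hψ01 x).1 (abs_nonneg _)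
    rw [Real.enorm_of_nonneg (integral_nonneg hnn), ofReal_integral_eq_lintegral_ofReal
      (hψσ.norm.congr (ae_of_all _ fun x => by
        simp [abs_of_nonneg (hψ01 x).1])) (ae_of_all _ hnn), ← lintegral_const_mul' _ _ (by simp)]
    refine (setLIntegral_mono' hK fun x hx => ?_).trans (setLIntegral_le_lintegral K _)
    have h4 : (4 : ℝ≥0∞) = ENNReal.ofReal 4 := by simp
    rw [h4, ← ENNReal.ofReal_mul (by norm_num), Real.enorm_eq_ofReal_abs]
    refine ENNReal.ofReal_le_ofReal ?_
    nlinarith [hψK x hx, abs_nonneg (σ x (i, j))]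
  calc _ ≤ 4 * (4 * (ENNReal.ofReal C * B) * δ + 2 * (η / 16)) := by
        refine hlow.trans ?_
        gcongr
        rw [hsum]
        exact (enorm_add_le _ _).trans (add_le_add hI1 hI2)
    _ = 16 * (ENNReal.ofReal C * B) * δ + 8 * (η / 16) := by ring
    _ ≤ η / 2 + η / 2 := by
        refine add_le_add hδ (le_of_eq ?_)
        rw [ENNReal.div_eq_inv_mul, ENNReal.div_eq_inv_mul, ← mul_assoc]
        congr 1
        have : (16 : ℝ≥0∞) = 8 * 2 := by norm_num
        rw [this, ENNReal.mul_inv (by simp) (by simp), ← mul_assoc,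
          ENNReal.mul_inv_cancel (by simp) (by simp), one_mul]
    _ = η := ENNReal.add_halves η

theorem euclidean_enorm_le_sum_enorm {ι : Type*} [Fintype ι] (a : EuclideanSpace ℝ ι) :
    ‖a‖ₑ ≤ ∑ i, ‖a i‖ₑ := by
  have h : ‖a‖ ≤ ∑ i, ‖a i‖ := by
    rw [EuclideanSpace.norm_eq]
    refine Real.sqrt_le_iff.2 ⟨Finset.sum_nonneg fun _ _ => norm_nonneg _, ?_⟩
    exact Finset.sum_sq_le_sq_sum_of_nonneg fun _ _ => norm_nonneg _
  have h2 : ‖a‖₊ ≤ ∑ i, ‖a i‖₊ := by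
    rw [← NNReal.coe_le_coe]
    simpa using h
  simp only [enorm_eq_nnnorm]
  exact_mod_cast h2

/-- A variation measure of a strain is small on sets of small capacity. -/
theorem IsStrainDensity.exists_withDensity_le (hn : 2 ≤ n) {Ω : Opens (Space n)}
    {u : Space n → Space n} {m : Measure (Space n)} {σ : Space n → Mat n}
    (h : IsStrainDensity Ω u m σ)
    (hu : MemLp u (ENNReal.ofReal ((n : ℝ) / (n - 1))) (volume.restrict Ω))
    {η : ℝ≥0∞} (hη : η ≠ 0) :
    ∃ δ : ℝ≥0∞, δ ≠ 0 ∧ ∀ ψ : Space n → ℝ, ContDiff ℝ (⊤ : ℕ∞) ψ → (∀ x, 0 ≤ ψ x ∧ ψ x ≤ 2) →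
      eLpNorm ψ n volume ≤ δ → (∀ i, eLpNorm (fun x => (∇ ψ x) i) n volume ≤ δ) →
      ∀ K : Set (Space n), MeasurableSet K → (∀ x ∈ K, 1 / 4 ≤ ψ x) →
        m.withDensity (fun x => ‖σ x‖ₑ) K ≤ η := by
  let N : ℝ≥0∞ := Fintype.card (Fin n × Fin n)
  obtain ⟨η', hη'0, -, hη'⟩ := exists_ne_zero_mul_le (a := N) (ENNReal.natCast_ne_top _) hη
  choose δ hδ0 hδ using fun p : Fin n × Fin n =>
    h.exists_setLIntegral_component_le hn hu p.1 p.2 hη'0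
  refine ⟨⨅ p, δ p, ?_, fun ψ hψ hψ01 hψδ hψδ' K hK hψK => ?_⟩
  · have : Nonempty (Fin n × Fin n) := ⟨(⟨0, by omega⟩, ⟨0, by omega⟩)⟩
    obtain ⟨p, hp⟩ := exists_eq_ciInf_of_finite (f := δ)
    rw [← hp]; exact hδ0 p
  rw [withDensity_apply _ hK]
  calc ∫⁻ x in K, ‖σ x‖ₑ ∂m ≤ ∫⁻ x in K, ∑ p : Fin n × Fin n, ‖σ x p‖ₑ ∂m := by
        refine lintegral_mono fun x => ?_
        exact euclidean_enorm_le_sum_enorm _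
    _ = ∑ p : Fin n × Fin n, ∫⁻ x in K, ‖σ x p‖ₑ ∂m := lintegral_finsetSum _ fun p _ =>
        ((EuclideanSpace.proj (𝕜 := ℝ) p).continuous.measurable.comp h.measurable).enorm
    _ ≤ ∑ p : Fin n × Fin n, η' := Finset.sum_le_sum fun p _ =>
        hδ p ψ hψ hψ01 (hψδ.trans (iInf_le _ p)) (fun i => (hψδ' i).trans (iInf_le _ p)) K hK hψK
    _ ≤ η := by simpa [N] using hη'

end

/-! ### Passage to open sets described only Lebesgue almost everywhere. -/

section

variable {n : ℕ}

theorem norm_gradient (f : Space n → ℝ) (x : Space n) : ‖∇ f x‖ = ‖fderiv ℝ f x‖ := by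
  simp [gradient]

/-- Poincaré inequality for test functions on a bounded set, in the critical exponent. -/
theorem exists_poincare (hn : 2 ≤ n) {Ω : Opens (Space n)}
    (hb : Bornology.IsBounded (Ω : Set (Space n))) :
    ∃ C : ℝ≥0∞, C ≠ ∞ ∧ ∀ φ : 𝓓(Ω, ℝ),
      eLpNorm φ n volume ≤ C * eLpNorm (∇ φ) n (volume.restrict Ω) := by
  have hn0 : (0 : ℝ) < n := by exact_mod_cast (by omega : 0 < n)
  -- The Sobolev conjugate of `n / 2` is exactly `n`, since `2 / n - 1 / n = 1 / n`, and `n ≥ 2`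
  -- makes it an admissible exponent. Hölder's inequality on the bounded set `Ω` then raises the
  -- exponent of the gradient from `n / 2` to `n`.
  let p : ℝ≥0 := n / 2
  have hp1 : 1 ≤ p := by
    rw [← NNReal.coe_le_coe]
    simp only [p, NNReal.coe_div, NNReal.coe_natCast, NNReal.coe_one, NNReal.coe_ofNat]
    rw [le_div_iff₀ (by norm_num)]
    exact_mod_cast (by omega : 1 * 2 ≤ n)
  have hpn : p < n := by
    rw [← NNReal.coe_lt_coe]
    simp only [p, NNReal.coe_div, NNReal.coe_natCast, NNReal.coe_ofNat]
    linarith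
  have hΩf : volume (Ω : Set (Space n)) ≠ ∞ := hb.measure_lt_top.ne
  set c : ℝ≥0 := eLpNormLESNormFDerivOfLeConst ℝ (volume : Measure (Space n)) Ω p n
  refine ⟨c * volume (Ω : Set (Space n)) ^
    (1 / ((p : ℝ≥0∞)).toReal - 1 / ((n : ℝ≥0∞)).toReal), ?_, fun φ => ?_⟩
  · refine ENNReal.mul_ne_top (by simp) (ENNReal.rpow_ne_top_of_nonneg ?_ hΩf)
    simp only [ENNReal.coe_toReal, ENNReal.toReal_natCast, p, NNReal.coe_div, NNReal.coe_natCast,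
      NNReal.coe_ofNat, sub_nonneg]
    gcongr
    linarith
  have h := eLpNorm_le_eLpNorm_fderiv_of_le (μ := (volume : Measure (Space n))) (p := p) (q := n)
    (φ.contDiff.of_le (by simp)) ((subset_tsupport _).trans φ.tsupport_subset) hp1
    (by simpa using hpn) (by
      simp only [finrank_euclideanSpace, Fintype.card_fin, p, NNReal.coe_div, NNReal.coe_natCast,
        NNReal.coe_ofNat, NNReal.coe_inv]
      field_simp
      norm_num) hb
  have h2 : eLpNorm (fderiv ℝ φ) p volume = eLpNorm (∇ φ) p (volume.restrict (Ω : Set (Space n))) := by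
    rw [← eLpNorm_restrict_eq_of_support_subset (s := (Ω : Set (Space n))) (f := fderiv ℝ φ)]
    · exact eLpNorm_congr_norm_ae (ae_of_all _ fun x => (norm_gradient φ x).symm)
    · exact ((subset_tsupport _).trans (tsupport_fderiv_subset ℝ)).trans φ.tsupport_subset
  rw [h2] at h
  have h3 := eLpNorm_le_eLpNorm_mul_rpow_measure_univ (p := p) (q := n)
    (μ := volume.restrict (Ω : Set (Space n))) (by exact_mod_cast hpn.le)
    (continuous_gradient φ.contDiff).aestronglyMeasurable
  rw [Measure.restrict_apply_univ] at h3
  refine (by simpa using h : eLpNorm φ n volume ≤ _).trans ?_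
  rw [mul_assoc]
  gcongr
  rwa [mul_comm]

theorem abs_softSq_sub_le (s t : ℝ) : |softSq s - softSq t| ≤ |s - t| := by
  have := Convex.norm_image_sub_le_of_norm_hasDerivWithin_le (C := 1) (s := Set.univ)
    (fun t _ => (hasDerivAt_softSq t).hasDerivWithinAt) (fun t _ => abs_softSqDeriv_le t)
    convex_univ (Set.mem_univ t) (Set.mem_univ s)
  simpa using this

theorem gradient_softSq_comp_apply {f : Space n → ℝ} {x : Space n} (hf : DifferentiableAt ℝ f x)
    (i : Fin n) : (∇ (fun y => softSq (f y)) x) i = softSqDeriv (f x) * (∇ f x) i := by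
  simp only [gradient_apply]
  have h := (hasDerivAt_softSq (f x)).comp_hasFDerivAt x hf.hasFDerivAt
  have h2 : fderiv ℝ (fun y => softSq (f y)) x = _ := h.fderiv
  rw [h2]
  simp

theorem IsMollifier.gradient_conv_apply {g : Space n → ℝ} {δ : ℝ} (hg : IsMollifier g δ)
    {f : Space n → ℝ} (hf : ContDiff ℝ (⊤ : ℕ∞) f) (hc : HasCompactSupport f) (x : Space n)
    (i : Fin n) : (∇ (conv f g) x) i = conv (fun y => (∇ f y) i) g x := by
  simp only [gradient_apply]
  have h := hc.hasFDerivAt_convolution_left (ContinuousLinearMap.lsmul ℝ ℝ)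
    (hf.of_le (by simp)) hg.continuous.locallyIntegrable x (μ := volume)
  have h2 : fderiv ℝ (conv f g) x = _ := h.fderiv
  rw [h2, convolution_def, ContinuousLinearMap.integral_apply]
  · rfl
  · exact (hc.fderiv ℝ).convolutionExists_left _ (hf.continuous_fderiv (by simp))
      hg.continuous.locallyIntegrable x

/-- With the kernel held fixed, `L¹` convergence of functions becomes uniform convergence of their
convolutions. -/
theorem IsMollifier.abs_conv_sub_le {g : Space n → ℝ} {δ : ℝ} (hg : IsMollifier g δ)
    {f f' : Space n → ℝ} (hf : LocallyIntegrable f) (hf' : LocallyIntegrable f')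
    {S : ℝ} (hS : ∀ x, |g x| ≤ S) (x : Space n) :
    ‖conv f g x - conv f' g x‖ₑ ≤ ENNReal.ofReal S * ∫⁻ y, ‖f y - f' y‖ₑ := by
  have h : conv f g x - conv f' g x = conv (f - f') g x := by rw [hg.conv_sub hf hf']; rfl
  rw [h, conv_apply, ← lintegral_const_mul' _ _ (by simp)]
  refine (enorm_integral_le_lintegral_enorm _).trans (lintegral_mono fun y => ?_)
  rw [enorm_mul, mul_comm, Pi.sub_apply]
  gcongr
  rw [Real.enorm_eq_ofReal_abs]
  exact ENNReal.ofReal_le_ofReal (hS _)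

/-- The variation measure of a strain is small on the open sets where functions of small
`W^{1,n}` norm are large. -/
theorem IsStrainDensity.exists_withDensity_le_of_tendsto (hn : 2 ≤ n) {Ω : Opens (Space n)}
    (hb : Bornology.IsBounded (Ω : Set (Space n)))
    {u : Space n → Space n} {m : Measure (Space n)} {σ : Space n → Mat n}
    (h : IsStrainDensity Ω u m σ)
    (hu : MemLp u (ENNReal.ofReal ((n : ℝ) / (n - 1))) (volume.restrict Ω))
    {η : ℝ≥0∞} (hη : η ≠ 0) :
    ∃ δ : ℝ≥0∞, δ ≠ 0 ∧ ∀ v w : Space n → ℝ,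
      AEStronglyMeasurable v (volume.restrict Ω) → AEStronglyMeasurable w (volume.restrict Ω) →
      ∀ a b : ℕ → 𝓓(Ω, ℝ),
      Tendsto (fun k => eLpNorm (fun x => a k x - v x) n (volume.restrict Ω)) atTop (𝓝 0) →
      Tendsto (fun k => eLpNorm (fun x => b k x - w x) n (volume.restrict Ω)) atTop (𝓝 0) →
      (∀ᶠ k in atTop, eLpNorm (a k) n volume ≤ δ ∧
        ∀ i, eLpNorm (fun x => (∇ (a k) x) i) n volume ≤ δ) →
      (∀ᶠ k in atTop, eLpNorm (b k) n volume ≤ δ ∧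
        ∀ i, eLpNorm (fun x => (∇ (b k) x) i) n volume ≤ δ) →
      ∀ W : Set (Space n), IsOpen W → W ⊆ Ω →
        (∀ᵐ x ∂(volume.restrict W), 1 ≤ |v x| ∨ 1 ≤ |w x|) →
        m.withDensity (fun x => ‖σ x‖ₑ) W ≤ η := by
  have hn1 : (1 : ℝ≥0∞) ≤ n := by exact_mod_cast (by omega : 1 ≤ n)
  have hntop : (n : ℝ≥0∞) ≠ ∞ := by simp
  have hΩ : MeasurableSet (Ω : Set (Space n)) := Ω.isOpen.measurableSet
  have hΩf : volume (Ω : Set (Space n)) ≠ ∞ := hb.measure_lt_top.ne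
  have : IsFiniteMeasure (volume.restrict (Ω : Set (Space n))) := ⟨by simpa using hΩf.lt_top⟩
  obtain ⟨δ, hδ0, hδ⟩ := h.exists_withDensity_le hn hu hη
  refine ⟨δ / 2, (ENNReal.div_pos hδ0 (by simp)).ne', fun v w hv hw a b hav hbw ha hb W hW hWΩ hvw => ?_⟩
  have := isFiniteMeasure_withDensity h.integrable.2.ne
  -- By inner regularity a compact `K` inside `W` suffices. A mollifier of radius smaller than the
  -- distance from `K` to the complement of `W` then averages, at points of `K`, only over `W`.
  rw [hW.measure_eq_iSup_isCompact]
  refine iSup₂_le fun K hKW => iSup_le fun hK => ?_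
  obtain ⟨s, hs, hsW⟩ := hK.exists_cthickening_subset_open hW hKW
  obtain ⟨g, hg, -⟩ := exists_isMollifier (0 : Space n) hs
  rw [norm_zero, zero_add] at hg
  obtain ⟨S, hS⟩ := hg.continuous.bounded_above_of_compact_support hg.hasCompactSupport
  -- `H ≥ 1 / 2` holds only Lebesgue almost everywhere on `W`, while the strain may charge Lebesgue
  -- null sets. Convolution turns this into an inequality at every point of `K`.
  let H : Space n → ℝ := (Ω : Set (Space n)).indicator fun x => softSq (v x) + softSq (w x)
  let f : ℕ → Space n → ℝ := fun k x => softSq (a k x) + softSq (b k x)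
  have hbd : ∀ s t : ℝ, 0 ≤ softSq s + softSq t ∧ softSq s + softSq t ≤ 2 := fun s t =>
    ⟨add_nonneg (softSq_nonneg _) (softSq_nonneg _), by linarith [softSq_le_one s, softSq_le_one t]⟩
  have hHm : AEStronglyMeasurable H volume :=
    (aestronglyMeasurable_indicator_iff hΩ).2
      ((contDiff_softSq.continuous.comp_aestronglyMeasurable hv).add
        (contDiff_softSq.continuous.comp_aestronglyMeasurable hw))
  have hHl : LocallyIntegrable H := by
    refine Integrable.locallyIntegrable ?_
    refine IntegrableOn.integrable_indicator ?_ hΩ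
    refine Integrable.of_bound ((contDiff_softSq.continuous.comp_aestronglyMeasurable hv).add
        (contDiff_softSq.continuous.comp_aestronglyMeasurable hw)) 2 (ae_of_all _ fun x => ?_)
    exact (Real.norm_of_nonneg (hbd _ _).1).trans_le (hbd _ _).2
  have hfc : ∀ k, ContDiff ℝ (⊤ : ℕ∞) (f k) := fun k =>
    (contDiff_softSq.comp (a k).contDiff).add (contDiff_softSq.comp (b k).contDiff)
  have hfs : ∀ k, HasCompactSupport (f k) := fun k =>
    ((a k).hasCompactSupport.comp_left softSq_zero).add
      ((b k).hasCompactSupport.comp_left softSq_zero)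
  have ha0 : ∀ (φ : 𝓓(Ω, ℝ)) x, x ∉ (Ω : Set (Space n)) → φ x = 0 := fun φ x hx => by
    by_contra hne
    exact hx (φ.tsupport_subset (subset_tsupport _ hne))
  have hconv : Tendsto (fun k => ENNReal.ofReal S * ∫⁻ y, ‖H y - f k y‖ₑ) atTop (𝓝 0) := by
    set c := volume (Ω : Set (Space n)) ^ (1 / (1 : ℝ≥0∞).toReal - 1 / (n : ℝ≥0∞).toReal)
    have hc : c ≠ ∞ := by
      refine ENNReal.rpow_ne_top_of_nonneg ?_ hΩf
      simp only [ENNReal.toReal_one, ENNReal.toReal_natCast, sub_nonneg]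
      gcongr
      exact_mod_cast (by omega : 1 ≤ n)
    have h1 : Tendsto (fun k => ENNReal.ofReal S *
        (eLpNorm (fun x => a k x - v x) n (volume.restrict (Ω : Set (Space n))) * c +
          eLpNorm (fun x => b k x - w x) n (volume.restrict (Ω : Set (Space n))) * c))
        atTop (𝓝 (ENNReal.ofReal S * (0 * c + 0 * c))) :=
      ENNReal.Tendsto.const_mul ((ENNReal.Tendsto.mul_const hav (Or.inr hc)).add
        (ENNReal.Tendsto.mul_const hbw (Or.inr hc))) (Or.inr (by simp))
    simp only [zero_mul, add_zero, mul_zero] at h1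
    refine tendsto_of_tendsto_of_tendsto_of_le_of_le tendsto_const_nhds h1 (fun _ => zero_le)
      fun k => ?_
    dsimp only
    gcongr
    have hm1 : AEStronglyMeasurable (fun x => a k x - v x) (volume.restrict (Ω : Set (Space n))) :=
      (a k).contDiff.continuous.aestronglyMeasurable.sub hv
    have hm2 : AEStronglyMeasurable (fun x => b k x - w x) (volume.restrict (Ω : Set (Space n))) :=
      (b k).contDiff.continuous.aestronglyMeasurable.sub hw
    have h3 := eLpNorm_le_eLpNorm_mul_rpow_measure_univ hn1 hm1
    have h4 := eLpNorm_le_eLpNorm_mul_rpow_measure_univ hn1 hm2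
    rw [Measure.restrict_apply_univ] at h3 h4
    refine le_trans ?_ (add_le_add h3 h4)
    rw [eLpNorm_one_eq_lintegral_enorm, eLpNorm_one_eq_lintegral_enorm,
      ← lintegral_add_left' hm1.enorm, ← lintegral_indicator hΩ]
    refine lintegral_mono fun x => ?_
    by_cases hx : x ∈ (Ω : Set (Space n))
    · simp only [H, f, hx, Set.indicator_of_mem]
      have e1 : softSq (v x) + softSq (w x) - (softSq (a k x) + softSq (b k x)) =
        -(softSq (a k x) - softSq (v x)) + -(softSq (b k x) - softSq (w x)) := by ring
      rw [e1]
      refine (enorm_add_le _ _).trans ?_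
      rw [enorm_neg, enorm_neg]
      simp only [Real.enorm_eq_ofReal_abs]
      exact add_le_add (ENNReal.ofReal_le_ofReal (abs_softSq_sub_le _ _))
        (ENNReal.ofReal_le_ofReal (abs_softSq_sub_le _ _))
    · simp [H, f, hx, ha0, softSq_zero]
  -- For this `k` the convolution of the smooth `f k` is uniformly within `1 / 4` of that of `H`,
  -- hence at least `1 / 4` on `K`. Its norms are bounded by `δ / 2 + δ / 2`.
  obtain ⟨k, hk1, hk2, hk3⟩ := (((hconv.eventually_le_const
    (by simp : (0 : ℝ≥0∞) < ENNReal.ofReal (1 / 4))).and (ha.and hb))).exists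
  have hψ0 : ∀ x, 0 ≤ conv (f k) g x := fun x =>
    hg.le_conv (hfc k).continuous.locallyIntegrable (ae_of_all _ fun y _ => (hbd _ _).1)
  have hae : ∀ i, ∀ x, ‖(∇ (f k) x) i‖ ≤ ‖(∇ (a k) x) i‖ + ‖(∇ (b k) x) i‖ := by
    intro i x
    have hda := (a k).contDiff.differentiable (by simp) x
    have hdb := (b k).contDiff.differentiable (by simp) x
    have : (∇ (f k) x) i = softSqDeriv (a k x) * (∇ (a k) x) i +
        softSqDeriv (b k x) * (∇ (b k) x) i := by
      rw [← gradient_softSq_comp_apply hda, ← gradient_softSq_comp_apply hdb]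
      simp only [gradient_apply, f]
      rw [fderiv_fun_add]
      · rfl
      · exact (hasDerivAt_softSq _).differentiableAt.comp x hda
      · exact (hasDerivAt_softSq _).differentiableAt.comp x hdb
    rw [this]
    refine (norm_add_le _ _).trans (add_le_add ?_ ?_)
    · rw [norm_mul]; exact mul_le_of_le_one_left (norm_nonneg _) (abs_softSqDeriv_le _)
    · rw [norm_mul]; exact mul_le_of_le_one_left (norm_nonneg _) (abs_softSqDeriv_le _)
  have hcg : ∀ (φ : Space n → ℝ) (i : Fin n), ContDiff ℝ (⊤ : ℕ∞) φ →
      Continuous fun x => (∇ φ x) i := fun φ i hφ =>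
    (EuclideanSpace.proj (𝕜 := ℝ) i).continuous.comp (continuous_gradient hφ)
  refine hδ (conv (f k) g) (hg.contDiff_conv (hfc k).continuous.locallyIntegrable)
    (fun x => ⟨hψ0 x, ?_⟩) ?_ (fun i => ?_) K hK.measurableSet fun x hx => ?_
  · refine (le_abs_self _).trans (hg.abs_conv_le (ae_of_all _ fun y => ?_) x)
    rw [abs_of_nonneg (hbd _ _).1]; exact (hbd _ _).2
  · refine (hg.eLpNorm_conv_le (hfc k).continuous.aestronglyMeasurable hn1 hntop).trans ?_
    refine (eLpNorm_mono_real (g := fun x => ‖a k x‖ + ‖b k x‖) fun x => ?_).trans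
      ((eLpNorm_add_le (a k).contDiff.continuous.norm.aestronglyMeasurable
        (b k).contDiff.continuous.norm.aestronglyMeasurable hn1).trans ?_)
    · rw [Real.norm_of_nonneg (hbd _ _).1]
      exact add_le_add (softSq_le_abs _) (softSq_le_abs _)
    · rw [eLpNorm_norm, eLpNorm_norm]
      exact (add_le_add hk2.1 hk3.1).trans (ENNReal.add_halves δ).le
  · simp_rw [hg.gradient_conv_apply (hfc k) (hfs k)]
    refine (hg.eLpNorm_conv_le (hcg _ i (hfc k)).aestronglyMeasurable hn1 hntop).trans ?_
    refine (eLpNorm_mono_real (g := fun x => ‖(∇ (a k) x) i‖ + ‖(∇ (b k) x) i‖) (hae i)).trans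
      ((eLpNorm_add_le (hcg _ i (a k).contDiff).norm.aestronglyMeasurable
        (hcg _ i (b k).contDiff).norm.aestronglyMeasurable hn1).trans ?_)
    rw [eLpNorm_norm, eLpNorm_norm]
    exact (add_le_add (hk2.2 i) (hk3.2 i)).trans (ENNReal.add_halves δ).le
  · have h1 : 1 / 2 ≤ conv H g x := by
      refine hg.le_conv hHl ?_
      filter_upwards [(ae_restrict_iff' hW.measurableSet).1 hvw] with y hy hyx
      have hyW : y ∈ W := hsW (Metric.mem_cthickening_of_dist_le y x s K hx hyx)
      simp only [H, Set.indicator_of_mem (hWΩ hyW)]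
      rcases hy hyW with hy | hy
      · linarith [half_le_softSq hy, softSq_nonneg (w y)]
      · linarith [half_le_softSq hy, softSq_nonneg (v y)]
    have h2 := (hg.abs_conv_sub_le hHl (hfc k).continuous.locallyIntegrable hS x).trans hk1
    rw [Real.enorm_eq_ofReal_abs, ENNReal.ofReal_le_ofReal_iff (by norm_num)] at h2
    linarith [le_abs_self (conv H g x - conv (f k) g x)]

end

/-! ### Smoothings of `α` and their convergence in measure with respect to the strain. -/

section

variable {n : ℕ}

theorem exists_isMollifier_radius (k : ℕ) :
    ∃ g : Space n → ℝ, IsMollifier g (1 / ((k : ℝ) + 1)) := by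
  obtain ⟨g, hg, -⟩ := exists_isMollifier (0 : Space n) (Nat.one_div_pos_of_nat (n := k) (α := ℝ))
  rw [norm_zero, zero_add] at hg
  exact ⟨g, hg⟩

/-- A standard mollifier of radius `1 / (k + 1)`. -/
def stdMollifier (n k : ℕ) : Space n → ℝ := (exists_isMollifier_radius k).choose

theorem isMollifier_stdMollifier (k : ℕ) : IsMollifier (stdMollifier n k) (1 / ((k : ℝ) + 1)) :=
  (exists_isMollifier_radius k).choose_spec

/-- Smooth approximations of a function on `Ω`. -/
def smoothing (Ω : Opens (Space n)) (f : Space n → ℝ) (k : ℕ) : Space n → ℝ :=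
  conv ((Ω : Set (Space n)).indicator f) (stdMollifier n k)

variable {Ω : Opens (Space n)}

theorem locallyIntegrable_indicator {f : Space n → ℝ} {q : ℝ≥0∞} (hq : 1 ≤ q)
    (hf : MemLp f q (volume.restrict Ω)) :
    LocallyIntegrable ((Ω : Set (Space n)).indicator f) :=
  ((memLp_indicator_iff_restrict Ω.isOpen.measurableSet).2 hf).locallyIntegrable hq

theorem contDiff_smoothing {f : Space n → ℝ} {q : ℝ≥0∞} (hq : 1 ≤ q)
    (hf : MemLp f q (volume.restrict Ω)) (k : ℕ) : ContDiff ℝ (⊤ : ℕ∞) (smoothing Ω f k) :=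
  (isMollifier_stdMollifier k).contDiff_conv (locallyIntegrable_indicator hq hf)

theorem tendsto_eLpNorm_smoothing_sub {f : Space n → ℝ} {q : ℝ≥0∞} (hq : 1 ≤ q) (hq' : q ≠ ∞)
    (hf : MemLp f q (volume.restrict Ω)) :
    Tendsto (fun k => eLpNorm (smoothing Ω f k - (Ω : Set (Space n)).indicator f) q volume)
      atTop (𝓝 0) :=
  tendsto_eLpNorm_conv_sub isMollifier_stdMollifier tendsto_one_div_add_atTop_nhds_zero_nat hq hq'
    ((memLp_indicator_iff_restrict Ω.isOpen.measurableSet).2 hf)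

/-- Extension by zero need not be Sobolev across the boundary of `Ω`, so the formula is local: it
holds once the radius of the mollifier is less than the distance from `K` to the complement. -/
theorem IsSobolev.gradient_smoothing {q : ℝ≥0∞} (hq : 1 ≤ q) {v : Space n → ℝ}
    {G : Space n → Space n} (hv : IsSobolev Ω q v G) {K : Set (Space n)} (hK : IsCompact K)
    (hKΩ : K ⊆ Ω) : ∀ᶠ k in atTop, ∀ x ∈ K, ∀ i,
      (∇ (smoothing Ω v k) x) i = smoothing Ω (fun y => G y i) k x := by
  obtain ⟨s, hs, hsub⟩ := hK.exists_cthickening_subset_open Ω.isOpen hKΩ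
  filter_upwards [(tendsto_one_div_add_atTop_nhds_zero_nat (𝕜 := ℝ)).eventually_lt_const hs]
    with k hk x hx i
  refine hv.gradient_conv hq (isMollifier_stdMollifier k) (fun y hy => hsub ?_) i
  exact Metric.mem_cthickening_of_dist_le y x s K hx ((Metric.mem_closedBall.1 hy).trans hk.le)

/-- The product of a test function and a smooth function. -/
def testMul (χ : 𝓓(Ω, ℝ)) {f : Space n → ℝ} (hf : ContDiff ℝ (⊤ : ℕ∞) f) : 𝓓(Ω, ℝ) :=
  ⟨fun x => χ x * f x, χ.contDiff.mul hf, χ.hasCompactSupport.mul_right,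
    (closure_mono (Function.support_mul_subset_left _ _)).trans χ.tsupport_subset⟩

theorem testMul_apply (χ : 𝓓(Ω, ℝ)) {f : Space n → ℝ} (hf : ContDiff ℝ (⊤ : ℕ∞) f) (x : Space n) :
    testMul χ hf x = χ x * f x := rfl

theorem gradient_testMul (χ : 𝓓(Ω, ℝ)) {f : Space n → ℝ} (hf : ContDiff ℝ (⊤ : ℕ∞) f) (x : Space n)
    (i : Fin n) : (∇ (testMul χ hf) x) i = χ x * (∇ f x) i + f x * (∇ χ x) i :=
  gradient_mul_apply (χ.contDiff.differentiable (by simp) x) (hf.differentiable (by simp) x) i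

theorem continuous_gradient_apply {f : Space n → ℝ} (hf : ContDiff ℝ (⊤ : ℕ∞) f) (i : Fin n) :
    Continuous fun x => (∇ f x) i :=
  (EuclideanSpace.proj (𝕜 := ℝ) i).continuous.comp (continuous_gradient hf)

theorem TestFunction.exists_common_bound (χ : 𝓓(Ω, ℝ)) :
    ∃ C : ℝ, 0 ≤ C ∧ (∀ x, ‖χ x‖ ≤ C) ∧ ∀ x i, ‖(∇ χ x) i‖ ≤ C := by
  obtain ⟨C₁, hC₁⟩ := TestFunction.exists_bound χ
  obtain ⟨C₂, hC₂⟩ := exists_bound_gradient χ.contDiff χ.hasCompactSupport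
  exact ⟨max C₁ C₂, (norm_nonneg _).trans ((hC₁ 0).trans (le_max_left _ _)),
    fun x => (hC₁ x).trans (le_max_left _ _),
    fun x i => ((PiLp.norm_apply_le _ _).trans (hC₂ x)).trans (le_max_right _ _)⟩

theorem gradient_eq_zero_of_notMem {χ : Space n → ℝ} {x : Space n} (hx : x ∉ tsupport χ) :
    ∇ χ x = 0 := by
  have h : fderiv ℝ χ x = 0 := by
    by_contra hne
    exact hx (tsupport_fderiv_subset ℝ (subset_tsupport _ hne))
  simp [gradient, h]

theorem eLpNorm_sub_le_sub_add_sub {f g h : Space n → ℝ} {q : ℝ≥0∞} (hq : 1 ≤ q)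
    (hf : AEStronglyMeasurable f) (hg : AEStronglyMeasurable g) (hh : AEStronglyMeasurable h) :
    eLpNorm (f - g) q volume ≤ eLpNorm (f - h) q volume + eLpNorm (g - h) q volume := by
  have : f - g = (f - h) - (g - h) := by abel
  rw [this]
  exact eLpNorm_sub_le (hf.sub hh) (hg.sub hh) hq

/-- Localised smoothings form a Cauchy sequence in `W^{1,q}`. -/
theorem IsSobolev.exists_eLpNorm_testMul_le {q : ℝ≥0∞} (hq : 1 ≤ q) (hq' : q ≠ ∞) {v : Space n → ℝ}
    {G : Space n → Space n} (hv : IsSobolev Ω q v G) (χ : 𝓓(Ω, ℝ)) {ε : ℝ≥0∞} (hε : ε ≠ 0) :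
    ∃ N : ℕ, ∀ k ≥ N, ∀ l ≥ N,
      ∀ hf : ContDiff ℝ (⊤ : ℕ∞) (smoothing Ω v k - smoothing Ω v l),
      eLpNorm (testMul χ hf) q volume ≤ ε ∧
        ∀ i, eLpNorm (fun x => (∇ (testMul χ hf) x) i) q volume ≤ ε := by
  have hΩ : MeasurableSet (Ω : Set (Space n)) := Ω.isOpen.measurableSet
  obtain ⟨C, hC0, hC, hC'⟩ := TestFunction.exists_common_bound χ
  have hG : ∀ i, MemLp (fun x => G x i) q (volume.restrict (Ω : Set (Space n))) := fun i =>
    memLp_piLp_iff.1 hv.memLp_grad i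
  -- The constant `4` comes from the gradient of the product: two terms, each with a difference of
  -- two smoothings at distance `δ` from their limit.
  obtain ⟨δ, hδ0, -, hδ⟩ := exists_ne_zero_mul_le (a := ENNReal.ofReal C * 4) (η := ε)
    (ENNReal.mul_ne_top (by simp) (by simp)) hε
  have hev : ∀ᶠ k in atTop,
      (eLpNorm (smoothing Ω v k - (Ω : Set (Space n)).indicator v) q volume ≤ δ ∧
      ∀ i, eLpNorm (smoothing Ω (fun x => G x i) k -
        (Ω : Set (Space n)).indicator fun x => G x i) q volume ≤ δ) ∧
      ∀ x ∈ tsupport χ, ∀ i, (∇ (smoothing Ω v k) x) i = smoothing Ω (fun y => G y i) k x := by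
    refine (((tendsto_eLpNorm_smoothing_sub hq hq' hv.memLp).eventually_le_const hδ0.bot_lt).and
      ?_).and (hv.gradient_smoothing hq χ.hasCompactSupport χ.tsupport_subset)
    exact eventually_all.2 fun i =>
      (tendsto_eLpNorm_smoothing_sub hq hq' (hG i)).eventually_le_const hδ0.bot_lt
  obtain ⟨N, hN⟩ := eventually_atTop.1 hev
  refine ⟨N, fun k hk l hl hf => ?_⟩
  have hm : ∀ {f : Space n → ℝ}, MemLp f q (volume.restrict (Ω : Set (Space n))) → ∀ k,
      AEStronglyMeasurable (smoothing Ω f k) volume := fun hf k =>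
    (contDiff_smoothing hq hf k).continuous.aestronglyMeasurable
  have hmi : ∀ {f : Space n → ℝ}, MemLp f q (volume.restrict (Ω : Set (Space n))) →
      AEStronglyMeasurable ((Ω : Set (Space n)).indicator f) volume := fun hf =>
    (aestronglyMeasurable_indicator_iff hΩ).2 hf.1
  have hA : eLpNorm (smoothing Ω v k - smoothing Ω v l) q volume ≤ 2 * δ := by
    rw [two_mul]
    exact (eLpNorm_sub_le_sub_add_sub hq (hm hv.memLp k) (hm hv.memLp l) (hmi hv.memLp)).trans
      (add_le_add (hN k hk).1.1 (hN l hl).1.1)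
  have hB : ∀ i, eLpNorm (smoothing Ω (fun x => G x i) k - smoothing Ω (fun x => G x i) l) q volume
      ≤ 2 * δ := fun i => by
    rw [two_mul]
    exact (eLpNorm_sub_le_sub_add_sub hq (hm (hG i) k) (hm (hG i) l) (hmi (hG i))).trans
      (add_le_add ((hN k hk).1.2 i) ((hN l hl).1.2 i))
  constructor
  · calc _ ≤ eLpNorm (C • (smoothing Ω v k - smoothing Ω v l)) q volume := by
          refine eLpNorm_mono fun x => ?_
          rw [testMul_apply, Pi.smul_apply, norm_mul, norm_smul, Real.norm_of_nonneg hC0]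
          gcongr
          exact hC x
      _ = ENNReal.ofReal C * eLpNorm (smoothing Ω v k - smoothing Ω v l) q volume := by
          rw [eLpNorm_const_smul, Real.enorm_of_nonneg hC0]
      _ ≤ ENNReal.ofReal C * (4 * δ) := by
          gcongr
          refine hA.trans ?_
          gcongr
          norm_num
      _ ≤ ε := by rwa [← mul_assoc]
  · intro i
    let g : Space n → ℝ := fun x => ‖(smoothing Ω v k - smoothing Ω v l) x‖ +
      ‖(smoothing Ω (fun x => G x i) k - smoothing Ω (fun x => G x i) l) x‖
    calc _ ≤ eLpNorm (C • g) q volume := by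
          refine eLpNorm_mono_real fun x => ?_
          rw [gradient_testMul, Pi.smul_apply, smul_eq_mul]
          by_cases hx : x ∈ tsupport χ
          · have h1 : (∇ (smoothing Ω v k - smoothing Ω v l) x) i =
                (smoothing Ω (fun x => G x i) k - smoothing Ω (fun x => G x i) l) x := by
              rw [Pi.sub_apply, ← (hN k hk).2 x hx i, ← (hN l hl).2 x hx i]
              simp only [gradient_apply]
              rw [fderiv_sub ((contDiff_smoothing hq hv.memLp k).differentiable (by simp) x)
                ((contDiff_smoothing hq hv.memLp l).differentiable (by simp) x)]
              rfl
            rw [h1]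
            refine (norm_add_le _ _).trans ?_
            rw [norm_mul, norm_mul, mul_add, add_comm, mul_comm ‖(smoothing Ω v k - _) x‖]
            gcongr
            · exact hC' x i
            · exact hC x
          · rw [gradient_eq_zero_of_notMem hx, image_eq_zero_of_notMem_tsupport hx]
            simp only [zero_mul, PiLp.zero_apply, mul_zero, add_zero, norm_zero]
            positivity
      _ = ENNReal.ofReal C * eLpNorm g q volume := by
          rw [eLpNorm_const_smul, Real.enorm_of_nonneg hC0]
      _ ≤ ENNReal.ofReal C * (2 * δ + 2 * δ) := by
          gcongr
          refine (eLpNorm_add_le ((hm hv.memLp k).sub (hm hv.memLp l)).norm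
            ((hm (hG i) k).sub (hm (hG i) l)).norm hq).trans ?_
          rw [eLpNorm_norm, eLpNorm_norm]
          exact add_le_add hA (hB i)
      _ = ENNReal.ofReal C * 4 * δ := by ring
      _ ≤ ε := hδ

theorem TestFunction.eLpNorm_gradient_apply_le (φ : 𝓓(Ω, ℝ)) (q : ℝ≥0∞) (i : Fin n) :
    eLpNorm (fun x => (∇ φ x) i) q volume ≤ eLpNorm (∇ φ) q (volume.restrict Ω) := by
  rw [← eLpNorm_restrict_eq_of_support_subset (s := (Ω : Set (Space n)))]
  · exact eLpNorm_mono fun x => PiLp.norm_apply_le _ _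
  · intro x hx
    by_contra hcon
    refine hx ?_
    dsimp only
    rw [gradient_eq_zero_of_notMem fun h => hcon (φ.tsupport_subset h)]
    rfl

/-- Off a set `A` of small capacity `αt` is continuous, so the set where `|α_k - αt| > t` is
relatively open in `Ω \ A`. Adding a neighbourhood `U` of `A` gives an open set on which, Lebesgue
almost everywhere, either the capacity competitor `v` is at least `1` or `w = t⁻¹ χ (α_k - α)` is at
least `1` in absolute value. Both `v` and `w` are `Lⁿ` limits of test functions with small `W^{1,n}`
norm, so the strain of this open set is small. -/
theorem tendstoInMeasure_smoothing (hn : 2 ≤ n) (hb : Bornology.IsBounded (Ω : Set (Space n)))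
    {u : Space n → Space n} {m : Measure (Space n)} {σ : Space n → Mat n}
    (h : IsStrainDensity Ω u m σ)
    (hu : MemLp u (ENNReal.ofReal ((n : ℝ) / (n - 1))) (volume.restrict Ω))
    {α αt : Space n → ℝ} {G : Space n → Space n} (hα : IsSobolev Ω n α G)
    (hαt : IsQuasicontinuousRep n Ω α αt) (χ : 𝓓(Ω, ℝ)) {O : Set (Space n)} (hO : IsOpen O)
    (hOΩ : O ⊆ Ω) (hχ : ∀ x ∈ O, χ x = 1) :
    TendstoInMeasure ((m.withDensity fun x => ‖σ x‖ₑ).restrict O) (smoothing Ω α) atTop αt := by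
  have hn1 : (1 : ℝ≥0∞) ≤ n := by exact_mod_cast (by omega : 1 ≤ n)
  have hntop : (n : ℝ≥0∞) ≠ ∞ := by simp
  have hn0 : (n : ℝ≥0∞) ≠ 0 := by
    simp only [ne_eq, Nat.cast_eq_zero]; omega
  have hnr : (0 : ℝ) < n := by exact_mod_cast (by omega : 0 < n)
  have hΩ : MeasurableSet (Ω : Set (Space n)) := Ω.isOpen.measurableSet
  rw [tendstoInMeasure_iff_norm]
  intro ε hε
  rw [ENNReal.tendsto_atTop_zero]
  intro η hη
  -- A level strictly below `ε`, so that the set `≥ ε` is contained in the relatively open set `>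
  -- t`.
  let t := ε / 2
  have ht : 0 < t := half_pos hε
  obtain ⟨δ, hδ0, hδ⟩ := h.exists_withDensity_le_of_tendsto hn hb hu hη.ne'
  obtain ⟨C, hC, hpoin⟩ := exists_poincare hn hb
  -- In `1 + C` the `1` serves the gradients and the Poincaré constant `C` the functions themselves.
  obtain ⟨δ₁, hδ₁0, hδ₁t, hδ₁⟩ := exists_ne_zero_mul_le (a := 1 + C) (by simp [hC]) hδ0
  obtain ⟨δ₂, hδ₂0, -, hδ₂⟩ := exists_ne_zero_mul_le (a := ENNReal.ofReal t⁻¹) (by simp) hδ0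
  obtain ⟨N, hN⟩ := hα.exists_eLpNorm_testMul_le hn1 hntop χ hδ₂0
  have hδ₁2 : δ₁ / 2 ≠ 0 := (ENNReal.div_pos hδ₁0 (by simp)).ne'
  have hδ₁2t : δ₁ / 2 ≠ ∞ := ENNReal.div_ne_top hδ₁t (by simp)
  -- Capacity below `(δ₁ / 2) ^ n` means a competitor whose gradient has norm below `δ₁ / 2`; the
  -- other half absorbs the error of its approximation by test functions.
  obtain ⟨A, hAΩ, hcap, hcont⟩ := hαt.1 ((δ₁ / 2) ^ n) (by positivity)
  simp only [capacity, iInf_lt_iff] at hcap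
  obtain ⟨v, g, hvg, ⟨U, hU, hAU, hUΩ, hUv⟩, hgint⟩ := hcap
  obtain ⟨a, hav, hag⟩ := hvg.exists_approx
  have hgn : eLpNorm g n (volume.restrict (Ω : Set (Space n))) < δ₁ / 2 := by
    rw [eLpNorm_eq_lintegral_rpow_enorm_toReal hn0 hntop]
    have := ENNReal.rpow_lt_rpow hgint (z := 1 / (n : ℝ≥0∞).toReal) (by simpa using hnr)
    refine this.trans_le (le_of_eq ?_)
    rw [← ENNReal.rpow_natCast, ← ENNReal.rpow_mul, ENNReal.toReal_natCast,
      mul_one_div_cancel hnr.ne', ENNReal.rpow_one]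
  have hak : ∀ᶠ k in atTop, eLpNorm (a k) n volume ≤ δ ∧
      ∀ i, eLpNorm (fun x => (∇ (a k) x) i) n volume ≤ δ := by
    filter_upwards [hag.eventually_le_const hδ₁2.bot_lt] with k hk
    have h1 : eLpNorm (∇ (a k)) n (volume.restrict (Ω : Set (Space n))) ≤ δ₁ := by
      have e : ∇ (a k) = (fun x => ∇ (a k) x - g x) + g := by ext; simp
      rw [e]
      refine (eLpNorm_add_le (((continuous_gradient (a k).contDiff).aestronglyMeasurable).sub
        hvg.memLp_grad.1) hvg.memLp_grad.1 hn1).trans ?_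
      exact (add_le_add hk hgn.le).trans (ENNReal.add_halves δ₁).le
    constructor
    · refine (hpoin (a k)).trans ((mul_le_mul' le_rfl h1).trans (le_trans ?_ hδ₁))
      gcongr
      exact le_add_self
    · intro i
      refine (TestFunction.eLpNorm_gradient_apply_le _ _ i).trans (h1.trans (le_trans ?_ hδ₁))
      exact le_mul_of_one_le_left' le_self_add
  refine ⟨N, fun k hk => ?_⟩
  have hsm := contDiff_smoothing hn1 hα.memLp
  obtain ⟨Cχ, hCχ0, hCχ, -⟩ := TestFunction.exists_common_bound χ
  let w : Space n → ℝ := fun x => t⁻¹ * (χ x * (smoothing Ω α k x - α x))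
  -- With `k` fixed, `l → ∞` replaces `α_l` by `α`: the Cauchy property bounds the `W^{1,n}` norms
  -- of `b l`, and only `Lⁿ` convergence to `w` is used.
  let b : ℕ → 𝓓(Ω, ℝ) := fun l => testMul (testMul χ ((hsm k).sub (hsm l)))
    (contDiff_const (c := t⁻¹))
  have hbl : ∀ l ≥ N, eLpNorm (b l) n volume ≤ δ ∧
      ∀ i, eLpNorm (fun x => (∇ (b l) x) i) n volume ≤ δ := by
    intro l hl
    obtain ⟨h1, h2⟩ := hN k hk l hl ((hsm k).sub (hsm l))
    have e1 : (b l : Space n → ℝ) = t⁻¹ • (testMul χ ((hsm k).sub (hsm l)) : Space n → ℝ) := by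
      ext x; simp [b, testMul_apply, mul_comm]
    have e2 : ∀ i, (fun x => (∇ (b l) x) i) =
        t⁻¹ • fun x => (∇ (testMul χ ((hsm k).sub (hsm l))) x) i := by
      intro i; ext x
      have h0 : (∇ (fun _ : Space n => t⁻¹) x) i = 0 := by simp
      simp only [b, Pi.smul_apply, smul_eq_mul]
      rw [gradient_testMul, h0]
      ring
    constructor
    · rw [e1, eLpNorm_const_smul, Real.enorm_of_nonneg (by positivity)]
      exact (mul_le_mul' le_rfl h1).trans hδ₂
    · intro i
      rw [e2, eLpNorm_const_smul, Real.enorm_of_nonneg (by positivity)]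
      exact (mul_le_mul' le_rfl (h2 i)).trans hδ₂
  have hwm : AEStronglyMeasurable w (volume.restrict (Ω : Set (Space n))) :=
    ((χ.contDiff.continuous.aestronglyMeasurable).mul
      ((hsm k).continuous.aestronglyMeasurable.sub hα.memLp.1)).const_mul _
  have hbw : Tendsto (fun l => eLpNorm (fun x => b l x - w x) n
      (volume.restrict (Ω : Set (Space n)))) atTop (𝓝 0) := by
    have h1 := ENNReal.Tendsto.const_mul (a := ENNReal.ofReal (t⁻¹ * Cχ))
      (tendsto_eLpNorm_smoothing_sub hn1 hntop hα.memLp) (Or.inr (by simp))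
    rw [mul_zero] at h1
    refine tendsto_of_tendsto_of_tendsto_of_le_of_le tendsto_const_nhds h1 (fun _ => zero_le)
      fun l => ?_
    dsimp only
    rw [← Real.enorm_of_nonneg (by positivity : 0 ≤ t⁻¹ * Cχ), ← eLpNorm_const_smul]
    refine le_trans (eLpNorm_mono_ae ?_) (eLpNorm_restrict_le _ _ _ (Ω : Set (Space n)))
    filter_upwards [ae_restrict_mem hΩ] with x hx
    have e : b l x - w x = t⁻¹ * χ x * -(smoothing Ω α l x - α x) := by
      simp only [b, w, testMul_apply]; ring
    rw [e, Pi.smul_apply, Pi.sub_apply, Set.indicator_of_mem hx, norm_smul, norm_mul, norm_neg,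
      norm_mul, norm_mul, Real.norm_of_nonneg hCχ0]
    gcongr
    exact hCχ x
  obtain ⟨V, hV, hVeq⟩ : ∃ V : Set (Space n), IsOpen V ∧
      ((Ω : Set (Space n)) \ A) ∩ {x | t < ‖smoothing Ω α k x - αt x‖} =
        ((Ω : Set (Space n)) \ A) ∩ V := by
    have hc : ContinuousOn (fun x => ‖smoothing Ω α k x - αt x‖) ((Ω : Set (Space n)) \ A) :=
      ((hsm k).continuous.continuousOn.sub hcont).norm
    obtain ⟨V, hV, h1⟩ := continuousOn_iff'.1 hc (Set.Ioi t) isOpen_Ioi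
    refine ⟨V, hV, ?_⟩
    rw [Set.inter_comm, Set.inter_comm _ V]
    exact h1
  have hWle := hδ v w hvg.memLp.1 hwm a b hav hbw hak
    (eventually_atTop.2 ⟨N, hbl⟩) ((V ∩ O) ∪ U) ((hV.inter hO).union hU)
    (Set.union_subset (Set.inter_subset_right.trans hOΩ) hUΩ) ?_
  · refine le_trans ?_ hWle
    rw [Measure.restrict_apply' hO.measurableSet]
    refine measure_mono fun x hx => ?_
    by_cases hxU : x ∈ U
    · exact Or.inr hxU
    · have hxA : x ∈ (Ω : Set (Space n)) \ A := ⟨hOΩ hx.2, fun hxA => hxU (hAU hxA)⟩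
      have hx1 : t < ‖smoothing Ω α k x - αt x‖ := (half_lt_self hε).trans_le hx.1
      have : x ∈ ((Ω : Set (Space n)) \ A) ∩ V := hVeq ▸ ⟨hxA, hx1⟩
      exact Or.inl ⟨this.2, hx.2⟩
  · rw [ae_restrict_iff' ((hV.inter hO).union hU).measurableSet]
    filter_upwards [(ae_restrict_iff' hU.measurableSet).1 hUv,
      (ae_restrict_iff' hΩ).1 hαt.2] with x h1 h2 hx
    by_cases hxU : x ∈ U
    · exact Or.inl ((h1 hxU).trans (le_abs_self _))
    · have hx' : x ∈ V ∩ O := hx.resolve_right hxU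
      have hxA : x ∈ (Ω : Set (Space n)) \ A := ⟨hOΩ hx'.2, fun hxA => hxU (hAU hxA)⟩
      have : x ∈ ((Ω : Set (Space n)) \ A) ∩ {x | t < ‖smoothing Ω α k x - αt x‖} :=
        hVeq.symm ▸ ⟨hxA, hx'.1⟩
      have h3 : t < |smoothing Ω α k x - αt x| := this.2
      right
      simp only [w, hχ x hx'.2, one_mul]
      rw [abs_mul, abs_of_pos (inv_pos.2 ht), ← h2 (hOΩ hx'.2), inv_mul_eq_div, le_div_iff₀ ht,
        one_mul]
      exact h3.le

end

/-! ### Convergence almost everywhere with respect to the strain, and the product rule. -/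

section

variable {n : ℕ} {Ω : Opens (Space n)}

theorem exists_testFunction_eq_one {K : Set (Space n)} (hK : IsCompact K) (hKΩ : K ⊆ Ω) :
    ∃ (χ : 𝓓(Ω, ℝ)) (O : Set (Space n)), IsOpen O ∧ K ⊆ O ∧ O ⊆ Ω ∧ ∀ x ∈ O, χ x = 1 := by
  obtain ⟨χ, hχ, hχc, hχΩ, -, V, hV, hKV, hV1⟩ := exists_cutoff hK Ω.isOpen hKΩ
  exact ⟨⟨χ, hχ, hχc, hχΩ⟩, V ∩ Ω, hV.inter Ω.isOpen, Set.subset_inter hKV hKΩ,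
    Set.inter_subset_right, fun x hx => hV1 x hx.1⟩

/-- Exhaustion of an open set by compact sets. -/
theorem exists_compact_exhaustion (Ω : Opens (Space n)) :
    ∃ K : ℕ → Set (Space n), (∀ j, IsCompact (K j)) ∧ (∀ j, K j ⊆ interior (K (j + 1))) ∧
      ⋃ j, K j = (Ω : Set (Space n)) := by
  have : LocallyCompactSpace Ω := Ω.isOpen.locallyCompactSpace
  let E := CompactExhaustion.choice Ω
  refine ⟨fun j => Subtype.val '' E j, fun j => (E.isCompact j).image continuous_subtype_val,
    fun j => ?_, ?_⟩
  · refine (Set.image_mono (E.subset_interior_succ j)).trans (interior_maximal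
      (Set.image_mono interior_subset) ?_)
    exact Ω.isOpen.isOpenMap_subtype_val _ isOpen_interior
  · rw [← Set.image_iUnion, E.iUnion_eq, Set.image_univ, Subtype.range_coe]

/-- Along a subsequence, smoothings converge almost everywhere to the quasicontinuous
representative with respect to the variation of the strain. -/
theorem HasStrain.exists_tendsto_smoothing (hn : 2 ≤ n)
    (hb : Bornology.IsBounded (Ω : Set (Space n))) {u : Space n → Space n}
    {μ : VectorMeasure (Space n) (Mat n)} (h : HasStrain Ω u μ)
    (hu : MemLp u (ENNReal.ofReal ((n : ℝ) / (n - 1))) (volume.restrict Ω))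
    {α αt : Space n → ℝ} {G : Space n → Space n} (hα : IsSobolev Ω n α G)
    (hαt : IsQuasicontinuousRep n Ω α αt) {K : Set (Space n)} (hK : IsCompact K) (hKΩ : K ⊆ Ω) :
    ∃ ns : ℕ → ℕ, StrictMono ns ∧ ∀ᵐ x ∂(μ.variation.restrict K),
      Tendsto (fun k => smoothing Ω α (ns k) x) atTop (𝓝 (αt x)) := by
  obtain ⟨σ, hσ, hσv⟩ := h.exists_isStrainDensity
  obtain ⟨χ, O, hO, hKO, hOΩ, hχ⟩ := exists_testFunction_eq_one hK hKΩ
  have h1 := tendstoInMeasure_smoothing hn hb hσ hu hα hαt χ hO hOΩ hχ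
  rw [← hσv] at h1
  obtain ⟨ns, hns, h2⟩ := h1.exists_seq_tendsto_ae
  exact ⟨ns, hns, ae_restrict_of_ae_restrict_of_subset hKO h2⟩

theorem exists_abs_smoothing_le {α : Space n → ℝ} (hα : MemLp α ∞ (volume.restrict Ω)) :
    ∃ M : ℝ, 0 ≤ M ∧ (∀ᵐ x ∂(volume.restrict (Ω : Set (Space n))), ‖α x‖ ≤ M) ∧
      ∀ k x, |smoothing Ω α k x| ≤ M := by
  have hM : ∀ᵐ x ∂(volume.restrict (Ω : Set (Space n))),
      ‖α x‖ ≤ (eLpNormEssSup α (volume.restrict (Ω : Set (Space n)))).toReal := by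
    have hfin := hα.2
    rw [eLpNorm_exponent_top] at hfin
    filter_upwards [ae_le_eLpNormEssSup (f := α) (μ := volume.restrict (Ω : Set (Space n)))]
      with x hx
    rw [← toReal_enorm]
    exact ENNReal.toReal_mono hfin.ne hx
  refine ⟨_, ENNReal.toReal_nonneg, hM, fun k x => ?_⟩
  refine (isMollifier_stdMollifier k).abs_conv_le ?_ x
  filter_upwards [(ae_restrict_iff' Ω.isOpen.measurableSet).1 hM] with x hx
  by_cases hxΩ : x ∈ (Ω : Set (Space n))
  · simpa [hxΩ] using hx hxΩ
  · simp only [hxΩ, not_false_eq_true, Set.indicator_of_notMem, abs_zero]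
    exact ENNReal.toReal_nonneg

/-- Quasicontinuity does not mention the strain; both properties are inherited from the smoothings,
which converge to `αt` almost everywhere for the variation on each compact set of an exhaustion. The
subsequence may depend on the compact set. -/
theorem HasStrain.aestronglyMeasurable_quasicontinuousRep (hn : 2 ≤ n)
    (hb : Bornology.IsBounded (Ω : Set (Space n))) {u : Space n → Space n}
    {μ : VectorMeasure (Space n) (Mat n)} (h : HasStrain Ω u μ)
    (hu : MemLp u (ENNReal.ofReal ((n : ℝ) / (n - 1))) (volume.restrict Ω))
    {α αt : Space n → ℝ} {G : Space n → Space n} (hα : IsSobolev Ω n α G)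
    (hαt : IsQuasicontinuousRep n Ω α αt) {M : ℝ} (hM : ∀ k x, |smoothing Ω α k x| ≤ M) :
    AEStronglyMeasurable αt μ.variation ∧ ∀ᵐ x ∂μ.variation, ‖αt x‖ ≤ M := by
  have hn1 : (1 : ℝ≥0∞) ≤ n := by exact_mod_cast (by omega : 1 ≤ n)
  obtain ⟨K, hK, -, hKΩ⟩ := exists_compact_exhaustion Ω
  have hres : μ.variation.restrict (⋃ j, K j) = μ.variation := by
    rw [hKΩ]
    exact Measure.restrict_eq_self_of_ae_mem (by rw [ae_iff]; exact h.variation_compl)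
  choose ns hns hlim using fun j =>
    h.exists_tendsto_smoothing hn hb hu hα hαt (hK j) (hKΩ ▸ Set.subset_iUnion K j)
  constructor
  · rw [← hres, aestronglyMeasurable_iUnion_iff]
    exact fun j => aestronglyMeasurable_of_tendsto_ae atTop
      (fun k => (contDiff_smoothing hn1 hα.memLp _).continuous.aestronglyMeasurable) (hlim j)
  · rw [← hres, ae_restrict_iUnion_iff]
    intro j
    filter_upwards [hlim j] with x hx
    exact le_of_tendsto hx.norm (Eventually.of_forall fun k => hM _ x)

theorem integrable_comp_mul (hn : 2 ≤ n) {u : Space n → Space n}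
    (hu : MemLp u (ENNReal.ofReal ((n : ℝ) / (n - 1))) (volume.restrict Ω)) {f : Space n → ℝ}
    (hf : MemLp f n (volume.restrict Ω)) (i : Fin n) :
    Integrable (fun x => u x i * f x) (volume.restrict (Ω : Set (Space n))) := by
  refine ⟨((EuclideanSpace.proj (𝕜 := ℝ) i).continuous.comp_aestronglyMeasurable hu.1).mul hf.1, ?_⟩
  refine lt_of_le_of_lt (lintegral_mono fun x => (enorm_mul _ _).le) ?_
  exact (lintegral_comp_mul_le hn hu.1 hf.1 i).trans_lt (ENNReal.mul_lt_top hu.2 hf.2)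

theorem tendsto_integral_comp_mul (hn : 2 ≤ n) {u : Space n → Space n}
    (hu : MemLp u (ENNReal.ofReal ((n : ℝ) / (n - 1))) (volume.restrict Ω)) {f : Space n → ℝ}
    (hf : MemLp f n (volume.restrict Ω)) {F : ℕ → Space n → ℝ}
    (hF : ∀ k, MemLp (F k) n (volume.restrict Ω))
    (hlim : Tendsto (fun k => eLpNorm (F k - f) n (volume.restrict Ω)) atTop (𝓝 0)) (i : Fin n) :
    Tendsto (fun k => ∫ x in Ω, u x i * F k x) atTop (𝓝 (∫ x in Ω, u x i * f x)) := by
  refine tendsto_integral_of_L1 _ (integrable_comp_mul hn hu hf i).1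
    (Eventually.of_forall fun k => integrable_comp_mul hn hu (hF k) i) ?_
  have h1 := ENNReal.Tendsto.const_mul
    (a := eLpNorm u (ENNReal.ofReal ((n : ℝ) / (n - 1))) (volume.restrict (Ω : Set (Space n))))
    hlim (Or.inr hu.2.ne)
  rw [mul_zero] at h1
  refine tendsto_of_tendsto_of_tendsto_of_le_of_le tendsto_const_nhds h1 (fun _ => zero_le)
    fun k => le_trans (lintegral_mono fun x => le_of_eq ?_)
      (lintegral_comp_mul_le hn hu.1 ((hF k).1.sub hf.1) i)
  rw [← mul_sub, enorm_mul]
  rfl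

theorem integrable_symTensor (hn : 2 ≤ n) {u : Space n → Space n}
    (hu : MemLp u (ENNReal.ofReal ((n : ℝ) / (n - 1))) (volume.restrict Ω))
    {G : Space n → Space n} (hG : MemLp G n (volume.restrict Ω)) :
    IntegrableOn (fun x => symTensor (G x) (u x)) (Ω : Set (Space n)) := by
  have hGi : ∀ i, MemLp (fun x => G x i) n (volume.restrict (Ω : Set (Space n))) :=
    memLp_piLp_iff.1 hG
  rw [IntegrableOn, ← memLp_one_iff_integrable, memLp_piLp_iff]
  intro p
  rw [memLp_one_iff_integrable]
  refine (((integrable_comp_mul hn hu (hGi p.1) p.2).add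
    (integrable_comp_mul hn hu (hGi p.2) p.1)).div_const 2).congr (ae_of_all _ fun x => ?_)
  simp [symTensor, mul_comm]

/-- The gradient of a test function times smoothings converges in `Lⁿ`. -/
theorem IsSobolev.tendsto_eLpNorm_gradient_testMul {q : ℝ≥0∞} (hq : 1 ≤ q) (hq' : q ≠ ∞)
    {α : Space n → ℝ} {G : Space n → Space n} (hα : IsSobolev Ω q α G) (φ : 𝓓(Ω, ℝ)) (i : Fin n) :
    Tendsto (fun k => eLpNorm ((fun x => (∇ (testMul φ (contDiff_smoothing hq hα.memLp k)) x) i) -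
      fun x => φ x * G x i + α x * (∇ φ x) i) q (volume.restrict Ω)) atTop (𝓝 0) := by
  have hΩ : MeasurableSet (Ω : Set (Space n)) := Ω.isOpen.measurableSet
  obtain ⟨C, hC0, hC, hC'⟩ := TestFunction.exists_common_bound φ
  have hG : MemLp (fun x => G x i) q (volume.restrict (Ω : Set (Space n))) :=
    memLp_piLp_iff.1 hα.memLp_grad i
  have h1 := ENNReal.Tendsto.const_mul (a := ENNReal.ofReal C)
    ((tendsto_eLpNorm_smoothing_sub hq hq' hα.memLp).add (tendsto_eLpNorm_smoothing_sub hq hq' hG))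
    (Or.inr (by simp))
  rw [add_zero, mul_zero] at h1
  -- The comparison holds only for large `k`, when gradient and smoothing commute on the support of
  -- `φ`.
  refine tendsto_of_tendsto_of_tendsto_of_le_of_le' tendsto_const_nhds h1
    (Eventually.of_forall fun _ => zero_le) ?_
  filter_upwards [hα.gradient_smoothing hq φ.hasCompactSupport φ.tsupport_subset] with k hk
  have hm : ∀ {f : Space n → ℝ}, MemLp f q (volume.restrict (Ω : Set (Space n))) →
      AEStronglyMeasurable (smoothing Ω f k - (Ω : Set (Space n)).indicator f) volume := fun hf =>
    (contDiff_smoothing hq hf k).continuous.aestronglyMeasurable.sub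
      ((aestronglyMeasurable_indicator_iff hΩ).2 hf.1)
  let g : Space n → ℝ := fun x => ‖(smoothing Ω α k - (Ω : Set (Space n)).indicator α) x‖ +
    ‖(smoothing Ω (fun x => G x i) k - (Ω : Set (Space n)).indicator fun x => G x i) x‖
  calc _ ≤ eLpNorm (C • g) q (volume.restrict (Ω : Set (Space n))) := by
        refine eLpNorm_mono_ae_real ?_
        filter_upwards [ae_restrict_mem hΩ] with x hxΩ
        rw [Pi.sub_apply, gradient_testMul, Pi.smul_apply, smul_eq_mul]
        by_cases hx : x ∈ tsupport φ
        · rw [hk x hx i]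
          have e : φ x * smoothing Ω (fun y => G y i) k x + smoothing Ω α k x * (∇ φ x) i -
              (φ x * G x i + α x * (∇ φ x) i) =
              (smoothing Ω α k x - α x) * (∇ φ x) i +
                φ x * (smoothing Ω (fun y => G y i) k x - G x i) := by ring
          rw [e]
          refine (norm_add_le _ _).trans ?_
          simp only [g, Pi.sub_apply, Set.indicator_of_mem hxΩ]
          rw [norm_mul, norm_mul, mul_add, mul_comm ‖smoothing Ω α k x - α x‖]
          gcongr
          · exact hC' x i
          · exact hC x
        · rw [gradient_eq_zero_of_notMem hx, image_eq_zero_of_notMem_tsupport hx]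
          simp only [zero_mul, PiLp.zero_apply, mul_zero, add_zero, sub_zero, norm_zero]
          positivity
    _ ≤ eLpNorm (C • g) q volume := eLpNorm_restrict_le _ _ _ _
    _ = ENNReal.ofReal C * eLpNorm g q volume := by
        rw [eLpNorm_const_smul, Real.enorm_of_nonneg hC0]
    _ ≤ _ := by
        gcongr
        refine (eLpNorm_add_le (hm hα.memLp).norm (hm hG).norm hq).trans ?_
        rw [eLpNorm_norm, eLpNorm_norm]

theorem integral_apply_symm {μ : VectorMeasure (Space n) (Mat n)} (hμ : μ.variation Set.univ < ∞)
    (hs : ∀ (s : Set (Space n)) (i j : Fin n), μ s (i, j) = μ s (j, i)) {φ : Space n → ℝ}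
    (hφ : StronglyMeasurable φ) {C : ℝ} (hC : ∀ x, ‖φ x‖ ≤ C) (i j : Fin n) :
    (∫ᵛ x, φ x ∂•μ) (i, j) = (∫ᵛ x, φ x ∂•μ) (j, i) := by
  have : IsFiniteMeasure μ.variation := ⟨hμ⟩
  have hadd : ∀ p, ∀ f g : SimpleFunc (Space n) ℝ, (∫ᵛ x, (f x + g x) ∂•μ) p =
      (∫ᵛ x, f x ∂•μ) p + (∫ᵛ x, g x ∂•μ) p := fun p f g => by
    rw [VectorMeasure.integral_fun_add (simpleFunc_integrable f) (simpleFunc_integrable g)]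
    rfl
  have hlim : ∀ p, ∀ (f : ℕ → SimpleFunc (Space n) ℝ) (φ : Space n → ℝ) (C : ℝ),
      (∀ k x, ‖f k x‖ ≤ C) → (∀ x, Tendsto (fun k => f k x) atTop (𝓝 (φ x))) →
      Tendsto (fun k => (∫ᵛ x, f k x ∂•μ) p) atTop (𝓝 ((∫ᵛ x, φ x ∂•μ) p)) :=
    fun p f φ C hC hl => by
    have := VectorMeasure.tendsto_integral_of_dominated_convergence
      (B := ContinuousLinearMap.lsmul ℝ ℝ) (μ := μ) (fun _ => C)
      (fun k => (f k).aestronglyMeasurable) (integrable_const _) (fun k => ae_of_all _ (hC k))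
      (ae_of_all _ hl)
    exact ((EuclideanSpace.proj (𝕜 := ℝ) p).continuous.tendsto _).comp this
  refine eq_of_eq_indicator (L := fun φ => (∫ᵛ x, φ x ∂•μ) (i, j))
    (R := fun φ => (∫ᵛ x, φ x ∂•μ) (j, i)) ?_ (hadd _) (hadd _) (hlim _) (hlim _) hφ hC
  intro c s hsm
  rw [VectorMeasure.integral_indicator hsm, VectorMeasure.setIntegral_const]
  simp [hs s i j]

/-- Symmetry of the integral is available for bounded strongly measurable integrands, so `f` is
replaced by a strongly measurable version cut off to zero where it exceeds `M`. -/
theorem scalarMul_apply_symm {μ : VectorMeasure (Space n) (Mat n)} (hμ : μ.variation Set.univ < ∞)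
    (hs : ∀ (s : Set (Space n)) (i j : Fin n), μ s (i, j) = μ s (j, i)) {f : Space n → ℝ}
    (hf : AEStronglyMeasurable f μ.variation) {M : ℝ} (hM0 : 0 ≤ M)
    (hM : ∀ᵐ x ∂μ.variation, ‖f x‖ ≤ M) (s : Set (Space n)) (i j : Fin n) :
    scalarMul f μ s (i, j) = scalarMul f μ s (j, i) := by
  have : IsFiniteMeasure μ.variation := ⟨hμ⟩
  by_cases hsm : MeasurableSet s
  swap
  · rw [VectorMeasure.not_measurable _ hsm]; rfl
  let T : Set (Space n) := {x | ‖hf.mk f x‖ ≤ M}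
  have hT : MeasurableSet T :=
    hf.stronglyMeasurable_mk.norm.measurable measurableSet_Iic
  let f' : Space n → ℝ := T.indicator (hf.mk f)
  have hf' : StronglyMeasurable f' := hf.stronglyMeasurable_mk.indicator hT
  have hff' : f =ᵐ[μ.variation] f' := by
    filter_upwards [hf.ae_eq_mk, hM] with x h1 h2
    have : x ∈ T := by simpa [T, ← h1] using h2
    simp [f', this, h1]
  have hf'M : ∀ x, ‖s.indicator f' x‖ ≤ M := fun x => by
    refine (norm_indicator_le_norm_self _ _).trans ?_
    by_cases hx : x ∈ T
    · exact (congrArg norm (Set.indicator_of_mem hx _)).trans_le hx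
    · simpa [f', hx] using hM0
  have hint : μ.Integrable f' := Integrable.of_bound hf'.aestronglyMeasurable M (by
    filter_upwards [hff', hM] with x h1 h2
    rwa [← h1])
  rw [scalarMul, VectorMeasure.withDensity_congr hff', VectorMeasure.withDensity_apply hint,
    ← VectorMeasure.integral_indicator hsm]
  exact integral_apply_symm hμ hs (hf'.indicator hsm) hf'M i j

theorem lebesgueDensity_apply {F : Space n → Mat n} (hF : IntegrableOn F (Ω : Set (Space n)))
    {s : Set (Space n)} (hs : MeasurableSet s) (p : Fin n × Fin n) :
    lebesgueDensity Ω F s p = ∫ x in s ∩ Ω, F x p := by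
  rw [lebesgueDensity, withDensityᵥ_apply hF hs, Measure.restrict_restrict hs]
  exact ((EuclideanSpace.proj (𝕜 := ℝ) p).integral_comp_comm
    (hF.mono_set Set.inter_subset_right)).symm

/-- Product rule for the strain. -/
theorem HasStrain.smul (hn : 2 ≤ n) (hb : Bornology.IsBounded (Ω : Set (Space n)))
    {u : Space n → Space n} {μ : VectorMeasure (Space n) (Mat n)} (h : HasStrain Ω u μ)
    (hu : MemLp u (ENNReal.ofReal ((n : ℝ) / (n - 1))) (volume.restrict Ω))
    {α αt : Space n → ℝ} {G : Space n → Space n} (hα : IsSobolev Ω n α G)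
    (hα_bdd : MemLp α ∞ (volume.restrict Ω)) (hαt : IsQuasicontinuousRep n Ω α αt) :
    μ.Integrable αt ∧ HasStrain Ω (fun x => α x • u x)
      (scalarMul αt μ + lebesgueDensity Ω fun x => symTensor (G x) (u x)) := by
  have hn1 : (1 : ℝ≥0∞) ≤ n := by exact_mod_cast (by omega : 1 ≤ n)
  have hntop : (n : ℝ≥0∞) ≠ ∞ := by simp
  have hΩ : MeasurableSet (Ω : Set (Space n)) := Ω.isOpen.measurableSet
  have hfin : IsFiniteMeasure μ.variation := ⟨h.variation_lt_top⟩
  obtain ⟨M, hM0, hMα, hM⟩ := exists_abs_smoothing_le hα_bdd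
  obtain ⟨hαtm, hαtM⟩ := h.aestronglyMeasurable_quasicontinuousRep hn hb hu hα hαt hM
  have hint : μ.Integrable αt := Integrable.of_bound hαtm M hαtM
  have hF := integrable_symTensor hn hu hα.memLp_grad
  have hfin1 : IsFiniteMeasure (scalarMul αt μ).variation :=
    isFiniteMeasure_variation_withDensity hint
  have hfin2 : IsFiniteMeasure (lebesgueDensity Ω fun x => symTensor (G x) (u x)).variation := by
    rw [lebesgueDensity, Measure.variation_withDensityᵥ hF]
    exact isFiniteMeasure_withDensity hF.2.ne
  refine ⟨hint, ⟨?_, ?_, ?_, ?_⟩⟩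
  · rw [VectorMeasure.restrict_add]
    congr 1
    · rw [scalarMul, VectorMeasure.restrict_withDensity hint, h.restrict_eq]
    · ext s hs p
      rw [VectorMeasure.restrict_apply _ hΩ hs, lebesgueDensity_apply hF (hs.inter hΩ),
        lebesgueDensity_apply hF hs, Set.inter_assoc, Set.inter_self]
  · refine (VectorMeasure.variation_add_le Set.univ).trans_lt ?_
    exact ENNReal.add_lt_top.2 ⟨measure_lt_top _ _, measure_lt_top _ _⟩
  · intro s i j
    by_cases hs : MeasurableSet s
    swap
    · rw [VectorMeasure.not_measurable _ hs]; rfl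
    change scalarMul αt μ s (i, j) + lebesgueDensity Ω _ s (i, j) =
      scalarMul αt μ s (j, i) + lebesgueDensity Ω _ s (j, i)
    rw [scalarMul_apply_symm h.variation_lt_top h.isSymm hαtm hM0 hαtM s i j,
      lebesgueDensity_apply hF hs, lebesgueDensity_apply hF hs]
    congr 2 with x
    simp [symTensor, add_comm]
  · intro φ i j
    obtain ⟨C, hC0, hC, hC'⟩ := TestFunction.exists_common_bound φ
    have hφm : StronglyMeasurable φ := φ.contDiff.continuous.stronglyMeasurable
    have hφi : ∀ {ν : VectorMeasure (Space n) (Mat n)}, IsFiniteMeasure ν.variation →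
        ν.Integrable φ := fun _ => Integrable.of_bound hφm.aestronglyMeasurable C (ae_of_all _ hC)
    let sm := fun k => contDiff_smoothing hn1 hα.memLp k
    let f : Fin n → Space n → ℝ := fun l x => φ x * G x l + α x * (∇ φ x) l
    have hGl : ∀ l, MemLp (fun x => G x l) n (volume.restrict (Ω : Set (Space n))) :=
      memLp_piLp_iff.1 hα.memLp_grad
    have hfG : ∀ l, MemLp (fun x => φ x * G x l) n (volume.restrict (Ω : Set (Space n))) :=
      fun l => (hGl l).of_le_mul (c := C) (hφm.aestronglyMeasurable.mul (hGl l).1)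
        (ae_of_all _ fun x => by rw [norm_mul]; gcongr; exact hC x)
    have hfα : ∀ l, MemLp (fun x => α x * (∇ φ x) l) n (volume.restrict (Ω : Set (Space n))) :=
      fun l => hα.memLp.of_le_mul (c := C) (hα.memLp.1.mul
        (continuous_gradient_apply φ.contDiff l).aestronglyMeasurable)
        (ae_of_all _ fun x => by rw [norm_mul, mul_comm]; gcongr; exact hC' x l)
    have hf : ∀ l, MemLp (f l) n (volume.restrict (Ω : Set (Space n))) := fun l =>
      (hfG l).add (hfα l)
    have hFm : ∀ k l, MemLp (fun x => (∇ (testMul φ (sm k)) x) l) n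
        (volume.restrict (Ω : Set (Space n))) := fun k l =>
      (continuous_gradient_apply (testMul φ (sm k)).contDiff l).memLp_of_hasCompactSupport
        ((hasCompactSupport_gradient (testMul φ (sm k)).hasCompactSupport).comp_left
          (g := fun y : Space n => y l) rfl)
    have hterm := fun l p => tendsto_integral_comp_mul hn hu (hf l) (fun k => hFm k l)
      (hα.tendsto_eLpNorm_gradient_testMul hn1 hntop φ l) p
    -- The test functions `φ α_k` in the equation defining the strain of `u`: Hölder's inequality
    -- gives the limit of the right side.
    have hlim1 : Tendsto (fun k => (∫ᵛ x, testMul φ (sm k) x ∂•μ) (i, j)) atTop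
        (𝓝 (-((∫ x in Ω, u x i * f j x) + ∫ x in Ω, u x j * f i x) / 2)) := by
      have e : ∀ k, (∫ᵛ x, testMul φ (sm k) x ∂•μ) (i, j) =
          -((∫ x in Ω, u x i * (∇ (testMul φ (sm k)) x) j) +
            ∫ x in Ω, u x j * (∇ (testMul φ (sm k)) x) i) / 2 := by
        intro k
        rw [h.integral_eq, integral_div, integral_add (integrable_comp_mul hn hu (hFm k j) i)
          (integrable_comp_mul hn hu (hFm k i) j), neg_div]
      simp_rw [e]
      exact ((hterm j i).add (hterm i j)).neg.div_const 2
    obtain ⟨ns, hns, hae⟩ := h.exists_tendsto_smoothing hn hb hu hα hαt φ.hasCompactSupport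
      φ.tsupport_subset
    -- Dominated convergence with the constant bound `C * M`. Convergence is known only on the
    -- support of `φ`, and elsewhere both sides vanish.
    have hlim2 : Tendsto (fun k => ∫ᵛ x, testMul φ (sm (ns k)) x ∂•μ) atTop
        (𝓝 (∫ᵛ x, φ x * αt x ∂•μ)) := by
      refine VectorMeasure.tendsto_integral_of_dominated_convergence (fun _ => C * M)
        (fun k => (testMul φ (sm (ns k))).contDiff.continuous.aestronglyMeasurable)
        (integrable_const _) (fun k => ae_of_all _ fun x => ?_) ?_
      · rw [testMul_apply, norm_mul]
        gcongr
        · exact hC x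
        · exact hM _ x
      · have hcl : MeasurableSet (tsupport φ) := (isClosed_tsupport φ).measurableSet
        filter_upwards [(ae_restrict_iff' hcl).1 hae] with x hx
        by_cases hxs : x ∈ tsupport φ
        · exact (hx hxs).const_mul _
        · simp [testMul_apply, image_eq_zero_of_notMem_tsupport hxs]
    have hlim3 := ((EuclideanSpace.proj (𝕜 := ℝ) (i, j)).continuous.tendsto _).comp hlim2
    have key : (∫ᵛ x, φ x * αt x ∂•μ) (i, j) =
        -((∫ x in Ω, u x i * f j x) + ∫ x in Ω, u x j * f i x) / 2 :=
      tendsto_nhds_unique hlim3 (hlim1.comp hns.tendsto_atTop)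
    rw [VectorMeasure.integral_add_vectorMeasure (hφi hfin1) (hφi hfin2)]
    change (∫ᵛ x, φ x ∂•(scalarMul αt μ)) (i, j) + (∫ᵛ x, φ x ∂•(lebesgueDensity Ω _)) (i, j) = _
    rw [scalarMul, integral_withDensity_lsmul hint hφm hC, key, lebesgueDensity,
      integral_withDensityᵥ hF hφm hC]
    have hcomp : (∫ x in Ω, φ x • symTensor (G x) (u x)) (i, j) =
        ∫ x in Ω, (u x i * (φ x * G x j) + u x j * (φ x * G x i)) / 2 := by
      have h1 := ((EuclideanSpace.proj (𝕜 := ℝ) (i, j)).integral_comp_comm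
        (hF.bdd_smul (φ := φ) C hφm.aestronglyMeasurable (ae_of_all _ hC)))
      refine h1.symm.trans (integral_congr_ae (ae_of_all _ fun x => ?_))
      simp [symTensor]
      ring
    have i1 := fun p l => integrable_comp_mul hn hu (hfG l) p
    have i2 := fun p l => integrable_comp_mul hn hu (hfα l) p
    -- The part with `φ ∇α` becomes the measure `∇α ⊙ u`, the part with `α ∇φ` the distributional
    -- strain of `α u`.
    have hsplit : ∀ p l, ∫ x in Ω, u x p * f l x =
        (∫ x in Ω, u x p * (φ x * G x l)) + ∫ x in Ω, u x p * (α x * (∇ φ x) l) := by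
      intro p l
      rw [← integral_add (i1 p l) (i2 p l)]
      simp only [f, mul_add]
    have hr : ∫ x in Ω, ((α x • u x) i * (∇ φ x) j + (α x • u x) j * (∇ φ x) i) / 2 =
        ((∫ x in Ω, u x i * (α x * (∇ φ x) j)) + ∫ x in Ω, u x j * (α x * (∇ φ x) i)) / 2 := by
      rw [← integral_add (i2 i j) (i2 j i), ← integral_div]
      refine integral_congr_ae (ae_of_all _ fun x => ?_)
      simp
      ring
    rw [hcomp, hr, integral_div, integral_add (i1 i j) (i1 j i), hsplit, hsplit]
    ring

end

/-! ### Existence of quasicontinuous representatives. -/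

section

variable {n : ℕ} {Ω : Opens (Space n)}

theorem sum_Ico_two_inv_pow_le (a b : ℕ) :
    ∑ j ∈ Finset.Ico a b, (2⁻¹ : ℝ≥0∞) ^ j ≤ 2 * 2⁻¹ ^ a := by
  rw [Finset.sum_Ico_eq_sum_range]
  refine (ENNReal.sum_le_tsum _).trans (le_of_eq ?_)
  simp_rw [pow_add]
  rw [ENNReal.tsum_mul_left, ENNReal.tsum_geometric, ENNReal.one_sub_inv_two, inv_inv, mul_comm]

/-- A geometrically dominated series converges in `Lᵖ`. -/
theorem exists_tendsto_eLpNorm_sum_sub {X E : Type*} {mX : MeasurableSpace X}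
    [NormedAddCommGroup E] [CompleteSpace E] {ν : Measure X} {p : ℝ≥0∞} (hp : 1 ≤ p)
    {F : ℕ → X → E} (hF : ∀ j, MemLp (F j) p ν) (hF' : ∀ j, eLpNorm (F j) p ν ≤ 2⁻¹ ^ j) (N : ℕ) :
    ∃ f : X → E, MemLp f p ν ∧
      Tendsto (fun k => eLpNorm (∑ j ∈ Finset.Ico N (N + k), F j - f) p ν) atTop (𝓝 0) ∧
      eLpNorm f p ν ≤ 2 * 2⁻¹ ^ N := by
  let S : ℕ → X → E := fun k => ∑ j ∈ Finset.Ico N (N + k), F j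
  have hS : ∀ k, MemLp (S k) p ν := fun k => memLp_finsetSum' _ fun j _ => hF j
  have hsum : ∀ a b, eLpNorm (∑ j ∈ Finset.Ico a b, F j) p ν ≤ 2 * 2⁻¹ ^ a := fun a b =>
    (eLpNorm_sum_le (fun j _ => (hF j).1) hp).trans
      ((Finset.sum_le_sum fun j _ => hF' j).trans (sum_Ico_two_inv_pow_le a b))
  have hpos : ∀ k : ℕ, (2⁻¹ : ℝ≥0∞) ^ k ≠ 0 := fun k => by simp
  have hfin : ∀ k : ℕ, (2⁻¹ : ℝ≥0∞) ^ k ≠ ∞ := fun k => by simp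
  -- The completeness criterion asks for a strict inequality, whence `4` in place of `2`.
  have hlt : ∀ a k l, a ≤ l → l ≤ k → eLpNorm (S k - S l) p ν < 4 * 2⁻¹ ^ a := by
    intro a k l hal hlk
    have e : S k - S l = ∑ j ∈ Finset.Ico (N + l) (N + k), F j := by
      rw [sub_eq_iff_eq_add']
      exact (Finset.sum_Ico_consecutive F (by omega) (by omega)).symm
    rw [e]
    calc _ ≤ 2 * (2⁻¹ : ℝ≥0∞) ^ (N + l) := hsum _ _
      _ ≤ 2 * 2⁻¹ ^ a := by
        gcongr 2 * ?_
        exact pow_le_pow_right_of_le_one' (by simp) (by omega)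
      _ < 4 * 2⁻¹ ^ a := ENNReal.mul_lt_mul_left (hpos a) (hfin a) (by norm_num)
  obtain ⟨f, hf, hlim⟩ := Lp.cauchy_complete_eLpNorm hp hS (B := fun a => 4 * 2⁻¹ ^ a)
    (by
      rw [ENNReal.tsum_mul_left, ENNReal.tsum_geometric, ENNReal.one_sub_inv_two, inv_inv]
      exact ENNReal.mul_ne_top (by simp) (by simp))
    (fun a k l hk hl => by
      rcases le_total l k with h | h
      · exact hlt a k l hl h
      · rw [eLpNorm_sub_comm]; exact hlt a l k hk h)
  refine ⟨f, hf, hlim, ?_⟩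
  have h1 : ∀ k, eLpNorm f p ν ≤ 2 * 2⁻¹ ^ N + eLpNorm (S k - f) p ν := fun k => by
    have e : f = S k - (S k - f) := by abel
    calc eLpNorm f p ν = eLpNorm (S k - (S k - f)) p ν := by rw [← e]
      _ ≤ _ := (eLpNorm_sub_le (hS k).1 ((hS k).1.sub hf.1) hp).trans
        (add_le_add (hsum _ _) le_rfl)
  have h2 : Tendsto (fun k => 2 * 2⁻¹ ^ N + eLpNorm (S k - f) p ν) atTop
      (𝓝 (2 * 2⁻¹ ^ N + 0)) := tendsto_const_nhds.add hlim
  rw [add_zero] at h2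
  exact ge_of_tendsto' h2 h1

theorem gradient_sum (s : Finset ℕ) (θ : ℕ → 𝓓(Ω, ℝ)) (x : Space n) :
    ∇ (∑ j ∈ s, θ j : 𝓓(Ω, ℝ)) x = ∑ j ∈ s, ∇ (θ j) x := by
  have h : ((∑ j ∈ s, θ j : 𝓓(Ω, ℝ)) : Space n → ℝ) = ∑ j ∈ s, (θ j : Space n → ℝ) :=
    FunLike.coe_sum s θ
  rw [h, gradient, fderiv_sum fun j _ => (θ j).contDiff.differentiable (by simp) x, map_sum]
  rfl

theorem TestFunction.memLp (φ : 𝓓(Ω, ℝ)) (q : ℝ≥0∞) : MemLp φ q (volume.restrict Ω) :=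
  φ.contDiff.continuous.memLp_of_hasCompactSupport φ.hasCompactSupport

theorem TestFunction.memLp_gradient (φ : 𝓓(Ω, ℝ)) (q : ℝ≥0∞) :
    MemLp (∇ φ) q (volume.restrict Ω) :=
  (continuous_gradient φ.contDiff).memLp_of_hasCompactSupport
    (hasCompactSupport_gradient φ.hasCompactSupport)

theorem TestFunction.eq_zero_of_notMem (φ : 𝓓(Ω, ℝ)) {x : Space n} (hx : x ∉ (Ω : Set (Space n))) :
    φ x = 0 := image_eq_zero_of_notMem_tsupport fun h => hx (φ.tsupport_subset h)

theorem TestFunction.integral_mul_gradient (ψ φ : 𝓓(Ω, ℝ)) (i : Fin n) :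
    ∫ x in Ω, ψ x * (∇ φ x) i = - ∫ x in Ω, (∇ ψ x) i * φ x := by
  rw [setIntegral_eq_integral_of_forall_compl_eq_zero fun x hx => by
      rw [TestFunction.eq_zero_of_notMem ψ hx, zero_mul],
    setIntegral_eq_integral_of_forall_compl_eq_zero fun x hx => by
      rw [TestFunction.eq_zero_of_notMem φ hx, mul_zero]]
  simp only [gradient_apply]
  have hc : ∀ φ : 𝓓(Ω, ℝ), Continuous fun x => fderiv ℝ φ x (EuclideanSpace.single i 1) := fun φ =>
    (φ.contDiff.continuous_fderiv (by simp)).clm_apply continuous_const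
  refine integral_mul_fderiv_eq_neg_fderiv_mul_of_integrable ?_ ?_ ?_
    (fun x _ => ψ.contDiff.differentiable (by simp) x)
    (fun x _ => φ.contDiff.differentiable (by simp) x)
  · exact ((hc ψ).mul φ.contDiff.continuous).integrable_of_hasCompactSupport
      φ.hasCompactSupport.mul_left
  · exact (ψ.contDiff.continuous.mul (hc φ)).integrable_of_hasCompactSupport
      ψ.hasCompactSupport.mul_right
  · exact (ψ.contDiff.continuous.mul φ.contDiff.continuous).integrable_of_hasCompactSupport
      φ.hasCompactSupport.mul_left

theorem tendsto_integral_mul_of_eLpNorm {X : Type*} {mX : MeasurableSpace X} {ν : Measure X}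
    [IsFiniteMeasure ν] {q : ℝ≥0∞} (hq : 1 ≤ q) {F : ℕ → X → ℝ} {f w : X → ℝ}
    (hF : ∀ k, MemLp (F k) q ν) (hf : MemLp f q ν) (hw : AEStronglyMeasurable w ν) {C : ℝ}
    (hC : ∀ x, ‖w x‖ ≤ C) (hlim : Tendsto (fun k => eLpNorm (F k - f) q ν) atTop (𝓝 0)) :
    Tendsto (fun k => ∫ x, F k x * w x ∂ν) atTop (𝓝 (∫ x, f x * w x ∂ν)) := by
  have hint : ∀ g, MemLp g q ν → Integrable (fun x => g x * w x) ν := fun g hg =>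
    (hg.integrable hq).mul_bdd hw (ae_of_all _ hC)
  refine tendsto_integral_of_L1 _ (hint f hf).1 (Eventually.of_forall fun k => hint _ (hF k)) ?_
  set c := ν Set.univ ^ (1 / (1 : ℝ≥0∞).toReal - 1 / q.toReal)
  have hc : c ≠ ∞ := by
    refine ENNReal.rpow_ne_top_of_nonneg ?_ (measure_ne_top _ _)
    rcases eq_or_ne q ∞ with rfl | hq'
    · simp
    · have : 1 ≤ q.toReal := by simpa using ENNReal.toReal_mono hq' hq
      simp only [ENNReal.toReal_one, sub_nonneg]
      gcongr
  have h1 := ENNReal.Tendsto.mul_const (ENNReal.Tendsto.mul_const hlim (Or.inr hc) (b := c))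
    (b := ENNReal.ofReal C) (Or.inr (by simp))
  rw [zero_mul, zero_mul] at h1
  refine tendsto_of_tendsto_of_tendsto_of_le_of_le tendsto_const_nhds h1 (fun _ => zero_le)
    fun k => ?_
  calc ∫⁻ x, ‖F k x * w x - f x * w x‖ₑ ∂ν ≤ ∫⁻ x, ‖(F k - f) x‖ₑ * ENNReal.ofReal C ∂ν := by
        refine lintegral_mono fun x => ?_
        rw [← sub_mul, enorm_mul, Pi.sub_apply]
        gcongr
        rw [← ofReal_norm]
        exact ENNReal.ofReal_le_ofReal (hC x)
    _ = eLpNorm (F k - f) 1 ν * ENNReal.ofReal C := by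
        rw [lintegral_mul_const' _ _ (by simp), eLpNorm_one_eq_lintegral_enorm]
    _ ≤ _ := by
        gcongr
        exact eLpNorm_le_eLpNorm_mul_rpow_measure_univ hq ((hF k).1.sub hf.1)

/-- The weak gradient identity holds for test functions and passes to the limit, because convergence
in `L^q` on a bounded set implies convergence against bounded functions. -/
theorem isSobolevZero_of_tendsto (hb : Bornology.IsBounded (Ω : Set (Space n))) {q : ℝ≥0∞}
    (hq : 1 ≤ q) {S : ℕ → 𝓓(Ω, ℝ)} {v : Space n → ℝ} {g : Space n → Space n}
    (hv : MemLp v q (volume.restrict Ω)) (hg : MemLp g q (volume.restrict Ω))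
    (hSv : Tendsto (fun k => eLpNorm (fun x => S k x - v x) q (volume.restrict Ω)) atTop (𝓝 0))
    (hSg : Tendsto (fun k => eLpNorm (fun x => ∇ (S k) x - g x) q (volume.restrict Ω)) atTop
      (𝓝 0)) : IsSobolevZero Ω q v g := by
  have : IsFiniteMeasure (volume.restrict (Ω : Set (Space n))) :=
    ⟨by simpa using hb.measure_lt_top⟩
  refine ⟨⟨hv, hg, fun φ i => ?_⟩, S, hSv, hSg⟩
  obtain ⟨C, -, hC, hC'⟩ := TestFunction.exists_common_bound φ
  have h1 := tendsto_integral_mul_of_eLpNorm hq (fun k => TestFunction.memLp (S k) q) hv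
    (continuous_gradient_apply φ.contDiff i).aestronglyMeasurable (fun x => hC' x i) hSv
  have h2 := tendsto_integral_mul_of_eLpNorm hq
    (fun k => memLp_piLp_iff.1 (TestFunction.memLp_gradient (S k) q) i) (memLp_piLp_iff.1 hg i)
    φ.contDiff.continuous.aestronglyMeasurable hC
    (tendsto_of_tendsto_of_tendsto_of_le_of_le tendsto_const_nhds hSg (fun _ => zero_le)
      fun k => eLpNorm_mono fun x => PiLp.norm_apply_le (∇ (S k) x - g x) i)
  simp_rw [TestFunction.integral_mul_gradient] at h1
  exact tendsto_nhds_unique h1 h2.neg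

/-- The function `v` is the sum of the `θ j` with `j ≥ N`, which converges in `W^{1,q}`; as the
terms are nonnegative, it dominates each of them. It serves as a competitor for the capacity of a
countable union. -/
theorem exists_isSobolevZero_ge (hb : Bornology.IsBounded (Ω : Set (Space n))) {q : ℝ≥0∞}
    (hq : 1 ≤ q) {θ : ℕ → 𝓓(Ω, ℝ)} (h0 : ∀ j x, 0 ≤ θ j x)
    (hθ : ∀ j, eLpNorm (θ j) q (volume.restrict Ω) ≤ 2⁻¹ ^ j)
    (hθ' : ∀ j, eLpNorm (∇ (θ j)) q (volume.restrict Ω) ≤ 2⁻¹ ^ j) (N : ℕ) :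
    ∃ (v : Space n → ℝ) (g : Space n → Space n), IsSobolevZero Ω q v g ∧
      (∀ j ≥ N, ∀ᵐ x ∂(volume.restrict (Ω : Set (Space n))), θ j x ≤ v x) ∧
      eLpNorm v q (volume.restrict Ω) ≤ 2 * 2⁻¹ ^ N ∧
      eLpNorm g q (volume.restrict Ω) ≤ 2 * 2⁻¹ ^ N := by
  obtain ⟨v, hv, hvlim, hvn⟩ := exists_tendsto_eLpNorm_sum_sub hq
    (fun j => TestFunction.memLp (θ j) q) hθ N
  obtain ⟨g, hg, hglim, hgn⟩ := exists_tendsto_eLpNorm_sum_sub hq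
    (fun j => TestFunction.memLp_gradient (θ j) q) hθ' N
  let S : ℕ → 𝓓(Ω, ℝ) := fun k => ∑ j ∈ Finset.Ico N (N + k), θ j
  have hS : ∀ k x, S k x = ∑ j ∈ Finset.Ico N (N + k), θ j x := fun k x => by
    have h : (S k : Space n → ℝ) = ∑ j ∈ Finset.Ico N (N + k), (θ j : Space n → ℝ) :=
      FunLike.coe_sum _ θ
    rw [h, Finset.sum_apply]
  refine ⟨v, g, isSobolevZero_of_tendsto hb hq (S := S) hv hg ?_ ?_, fun j hj => ?_, hvn, hgn⟩
  · convert hvlim using 3 with k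
    ext x
    simp [hS]
  · convert hglim using 3 with k
    ext1 x
    simp [S, gradient_sum]
  · have hm := tendstoInMeasure_of_tendsto_eLpNorm (zero_lt_one.trans_le hq).ne'
      (fun k => (memLp_finsetSum' (Finset.Ico N (N + k))
        fun j _ => TestFunction.memLp (θ j) q).1) hv.1 hvlim
    obtain ⟨ns, hns, hae⟩ := hm.exists_seq_tendsto_ae
    filter_upwards [hae] with x hx
    refine ge_of_tendsto hx ?_
    filter_upwards [hns.tendsto_atTop.eventually_ge_atTop (j + 1)] with k hk
    rw [Finset.sum_apply]
    exact Finset.single_le_sum (f := fun j => θ j x) (fun j _ => h0 j x)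
      (Finset.mem_Ico.2 ⟨hj, by omega⟩)

/-- The test function `2 softSq (c ψ)`. -/
def softTest (c : ℝ) (ψ : 𝓓(Ω, ℝ)) : 𝓓(Ω, ℝ) :=
  ⟨fun x => 2 * softSq (c * ψ x),
    contDiff_const.mul (contDiff_softSq.comp (contDiff_const.mul ψ.contDiff)),
    ψ.hasCompactSupport.comp_left (g := fun t => 2 * softSq (c * t)) (by simp [softSq_zero]),
    (closure_mono (Function.support_comp_subset (g := fun t => 2 * softSq (c * t))
      (by simp [softSq_zero]) ψ)).trans ψ.tsupport_subset⟩

theorem softTest_apply (c : ℝ) (ψ : 𝓓(Ω, ℝ)) (x : Space n) :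
    softTest c ψ x = 2 * softSq (c * ψ x) := rfl

theorem gradient_softTest (c : ℝ) (ψ : 𝓓(Ω, ℝ)) (x : Space n) (i : Fin n) :
    (∇ (softTest c ψ) x) i = 2 * (softSqDeriv (c * ψ x) * (c * (∇ ψ x) i)) := by
  have hd : DifferentiableAt ℝ (fun y => c * ψ y) x :=
    (ψ.contDiff.differentiable (by simp) x).const_mul c
  have h1 := gradient_softSq_comp_apply hd i
  simp only [gradient_apply] at h1 ⊢
  change fderiv ℝ (fun y => 2 * softSq (c * ψ y)) x _ = _
  have hd2 : DifferentiableAt ℝ (fun y => softSq (c * ψ y)) x :=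
    (hasDerivAt_softSq _).differentiableAt.comp x hd
  rw [fderiv_const_mul hd2]
  rw [fderiv_const_mul (ψ.contDiff.differentiable (by simp) x)] at h1
  simpa using h1

theorem eLpNorm_softTest_le {c : ℝ} (hc : 0 ≤ c) (ψ : 𝓓(Ω, ℝ)) {q ε : ℝ≥0∞} (hq : 1 ≤ q)
    (h : eLpNorm ψ q volume ≤ ε) (h' : ∀ i, eLpNorm (fun x => (∇ ψ x) i) q volume ≤ ε) :
    eLpNorm (softTest c ψ) q volume ≤ ENNReal.ofReal (2 * c) * ε ∧
      eLpNorm (∇ (softTest c ψ)) q volume ≤ n * (ENNReal.ofReal (2 * c) * ε) := by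
  have h2c : 0 ≤ 2 * c := by positivity
  constructor
  · refine le_trans (eLpNorm_mono (g := (2 * c) • (ψ : Space n → ℝ)) fun x => ?_) ?_
    · rw [softTest_apply, Real.norm_of_nonneg (mul_nonneg zero_le_two (softSq_nonneg _)),
        Pi.smul_apply, norm_smul, Real.norm_of_nonneg h2c, mul_assoc]
      refine mul_le_mul_of_nonneg_left ((softSq_le_abs _).trans ?_) zero_le_two
      rw [abs_mul, abs_of_nonneg hc, Real.norm_eq_abs]
    · rw [eLpNorm_const_smul, Real.enorm_of_nonneg h2c]
      gcongr
  · have hm : ∀ i, AEStronglyMeasurable (fun x => ‖(∇ (softTest c ψ) x) i‖)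
        (volume : Measure (Space n)) := fun i =>
      (continuous_gradient_apply (softTest c ψ).contDiff i).norm.aestronglyMeasurable
    calc _ ≤ eLpNorm (∑ i, fun x => ‖(∇ (softTest c ψ) x) i‖) q volume := by
          refine eLpNorm_mono_enorm fun x => (euclidean_enorm_le_sum_enorm _).trans ?_
          rw [Finset.sum_apply, Real.enorm_of_nonneg (Finset.sum_nonneg fun _ _ => norm_nonneg _),
            ENNReal.ofReal_sum_of_nonneg fun _ _ => norm_nonneg _]
          simp only [ofReal_norm, le_refl]
      _ ≤ ∑ i, eLpNorm (fun x => ‖(∇ (softTest c ψ) x) i‖) q volume :=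
          eLpNorm_sum_le (fun i _ => hm i) hq
      _ ≤ ∑ i : Fin n, ENNReal.ofReal (2 * c) * ε := by
          refine Finset.sum_le_sum fun i _ => ?_
          refine le_trans (eLpNorm_mono (g := (2 * c) • fun x => (∇ ψ x) i) fun x => ?_) ?_
          · rw [gradient_softTest, norm_norm, Pi.smul_apply, norm_smul, Real.norm_of_nonneg h2c,
              norm_mul, norm_mul, norm_mul, Real.norm_of_nonneg hc, Real.norm_two, mul_assoc]
            refine mul_le_mul_of_nonneg_left ?_ zero_le_two
            exact mul_le_of_le_one_left (by positivity) (abs_softSqDeriv_le _)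
          · rw [eLpNorm_const_smul, Real.enorm_of_nonneg h2c]
            gcongr
            exact h' i
      _ = _ := by simp

theorem capacity_le {q : ℝ≥0∞} (hq0 : q ≠ 0) (hq : q ≠ ∞) {v : Space n → ℝ}
    {g : Space n → Space n} (hv : IsSobolevZero Ω q v g) {A : Set (Space n)} (hA : IsOpen A)
    (hAΩ : A ⊆ Ω) (h1 : ∀ᵐ x ∂(volume.restrict A), 1 ≤ v x) :
    capacity q A Ω ≤ eLpNorm g q (volume.restrict Ω) ^ q.toReal := by
  rw [eLpNorm_eq_lintegral_rpow_enorm_toReal hq0 hq, ← ENNReal.rpow_mul,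
    one_div_mul_cancel (ENNReal.toReal_pos hq0 hq).ne', ENNReal.rpow_one]
  exact iInf₂_le_of_le v g (iInf₂_le_of_le hv ⟨A, hA, subset_rfl, hAΩ, h1⟩ le_rfl)

/-- Existence of quasicontinuous representatives. -/
theorem IsSobolev.exists_isQuasicontinuousRep (hn : 2 ≤ n)
    (hb : Bornology.IsBounded (Ω : Set (Space n))) {α : Space n → ℝ} {G : Space n → Space n}
    (hα : IsSobolev Ω n α G) : ∃ αt : Space n → ℝ, IsQuasicontinuousRep n Ω α αt := by
  have hn1 : (1 : ℝ≥0∞) ≤ n := by exact_mod_cast (by omega : 1 ≤ n)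
  have hntop : (n : ℝ≥0∞) ≠ ∞ := by simp
  have hn0 : (n : ℝ≥0∞) ≠ 0 := (zero_lt_one.trans_le hn1).ne'
  have hΩ : MeasurableSet (Ω : Set (Space n)) := Ω.isOpen.measurableSet
  obtain ⟨K, hK, hKint, hKΩ⟩ := exists_compact_exhaustion Ω
  have hKmono : Monotone K := monotone_nat_of_le_succ fun j => (hKint j).trans interior_subset
  choose χ O hO hKO hOΩ hχ using fun j =>
    exists_testFunction_eq_one (hK j) (hKΩ ▸ Set.subset_iUnion K j)
  -- The factor `2 * 2 ^ j` is the Lipschitz constant of `t ↦ 2 softSq (2 ^ j t)`. In `1 + n` the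
  -- `1` is for the function and `n` for the components of its gradient.
  choose ε hε0 hεt hε using fun j : ℕ =>
    exists_ne_zero_mul_le (a := (1 + n) * ENNReal.ofReal (2 * 2 ^ j)) (η := 2⁻¹ ^ j)
      (ENNReal.mul_ne_top (by simp) ENNReal.ofReal_ne_top) (by simp)
  choose N hN using fun j => hα.exists_eLpNorm_testMul_le hn1 hntop (χ j) (hε0 j)
  let ns : ℕ → ℕ := fun j => ∑ i ∈ Finset.range (j + 1), N i + j
  have hns : ∀ j, ns j ≤ ns (j + 1) := fun j => by
    simp only [ns, Finset.sum_range_succ _ (j + 1)]; omega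
  have hNns : ∀ j, N j ≤ ns j := fun j => by
    simp only [ns, Finset.sum_range_succ _ j]; omega
  have hnst : Tendsto ns atTop atTop :=
    tendsto_atTop_mono (fun j => Nat.le_add_left _ _) tendsto_id
  let a : ℕ → Space n → ℝ := fun j => smoothing Ω α (ns j)
  have ha : ∀ j, ContDiff ℝ (⊤ : ℕ∞) (a j) := fun j => contDiff_smoothing hn1 hα.memLp _
  let ψ : ℕ → 𝓓(Ω, ℝ) := fun j => testMul (χ j) ((ha (j + 1)).sub (ha j))
  have hψK : ∀ j, ∀ x ∈ K j, ψ j x = a (j + 1) x - a j x := fun j x hx => by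
    simp only [ψ, testMul_apply, hχ j x (hKO j hx), one_mul]
  -- `θ j` is nonnegative and at least `1` wherever `|ψ j| > 2 ^ (-j)`, while its `W^{1,n}` norm is
  -- still of order `2 ^ (-j)`.
  let θ : ℕ → 𝓓(Ω, ℝ) := fun j => softTest (2 ^ j) (ψ j)
  have hθn : ∀ j, eLpNorm (θ j) n (volume.restrict (Ω : Set (Space n))) ≤ 2⁻¹ ^ j ∧
      eLpNorm (∇ (θ j)) n (volume.restrict (Ω : Set (Space n))) ≤ 2⁻¹ ^ j := by
    intro j
    obtain ⟨h1, h2⟩ := hN j (ns (j + 1)) ((hNns j).trans (hns j)) (ns j) (hNns j)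
      ((ha (j + 1)).sub (ha j))
    obtain ⟨h3, h4⟩ := eLpNorm_softTest_le (c := 2 ^ j) (by positivity) (ψ j) hn1 h1 h2
    constructor
    · refine (eLpNorm_restrict_le _ _ _ _).trans (h3.trans (le_trans ?_ (hε j)))
      rw [mul_assoc]
      exact le_mul_of_one_le_left' le_self_add
    · refine (eLpNorm_restrict_le _ _ _ _).trans (h4.trans (le_trans ?_ (hε j)))
      rw [mul_assoc]
      gcongr
      exact le_add_self
  -- Off `A N`, consecutive `a j` with `j ≥ N` differ by at most `2 ^ (-j)` on `K j`.
  let A : ℕ → Set (Space n) := fun N => ⋃ j ≥ N, {x | (2 ^ j : ℝ)⁻¹ < |ψ j x|}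
  have hA : ∀ N, IsOpen (A N) := fun N => isOpen_biUnion fun j _ =>
    isOpen_lt continuous_const (ψ j).contDiff.continuous.abs
  have hAΩ : ∀ N, A N ⊆ Ω := by
    intro N x hx
    simp only [A, Set.mem_iUnion, Set.mem_ofPred_eq] at hx
    obtain ⟨j, -, hj⟩ := hx
    by_contra hcon
    rw [TestFunction.eq_zero_of_notMem (ψ j) hcon, abs_zero] at hj
    exact absurd hj (not_lt.2 (by positivity))
  have hexists : ∀ N, ∃ (v : Space n → ℝ) (g : Space n → Space n), IsSobolevZero Ω n v g ∧
      (∀ᵐ x ∂(volume.restrict (Ω : Set (Space n))), x ∈ A N → 1 ≤ v x) ∧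
      eLpNorm v n (volume.restrict (Ω : Set (Space n))) ≤ 2 * 2⁻¹ ^ N ∧
      eLpNorm g n (volume.restrict (Ω : Set (Space n))) ≤ 2 * 2⁻¹ ^ N := by
    intro N
    obtain ⟨v, g, hvg, hv, hvn, hgn⟩ := exists_isSobolevZero_ge hb hn1 (θ := θ)
      (fun j x => mul_nonneg zero_le_two (softSq_nonneg _)) (fun j => (hθn j).1)
      (fun j => (hθn j).2) N
    refine ⟨v, g, hvg, ?_, hvn, hgn⟩
    have hall : ∀ᵐ x ∂(volume.restrict (Ω : Set (Space n))), ∀ j, N ≤ j → θ j x ≤ v x :=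
      ae_all_iff.2 fun j => by
        by_cases hj : N ≤ j
        · filter_upwards [hv j hj] with x hx _ using hx
        · exact ae_of_all _ fun x h => absurd h hj
    filter_upwards [hall] with x hx hxA
    simp only [A, Set.mem_iUnion, Set.mem_ofPred_eq] at hxA
    obtain ⟨j, hj, hjx⟩ := hxA
    refine le_trans ?_ (hx j hj)
    have h1 : 1 ≤ |2 ^ j * ψ j x| := by
      rw [abs_mul, abs_of_pos (by positivity : (0 : ℝ) < 2 ^ j)]
      rw [inv_lt_iff_one_lt_mul₀' (by positivity)] at hjx
      exact hjx.le
    have h2 := half_le_softSq h1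
    simp only [θ, softTest_apply]
    linarith
  have hpow : Tendsto (fun N : ℕ => (2 * (2⁻¹ : ℝ≥0∞) ^ N) ^ n) atTop (𝓝 0) := by
    have h1 : Tendsto (fun N : ℕ => 2 * (2⁻¹ : ℝ≥0∞) ^ N) atTop (𝓝 (2 * 0)) :=
      ENNReal.Tendsto.const_mul (ENNReal.tendsto_pow_atTop_nhds_zero_of_lt_one (by simp))
        (Or.inr (by simp))
    have h2 := (ENNReal.continuous_pow n).tendsto (2 * 0) |>.comp h1
    rwa [mul_zero, zero_pow (by omega)] at h2
  let αt : Space n → ℝ := fun x => limUnder atTop fun j => a j x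
  have hconv : ∀ m N, ∀ x ∈ K m \ A N, Tendsto (fun j => a j x) atTop (𝓝 (αt x)) ∧
      ∀ k, dist (a (max m N + k) x) (αt x) ≤ 2 / 2 ^ k := by
    intro m N x hx
    have hstep : ∀ k, dist (a (max m N + k) x) (a (max m N + (k + 1)) x) ≤ 2 / 2 / 2 ^ k := by
      intro k
      set j := max m N + k with hj
      have hxK : x ∈ K j := hKmono (by omega : m ≤ j) hx.1
      have hxA : |ψ j x| ≤ (2 ^ j)⁻¹ := by
        by_contra hcon
        exact hx.2 (Set.mem_iUnion₂.2 ⟨j, by omega, not_le.1 hcon⟩)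
      rw [dist_comm, Real.dist_eq, ← add_assoc, ← hj, ← hψK j x hxK]
      refine hxA.trans ?_
      rw [div_self two_ne_zero, one_div]
      gcongr
      · norm_num
      · omega
    obtain ⟨l, hl⟩ := cauchySeq_tendsto_of_complete (cauchySeq_of_le_geometric_two hstep)
    have hl' : Tendsto (fun j => a j x) atTop (𝓝 l) := by
      rw [← tendsto_add_atTop_iff_nat (max m N)]
      simpa only [add_comm] using hl
    have e : αt x = l := hl'.limUnder_eq
    rw [e]
    exact ⟨hl', fun k => dist_le_of_le_geometric_two_of_tendsto hstep hl k⟩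
  refine ⟨αt, fun η hη => ?_, ?_⟩
  · obtain ⟨N, hNη⟩ := (hpow.eventually_lt_const hη).exists
    obtain ⟨v, g, hvg, hv, -, hgn⟩ := hexists N
    refine ⟨A N, hAΩ N, ?_, ?_⟩
    · refine (capacity_le hn0 hntop hvg (hA N) (hAΩ N) ?_).trans_lt (lt_of_le_of_lt ?_ hNη)
      · filter_upwards [ae_restrict_of_ae_restrict_of_subset (hAΩ N) hv,
          ae_restrict_mem (hA N).measurableSet] with x h1 h2 using h1 h2
      · rw [ENNReal.toReal_natCast, ENNReal.rpow_natCast]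
        gcongr
    · have hcK : ∀ m, ContinuousOn αt (K m \ A N) := by
        intro m
        have hu : TendstoUniformlyOn (fun k => a (max m N + k)) αt atTop (K m \ A N) := by
          rw [Metric.tendstoUniformlyOn_iff]
          intro r hr
          have h0 : Tendsto (fun k : ℕ => (2 : ℝ) / 2 ^ k) atTop (𝓝 0) :=
            tendsto_const_nhds.div_atTop (tendsto_pow_atTop_atTop_of_one_lt one_lt_two)
          filter_upwards [h0.eventually_lt_const hr] with k hk x hx
          rw [dist_comm]
          exact ((hconv m N x hx).2 k).trans_lt hk
        exact hu.continuousOn (Frequently.of_forall fun k => (ha _).continuous.continuousOn)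
      -- Continuity on each `K m \ A N` suffices, since a point of `K m` is interior to `K (m + 1)`.
      intro x hx
      obtain ⟨m, hm⟩ := Set.mem_iUnion.1 (hKΩ.symm ▸ hx.1 : x ∈ ⋃ j, K j)
      refine (hcK (m + 1) x ⟨interior_subset (hKint m hm), hx.2⟩).mono_of_mem_nhdsWithin ?_
      have h1 : K (m + 1) ∈ 𝓝 x := mem_interior_iff_mem_nhds.1 (hKint m hm)
      filter_upwards [mem_nhdsWithin_of_mem_nhds h1, self_mem_nhdsWithin] with y hy1 hy2
      exact ⟨hy1, hy2.2⟩
  · have hnull : (volume.restrict (Ω : Set (Space n))) (⋂ N, A N) = 0 := by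
      refine le_antisymm (ge_of_tendsto' hpow fun N => ?_) zero_le
      obtain ⟨v, g, hvg, hv, hvn, -⟩ := hexists N
      calc _ ≤ (volume.restrict (Ω : Set (Space n))) (A N) := measure_mono (Set.iInter_subset _ N)
        _ ≤ (volume.restrict (Ω : Set (Space n))) {x | 1 ≤ ‖v x‖ₑ} := by
          refine measure_mono_ae ?_
          filter_upwards [hv] with x hx hxA
          have h1 := (hx hxA).trans (le_abs_self _)
          change 1 ≤ ‖v x‖ₑ
          rw [Real.enorm_eq_ofReal_abs]
          simpa using h1
        _ ≤ eLpNorm v n (volume.restrict (Ω : Set (Space n))) ^ (n : ℝ≥0∞).toReal := by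
          simpa using mul_meas_ge_le_pow_eLpNorm' (volume.restrict (Ω : Set (Space n)))
            hn0 hntop hvg.memLp.1 1
        _ ≤ _ := by
          rw [ENNReal.toReal_natCast, ENNReal.rpow_natCast]
          gcongr
    have hlim : Tendsto (fun j => eLpNorm (a j - α) n (volume.restrict (Ω : Set (Space n)))) atTop
        (𝓝 0) := by
      refine tendsto_of_tendsto_of_tendsto_of_le_of_le tendsto_const_nhds
        ((tendsto_eLpNorm_smoothing_sub hn1 hntop hα.memLp).comp hnst) (fun _ => zero_le)
        fun j => ?_
      refine le_trans (le_of_eq (eLpNorm_congr_ae ?_))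
        (eLpNorm_restrict_le _ _ _ (Ω : Set (Space n)))
      filter_upwards [ae_restrict_mem hΩ] with x hx
      simp [a, hx]
    obtain ⟨ms, hms, hae⟩ := (tendstoInMeasure_of_tendsto_eLpNorm hn0
      (fun j => (ha j).continuous.aestronglyMeasurable) hα.memLp.1 hlim).exists_seq_tendsto_ae
    -- Off the null intersection the `a j` converge to `αt`, and along a subsequence they converge
    -- to `α` almost everywhere.
    filter_upwards [hae, ae_restrict_mem hΩ, compl_mem_ae_iff.2 hnull] with x hx hxΩ hxA
    obtain ⟨N, hxN⟩ : ∃ N, x ∉ A N := by simpa using hxA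
    obtain ⟨m, hm⟩ := Set.mem_iUnion.1 (hKΩ.symm ▸ hxΩ : x ∈ ⋃ j, K j)
    exact tendsto_nhds_unique ((hconv m N x ⟨hm, hxN⟩).1.comp hms.tendsto_atTop) hx

theorem memLp_one_smul {α : Space n → ℝ} (hα : MemLp α ∞ (volume.restrict Ω))
    {u : Space n → Space n} (hu : MemLp u 1 (volume.restrict Ω)) :
    MemLp (fun x => α x • u x) 1 (volume.restrict Ω) := by
  obtain ⟨M, -, hM, -⟩ := exists_abs_smoothing_le hα
  refine hu.of_le_mul (c := M) (hα.1.smul hu.1) ?_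
  filter_upwards [hM] with x hx
  rw [norm_smul]
  gcongr

end

end BDProduct

end

theorem proposition3p5 {n : ℕ} (hn : 2 ≤ n)
    (Ω : TopologicalSpace.Opens (BDProduct.Space n))
    (hΩb : Bornology.IsBounded (Ω : Set (BDProduct.Space n)))
    (hΩL : BDProduct.HasLipschitzBoundary (Ω : Set (BDProduct.Space n)))
    (α : BDProduct.Space n → ℝ) (gradα : BDProduct.Space n → BDProduct.Space n)
    (hα : BDProduct.IsSobolev Ω (n : ℝ≥0∞) α gradα)
    (hα_bdd : MemLp α ∞ (volume.restrict (Ω : Set (BDProduct.Space n))))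
    (u : BDProduct.Space n → BDProduct.Space n) (hu : BDProduct.MemBD Ω u) :
    BDProduct.MemBD Ω (fun x => α x • u x) ∧
    (∃ αt : BDProduct.Space n → ℝ, BDProduct.IsQuasicontinuousRep (n : ℝ≥0∞) Ω α αt) ∧
    IntegrableOn (fun x => BDProduct.symTensor (gradα x) (u x)) (Ω : Set (BDProduct.Space n)) ∧
    ∀ αt : BDProduct.Space n → ℝ, BDProduct.IsQuasicontinuousRep (n : ℝ≥0∞) Ω α αt →
      ∀ Eu : VectorMeasure (BDProduct.Space n) (BDProduct.Mat n), BDProduct.HasStrain Ω u Eu →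
        Eu.Integrable αt ∧
        BDProduct.HasStrain Ω (fun x => α x • u x)
          (BDProduct.scalarMul αt Eu +
            BDProduct.lebesgueDensity Ω
              (fun x => BDProduct.symTensor (gradα x) (u x))) := by
  obtain ⟨hu1, Eu₀, hEu₀⟩ := hu
  obtain ⟨σ, hσ, -⟩ := hEu₀.exists_isStrainDensity
  have : IsFiniteMeasure Eu₀.variation := ⟨hEu₀.variation_lt_top⟩
  -- The Lipschitz boundary enters only here. Integrability is a property of `u`, so it can be used
  -- with any measure representing the strain.
  have hup := hσ.memLp hn hu1 hΩb hΩL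
  obtain ⟨α₀, hα₀⟩ := hα.exists_isQuasicontinuousRep hn hΩb
  exact ⟨⟨BDProduct.memLp_one_smul hα_bdd hu1, _, (hEu₀.smul hn hΩb hup hα hα_bdd hα₀).2⟩,
    ⟨α₀, hα₀⟩, BDProduct.integrable_symTensor hn hup hα.memLp_grad,
    fun αt hαt Eu hEu => hEu.smul hn hΩb hup hα hα_bdd hαt⟩
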